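/- **Setting.** $\mathcal P(K)$ denotes the Borel probability measures on $\mathbb R^d$ supported in $K$, $\mathcal P_c(\mathbb R^d)$ those with compact support, $W_p$ the Wasserstein distances and $\Gamma_o(\mu,\nu)$ the set of optimal plans for the quadratic cost. A function $\phi:\mathcal P_c(\mathbb R^d)\to\mathbb R$ is *Wasserstein-differentiable* at $\mu\in\mathcal P(K)$ over $\mathcal P(K)$ if there is $\xi$ in the tangent space $\overline{\{\nabla\psi:\psi\in C_c^\infty(\mathbb R^d)\}}^{L^2(\mu)}$ with $$\phi(\nu)-\phi(\mu)=\int\langle \xi(x),y-x\rangle\,d\gamma(x,y)+o(W_2(\mu,\nu))\qquad(\nu\in\mathcal P(K),\ \gamma\in\Gamma_o(\mu,\nu)).$$ The tangent vector $\xi$ with this property over $\mathcal P(K)$ for every compact $K$, if it exists, is $\mu$-a.e. unique; it is the Wasserstein gradient $\nabla_\mu\phi(\mu)$. The function $\phi$ is *regular* over $\mathcal P(K)$ if, whenever $\mu_n\to\mu$ in $(\mathcal P(K),W_2)$, $\phi(\mu_n)\to l$, and strong extended subdifferentials $\boldsymbol\gamma_n\in\boldsymbol\partial_S\phi(\mu_n)$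 converge in $W_2$ to $\boldsymbol\gamma\in\mathcal P_2(\mathbb R^{2d})$, one has $l=\phi(\mu)$ and $\boldsymbol\gamma\in\boldsymbol\partial\phi(\mu)$. Here $\boldsymbol\gamma\in\mathcal P_2(\mathbb R^{2d})$ with first marginal $\mu$ belongs to $\boldsymbol\partial_S\phi(\mu)$ if $\phi(\nu)-\phi(\mu)\ge\int\langle x_2,x_3-x_1\rangle d\theta+o\big((\int|x_1-x_3|^2d\theta)^{1/2}\big)$ for all $\nu\in\mathcal P_c(\mathbb R^d)$ and all $\theta$ with $\pi^{1,2}_\#\theta=\boldsymbol\gamma$, $\pi^3_\#\theta=\nu$; it belongs to $\boldsymbol\partial\phi(\mu)$ if $\phi(\nu)-\phi(\mu)\ge\inf_\theta\int\langle x_2,x_3-x_1\rangle d\theta+o(W_2(\mu,\nu))$ for all $\nu\in\mathcal P_c(\mathbb R^d)$, where the infimum runs over those $\theta$ for which moreover $\pi^{1,3}_\#\theta\in\Gamma_o(\mu,\nu)$. **Velocity field.** Let $v:\mathcal P_c(\mathbb R^d)\times\mathbb R\times\mathbb R^d\to\mathbb R^d$, $(\mu,t,x)\mapsto v[\mu](t,x)$,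 be measurable in $t$ and $C^1$ in $x$, and assume (H'): there are $M,L_1,L_2>0$ such that for all $\mu,\nu\in\mathcal P_c(\mathbb R^d)$, $t\in\mathbb R$, $x,y\in\mathbb R^d$ $$|v[\mu](t,x)|\le M(1+|x|),\quad |v[\mu](t,x)-v[\mu](t,y)|\le L_1|x-y|,\quad |v[\mu](t,x)-v[\nu](t,x)|\le L_2W_1(\mu,\nu).$$ Let $T>0$ and $s\in[0,T]$. For $\mu\in\mathcal P_c(\mathbb R^d)$ let $\Phi^v_{(s,t)}[\mu]$ be the flow defined by $\partial_t\Phi^v_{(s,t)}[\mu](x)=v[\mu(t)]\big(t,\Phi^v_{(s,t)}[\mu](x)\big)$, $\Phi^v_{(s,s)}[\mu](x)=x$, where $\mu(t)=\Phi^v_{(s,t)}[\mu]_\#\mu$; thus $\mu(\cdot)$ solves $\partial_t\mu(t)+\nabla\cdot(v[\mu(t)](t,\cdot)\mu(t))=0$, $\mu(s)=\mu$. All evolution equations are meant in the Carathéodory (integral) sense. Assume moreover that for every compact $K'\subset\mathbb R^d$ and every $i\in\{1,\dots,d\}$ the maps $\mu\mapsto v^i[\mu](t,x)$, $(t,x)\in[0,T]\times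 K'$, are regular over $\mathcal P(K')$ and Wasserstein-differentiable over $\mathcal P(K')$ at every point of $\mathcal P(K')$, with a remainder that is uniform in $(t,x)\in[0,T]\times K'$. **Perturbations.** Let $K\subset\mathbb R^d$ be compact, $\mu\in\mathcal P(K)$, $N\ge1$, $\epsilon>0$, and let $\mathcal G\in C^0([-\epsilon,\epsilon]^N\times K,\mathbb R^d)$ satisfy: $\mathcal G(0,\cdot)=\mathrm{Id}$ on $K$; $e\mapsto\mathcal G(e,x)$ is Fréchet-differentiable at $e=0$ uniformly in $x\in K$, with continuous partial derivatives $\mathcal F_k=\partial_{e_k}\mathcal G(0,\cdot):K\to\mathbb R^d$; and $\operatorname{supp}(\mathcal G(e,\cdot)_\#\mu)\subset K$ for all $e\in[-\epsilon,\epsilon]^N$. **Conclusion.** For each $k\in\{1,\dots,N\}$ there is a unique $w_k\in C^0([0,T]\times\mathbb R^d,\mathbb R^d)$ that solves, for all $x\in\mathbb R^d$, $$\partial_tw_k(t,x)=D_xv[\mu(t)]\big(t,\Phi_t(x)\big)w_k(t,x)+\int_{\mathbb R^d}\Gamma_{(t,\Phi_t(x))}\big(\Phi_t(y)\big)\Big(D_x\Phi_t(y)\,\mathcal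 F_k(y)+w_k(t,y)\Big)d\mu(y),\qquad w_k(s,x)=0,$$ where $\Phi_t=\Phi^v_{(s,t)}[\mu]$ and $\big(\Gamma_{(t,x)}(y)\big)_{i,j}=\big(\nabla_\mu(v^i[\cdot](t,x))(\mu(t))(y)\big)_j$. Moreover, for all $t\in[0,T]$ and $x\in\mathbb R^d$, the map $e\in[-\epsilon,\epsilon]^N\mapsto\Phi^v_{(s,t)}[\mathcal G(e,\cdot)_\#\mu](x)$ is Fréchet-differentiable at $e=0$, and its differential in the direction $\sigma$ is $\sum_{k=1}^N\sigma_kw_k(t,x)$. -/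

import Mathlib

open MeasureTheory Set Filter Topology
open scoped ENNReal

noncomputable section

/-- The Euclidean space `ℝ^d`. -/
abbrev Rd (d : ℕ) : Type := EuclideanSpace ℝ (Fin d)

/-! ### Probability measures, transport plans, Wasserstein distances -/

/-- `μ ∈ 𝒫(K)`: a Borel probability measure carried by `K`
(for closed `K`: whose support is contained in `K`). -/
def ProbOn {d : ℕ} (K : Set (Rd d)) (μ : Measure (Rd d)) : Prop :=
  IsProbabilityMeasure μ ∧ μ Kᶜ = 0

/-- `μ ∈ 𝒫_c(ℝ^d)`: a Borel probability measure with compact support. -/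
def ProbCompact {d : ℕ} (μ : Measure (Rd d)) : Prop :=
  ∃ K : Set (Rd d), IsCompact K ∧ ProbOn K μ

/-- `Γ(μ, ν)`: the transport plans between `μ` and `ν`. -/
def transportPlans {X Y : Type*} [MeasurableSpace X] [MeasurableSpace Y]
    (μ : Measure X) (ν : Measure Y) : Set (Measure (X × Y)) :=
  {γ | γ.map Prod.fst = μ ∧ γ.map Prod.snd = ν}

/-- `∫ |x - y|^p dγ(x, y)`. -/
def transportCost {X : Type*} [MeasurableSpace X] [PseudoEMetricSpace X]
    (p : ℝ) (γ : Measure (X × X)) : ℝ≥0∞ :=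
  ∫⁻ z, edist z.1 z.2 ^ p ∂γ

/-- The Wasserstein distance `W_p(μ, ν)`, as a real number
(it is finite on measures with finite `p`-th moment). -/
def wassersteinDist {X : Type*} [MeasurableSpace X] [PseudoEMetricSpace X]
    (p : ℝ) (μ ν : Measure X) : ℝ :=
  ((⨅ γ ∈ transportPlans μ ν, transportCost p γ) ^ (1 / p)).toReal

/-- `Γ_o(μ, ν)`: the transport plans that are optimal for the quadratic cost. -/
def optimalPlans {d : ℕ} (μ ν : Measure (Rd d)) : Set (Measure (Rd d × Rd d)) :=
  {γ | γ ∈ transportPlans μ ν ∧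
    ∀ γ' ∈ transportPlans μ ν, transportCost 2 γ ≤ transportCost 2 γ'}

/-! ### Extended subdifferentials and regular functionals

Functionals are defined on `𝒫_c(ℝ^d)`; their values at other measures are never used. -/

/-- `𝒫_2(ℝ^d × ℝ^d)`. -/
def ProbTwo {d : ℕ} (γ : Measure (Rd d × Rd d)) : Prop :=
  IsProbabilityMeasure γ ∧ ∫⁻ z, ‖z‖ₑ ^ 2 ∂γ < ∞

/-- `Γ(γ, ν)` for a plan `γ`: the 3-plans on `(x₁, (x₂, x₃))` whose marginal on `(x₁, x₂)`
is `γ` and whose marginal on `x₃` is `ν`. -/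
def threePlans {d : ℕ} (γ : Measure (Rd d × Rd d)) (ν : Measure (Rd d)) :
    Set (Measure (Rd d × Rd d × Rd d)) :=
  {θ | θ.map (fun z => (z.1, z.2.1)) = γ ∧ θ.map (fun z => z.2.2) = ν}

/-- `Γ_o^{1,3}(γ, ν)`: the 3-plans whose marginal on `(x₁, x₃)` is optimal. -/
def optimalThreePlans {d : ℕ} (γ : Measure (Rd d × Rd d)) (ν : Measure (Rd d)) :
    Set (Measure (Rd d × Rd d × Rd d)) :=
  {θ | θ ∈ threePlans γ ν ∧
    θ.map (fun z => (z.1, z.2.2)) ∈ optimalPlans (γ.map Prod.fst) ν}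

/-- `∫ ⟨x₂, x₃ - x₁⟩ dθ`. -/
def threePlanPairing {d : ℕ} (θ : Measure (Rd d × Rd d × Rd d)) : ℝ :=
  ∫ z, inner ℝ z.2.1 (z.2.2 - z.1) ∂θ

/-- `γ` belongs to the extended subdifferential of `φ` at `μ`. -/
def IsExtendedSubdifferential {d : ℕ} (φ : Measure (Rd d) → ℝ) (μ : Measure (Rd d))
    (γ : Measure (Rd d × Rd d)) : Prop :=
  ProbTwo γ ∧ γ.map Prod.fst = μ ∧
  ∀ ε > 0, ∃ δ > 0, ∀ ν, ProbCompact ν → wassersteinDist 2 μ ν < δ →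
    sInf (threePlanPairing '' optimalThreePlans γ ν) - ε * wassersteinDist 2 μ ν
      ≤ φ ν - φ μ

/-- `γ` belongs to the strong extended subdifferential of `φ` at `μ`. -/
def IsStrongSubdifferential {d : ℕ} (φ : Measure (Rd d) → ℝ) (μ : Measure (Rd d))
    (γ : Measure (Rd d × Rd d)) : Prop :=
  ProbTwo γ ∧ γ.map Prod.fst = μ ∧
  ∀ ε > 0, ∃ δ > 0, ∀ ν, ProbCompact ν → ∀ θ ∈ threePlans γ ν,
    √(∫ z, ‖z.1 - z.2.2‖ ^ 2 ∂θ) < δ →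
      threePlanPairing θ - ε * √(∫ z, ‖z.1 - z.2.2‖ ^ 2 ∂θ) ≤ φ ν - φ μ

/-- `φ` is regular over `𝒫(K)`: limits of strong subdifferentials at measures of `𝒫(K)` are
extended subdifferentials. (The product `ℝ^d × ℝ^d` carries the maximum norm here; it is
equivalent to the Euclidean one, and only `W_2`-convergence of plans is used.) -/
def IsRegularOn {d : ℕ} (K : Set (Rd d)) (φ : Measure (Rd d) → ℝ) : Prop :=
  ∀ (μs : ℕ → Measure (Rd d)) (μ : Measure (Rd d))
    (γs : ℕ → Measure (Rd d × Rd d)) (γ : Measure (Rd d × Rd d)) (l : ℝ),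
    (∀ n, ProbOn K (μs n)) → ProbOn K μ →
    Tendsto (fun n => wassersteinDist 2 (μs n) μ) atTop (𝓝 0) →
    Tendsto (fun n => φ (μs n)) atTop (𝓝 l) →
    (∀ n, IsStrongSubdifferential φ (μs n) (γs n)) → ProbTwo γ →
    Tendsto (fun n => wassersteinDist 2 (γs n) γ) atTop (𝓝 0) →
    IsExtendedSubdifferential φ μ γ ∧ l = φ μ

/-! ### Wasserstein gradients -/

/-- `ξ` belongs to the tangent space of `𝒫_2(ℝ^d)` at `μ`, the `L²(μ)`-closure of the
gradients of smooth compactly supported functions. -/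
def IsTangent {d : ℕ} (μ : Measure (Rd d)) (ξ : Rd d → Rd d) : Prop :=
  MemLp ξ 2 μ ∧ ∀ ε > 0, ∃ ψ : Rd d → ℝ, ContDiff ℝ (⊤ : ℕ∞) ψ ∧ HasCompactSupport ψ ∧
    eLpNorm (fun x => ξ x - gradient ψ x) 2 μ ≤ ENNReal.ofReal ε

/-- `ξ a ∈ ∂⁻(φ a)(μ)` (classical subdifferential) for the functionals `φ a` restricted to
`𝒫(K)`, with a remainder `o(W_2(μ, ν))` that is uniform in `a ∈ S`. The supremum over the
optimal plans is written as a bound for each of them. -/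
def IsSubgradientOn {d : ℕ} {ι : Type*} (K : Set (Rd d)) (S : Set ι)
    (φ : ι → Measure (Rd d) → ℝ) (μ : Measure (Rd d)) (ξ : ι → Rd d → Rd d) : Prop :=
  ∀ ε > 0, ∃ δ > 0, ∀ a ∈ S, ∀ ν, ProbOn K ν → wassersteinDist 2 μ ν < δ →
    ∀ γ ∈ optimalPlans μ ν,
      ∫ z, inner ℝ (ξ a z.1) (z.2 - z.1) ∂γ - ε * wassersteinDist 2 μ ν ≤ φ a ν - φ a μ

/-- `ξ a ∈ ∂⁻(φ a)(μ) ∩ ∂⁺(φ a)(μ)` is a tangent vector, for all `a ∈ S`, where the `φ a` are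
restricted to `𝒫(K)` and the remainders are uniform in `a ∈ S`. Tangency is what makes the
gradient unique. -/
def HasWassersteinGradientOn {d : ℕ} {ι : Type*} (K : Set (Rd d)) (S : Set ι)
    (φ : ι → Measure (Rd d) → ℝ) (μ : Measure (Rd d)) (ξ : ι → Rd d → Rd d) : Prop :=
  (∀ a ∈ S, IsTangent μ (ξ a)) ∧ IsSubgradientOn K S φ μ ξ ∧
    IsSubgradientOn K S (fun a ν => -φ a ν) μ (fun a x => -ξ a x)

/-- The functionals `φ a` are Wasserstein-differentiable over `𝒫(K)`,
uniformly with respect to `a ∈ S`. -/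
def IsWassersteinDifferentiableOn {d : ℕ} {ι : Type*} (K : Set (Rd d)) (S : Set ι)
    (φ : ι → Measure (Rd d) → ℝ) : Prop :=
  ∀ μ, ProbOn K μ → ∃ ξ : ι → Rd d → Rd d, HasWassersteinGradientOn K S φ μ ξ

/-- `ξ` is the Wasserstein gradient at `μ` of the functional `φ` on `𝒫_c(ℝ^d)`. -/
def IsWassersteinGradient {d : ℕ} (φ : Measure (Rd d) → ℝ) (μ : Measure (Rd d))
    (ξ : Rd d → Rd d) : Prop :=
  ∀ K : Set (Rd d), IsCompact K →
    HasWassersteinGradientOn K (univ : Set Unit) (fun _ => φ) μ (fun _ => ξ)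

open Classical in
/-- `∇_μ φ(μ)`: a representative of the (`μ`-a.e. unique) Wasserstein gradient,
and `0` if `φ` is not differentiable at `μ`. -/
def wassersteinGradient {d : ℕ} (φ : Measure (Rd d) → ℝ) (μ : Measure (Rd d)) :
    Rd d → Rd d :=
  if h : ∃ ξ, IsWassersteinGradient φ μ ξ then h.choose else 0

/-! ### Non-local velocity fields and their flows -/

/-- Hypotheses (H') on a non-local velocity field `μ ↦ v[μ](t, x)`: for `μ ∈ 𝒫_c(ℝ^d)` it is
measurable in time, `C¹` in space, sublinear and Lipschitz in `x`, and `W_1`-Lipschitz in `μ`. -/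
structure HypothesesH {d : ℕ} (v : Measure (Rd d) → ℝ → Rd d → Rd d) : Prop where
  measurable_time : ∀ μ, ProbCompact μ → ∀ x,
    AEStronglyMeasurable (fun t => v μ t x) (volume : Measure ℝ)
  contDiff_space : ∀ μ, ProbCompact μ → ∀ t, ContDiff ℝ 1 (v μ t)
  sublinear : ∃ M > 0, ∀ μ, ProbCompact μ → ∀ t x, ‖v μ t x‖ ≤ M * (1 + ‖x‖)
  lipschitz_space : ∃ L₁ > 0, ∀ μ, ProbCompact μ → ∀ t x y,
    ‖v μ t x - v μ t y‖ ≤ L₁ * ‖x - y‖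
  lipschitz_measure : ∃ L₂ > 0, ∀ μ ν, ProbCompact μ → ProbCompact ν → ∀ t x,
    ‖v μ t x - v ν t x‖ ≤ L₂ * wassersteinDist 1 μ ν

/-- `Φ t` is the flow map from time `s` to time `t` of the field `(t, x) ↦ v[μ(t)](t, x)`, where
`μ(t) = (Φ t)_# μ` is the curve with `μ(s) = μ` transported by this field. The equation
`∂ₜ Φ t x = v[μ(t)](t, Φ t x)`, `Φ s x = x`, is meant in the Carathéodory sense. -/
def IsNonlocalFlow {d : ℕ} (v : Measure (Rd d) → ℝ → Rd d → Rd d) (s : ℝ)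
    (μ : Measure (Rd d)) (Φ : ℝ → Rd d → Rd d) : Prop :=
  (∀ t, Continuous (Φ t)) ∧ ∀ t x,
    IntervalIntegrable (fun τ => v (μ.map (Φ τ)) τ (Φ τ x)) volume s t ∧
    Φ t x = x + ∫ τ in s..t, v (μ.map (Φ τ)) τ (Φ τ x)

open Classical in
/-- The flow `Φ^v_{(s,t)}[μ](x)`, where `μ` is the measure at time `s`
(the identity if there is no such flow). -/
def nonlocalFlow {d : ℕ} (v : Measure (Rd d) → ℝ → Rd d → Rd d) (s : ℝ)
    (μ : Measure (Rd d)) : ℝ → Rd d → Rd d :=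
  if h : ∃ Φ, IsNonlocalFlow v s μ Φ then h.choose else fun _ x => x

/-- The curve `t ↦ μ(t) = Φ^v_{(s,t)}[μ]_# μ`, solution of
`∂ₜ μ(t) + ∇ · (v[μ(t)](t, ·) μ(t)) = 0`, `μ(s) = μ`. -/
def nonlocalCurve {d : ℕ} (v : Measure (Rd d) → ℝ → Rd d → Rd d) (s : ℝ)
    (μ : Measure (Rd d)) (t : ℝ) : Measure (Rd d) :=
  μ.map (nonlocalFlow v s μ t)

/-- The matrix whose `i`-th row is the Wasserstein gradient of the component `v^i[·](t, x)`
at the measure `ρ`, evaluated at `y`. -/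
def wassersteinMatrix {d : ℕ} (v : Measure (Rd d) → ℝ → Rd d → Rd d)
    (ρ : Measure (Rd d)) (t : ℝ) (x y : Rd d) : Matrix (Fin d) (Fin d) ℝ :=
  Matrix.of fun i j => wassersteinGradient (fun ν => v ν t x i) ρ y j

/-! ### Perturbations of the initial measure and the linearized problem -/

/-- The cube `[-ε, ε]^N`. -/
def cube (N : ℕ) (ε : ℝ) : Set (EuclideanSpace ℝ (Fin N)) := {e | ∀ k, |e k| ≤ ε}

/-- `G ∈ C⁰([-ε, ε]^N × K, ℝ^d)` is a perturbation of the identity keeping `μ` in `𝒫(K)`, which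
is Fréchet-differentiable at `e = 0` uniformly in `x ∈ K`, with continuous partial
derivatives `F k`. -/
structure IsPerturbation {d N : ℕ} (K : Set (Rd d)) (ε : ℝ) (μ : Measure (Rd d))
    (G : EuclideanSpace ℝ (Fin N) → Rd d → Rd d) (F : Fin N → Rd d → Rd d) : Prop where
  continuousOn : ContinuousOn (fun p : EuclideanSpace ℝ (Fin N) × Rd d => G p.1 p.2)
    (cube N ε ×ˢ K)
  map_zero : ∀ x ∈ K, G 0 x = x
  differentiable : ∀ η > 0, ∃ δ > 0, ∀ e ∈ cube N ε, ‖e‖ < δ → ∀ x ∈ K,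
    ‖G e x - G 0 x - ∑ k, e k • F k x‖ ≤ η * ‖e‖
  support : ∀ e ∈ cube N ε, (μ.map (G e)) Kᶜ = 0
  continuousOn_deriv : ∀ k, ContinuousOn (F k) K

/-- The right-hand side of the linearized non-local problem at time `t`, for the unknown
`w t : ℝ^d → ℝ^d` and the direction `F : K → ℝ^d`. -/
def linearizedField {d : ℕ} (v : Measure (Rd d) → ℝ → Rd d → Rd d) (s : ℝ)
    (μ : Measure (Rd d)) (F : Rd d → Rd d) (w : ℝ → Rd d → Rd d) (t : ℝ) (x : Rd d) : Rd d :=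
  fderiv ℝ (v (nonlocalCurve v s μ t) t) (nonlocalFlow v s μ t x) (w t x) +
    ∫ y, Matrix.toEuclideanLin
      (wassersteinMatrix v (nonlocalCurve v s μ t) t (nonlocalFlow v s μ t x)
        (nonlocalFlow v s μ t y))
      (fderiv ℝ (nonlocalFlow v s μ t) y (F y) + w t y) ∂μ

/-- `w ∈ C⁰([0, T] × ℝ^d, ℝ^d)` solves the linearized non-local Cauchy problem with
`w(s, ·) = 0` (in the Carathéodory sense). -/
def IsLinearizedSolution {d : ℕ} (v : Measure (Rd d) → ℝ → Rd d → Rd d) (T s : ℝ)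
    (μ : Measure (Rd d)) (F : Rd d → Rd d) (w : ℝ → Rd d → Rd d) : Prop :=
  ContinuousOn (fun p : ℝ × Rd d => w p.1 p.2) (Icc 0 T ×ˢ univ) ∧
  ∀ t ∈ Icc 0 T, ∀ x,
    IntervalIntegrable (fun τ => linearizedField v s μ F w τ x) volume s t ∧
    w t x = ∫ τ in s..t, linearizedField v s μ F w τ x

end

noncomputable section

/-! ### Kantorovich–Rubinstein duality -/

section Duality

variable {X : Type*} [MetricSpace X] [CompactSpace X] [MeasurableSpace X] [BorelSpace X]

/-! Wasserstein differentiability controls `v` only along optimal plans, whereas the perturbed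
curves are images of `μ` under maps close to `Φ_t` that have no reason to be optimal. The heart of
the proof is that, for a functional which is also `W_1`-Lipschitz, the first-order expansion holds
along every perturbation `Φ + ∑ e_k Z_k` of a continuous injection
(`HasWassersteinGradientOn.expansion_map`).

To see this, write `m = Φ_# μ`. Injectivity lets each `Z_k` be approximated by `H_k ∘ Φ` with `H_k`
smooth, and the `W_1`-Lipschitz bound pays for the difference. In `L²(m)`, split `H_k` into a
gradient `∇ψ_k`, a field `q_k` orthogonal to the tangent space, and a small remainder. Small
gradient perturbations of the identity are optimal (`map_id_add_mem_optimalPlans`), so the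
hypothesis applies to them. The field `q_k` satisfies a weak divergence-free condition with respect
to `m`, so moving along it changes `m` only at second order in `W_1`
(`wassersteinDist_one_map_id_add_le`). This last estimate uses Kantorovich–Rubinstein duality with
smooth test functions. Finally `q_k` pairs to zero with the Wasserstein gradient, which is tangent,
so only the pairing with `Z_k` itself survives.

Consequently `v` is differentiable along curves of maps, locally uniformly in the position. Its
nonlocal derivative is a limit of difference quotients, from which it inherits the `L¹(μ)` bound,
continuity in space and measurability in time. With these properties the linearized problem is a
linear Volterra equation, solved by a contraction in an exponentially weighted norm.

For differentiability, `Z_k = DΦ_t F_k + w_k` is the direction in which the transported points move.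
The remainder `Ψ_t(G(e, y)) - Φ_t(y) - ∑ e_k Z_k(t, y)`, with `Ψ` the perturbed flow, satisfies a
Grönwall inequality containing its own mean over `μ`. The linearization error of `v` is `o(e)`
pointwise and `O(e)` uniformly, so dominated convergence in time and then in `y` shows that the mean
is `o(e)`. Inserting this in the same inequality along the trajectory of a fixed `x`, with `w_k` in
place of `Z_k`, gives the differential. -/

theorem integral_add_integral_le_of_lipschitz_bound (μ ν : Measure X) [IsProbabilityMeasure μ]
    [IsProbabilityMeasure ν] {c : ℝ}
    (h : ∀ φ : X → ℝ, LipschitzWith 1 φ → ∫ x, φ x ∂μ - ∫ x, φ x ∂ν ≤ c)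
    (φ ψ : C(X, ℝ)) (hφψ : ∀ x y, φ x + ψ y ≤ dist x y) :
    ∫ x, φ x ∂μ + ∫ x, ψ x ∂ν ≤ c := by
  have hne : Nonempty X := nonempty_of_isProbabilityMeasure μ
  have hbdd : ∀ x, BddBelow (range fun y => dist x y - ψ y) := fun x =>
    ⟨φ x, by rintro _ ⟨y, rfl⟩; linarith [hφψ x y]⟩
  -- The c-transform of `ψ` replaces the pair by one 1-Lipschitz function: `φ ≤ χ` by the
  -- constraint, and `ψ ≤ -χ` by taking `y = x` in the infimum.
  set χ : X → ℝ := fun x => ⨅ y, (dist x y - ψ y) with hχ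
  have hlip : LipschitzWith 1 χ := by
    apply LipschitzWith.of_le_add
    intro x x'
    rw [← sub_le_iff_le_add]
    apply le_ciInf
    intro y
    have := ciInf_le (hbdd x) y
    have h2 := dist_triangle x x' y
    simp only [hχ]
    linarith
  have hint : ∀ (f : X → ℝ) (ρ : Measure X) [IsProbabilityMeasure ρ], Continuous f →
      Integrable f ρ := fun f ρ _ hf => by
    rw [← integrableOn_univ]
    exact hf.continuousOn.integrableOn_compact isCompact_univ
  have h1 : ∫ x, φ x ∂μ ≤ ∫ x, χ x ∂μ := by
    refine integral_mono (hint _ _ φ.continuous) (hint _ _ hlip.continuous) fun x => ?_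
    exact le_ciInf fun y => by linarith [hφψ x y]
  have h2 : ∫ x, ψ x ∂ν ≤ - ∫ x, χ x ∂ν := by
    rw [← integral_neg]
    refine integral_mono (hint _ _ ψ.continuous) (hint _ _ hlip.continuous).neg fun x => ?_
    have := ciInf_le (hbdd x) x
    simp only [dist_self] at this
    simp only [hχ]
    linarith
  linarith [h χ hlip]

theorem integral_add_integral_le_mul_of_lipschitz_bound (μ ν : Measure X)
    [IsProbabilityMeasure μ] [IsProbabilityMeasure ν] {c : ℝ}
    (h : ∀ φ : X → ℝ, LipschitzWith 1 φ → ∫ x, φ x ∂μ - ∫ x, φ x ∂ν ≤ c)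
    (φ ψ : C(X, ℝ)) {r : ℝ} (hr : 0 ≤ r) (hφψ : ∀ x y, φ x + ψ y ≤ r * dist x y) :
    ∫ x, φ x ∂μ + ∫ x, ψ x ∂ν ≤ r * c := by
  have hpos : ∀ r : ℝ, 0 < r → (∀ x y, φ x + ψ y ≤ r * dist x y) →
      ∫ x, φ x ∂μ + ∫ x, ψ x ∂ν ≤ r * c := by
    intro r hr hφψ
    have := integral_add_integral_le_of_lipschitz_bound μ ν h (r⁻¹ • φ) (r⁻¹ • ψ) (fun x y => by
      simp only [ContinuousMap.smul_apply, smul_eq_mul]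
      rw [← mul_add, inv_mul_le_iff₀ hr]
      exact hφψ x y)
    simp only [ContinuousMap.smul_apply, smul_eq_mul, integral_const_mul] at this
    rwa [← mul_add, inv_mul_le_iff₀ hr] at this
  rcases hr.eq_or_lt with rfl | hr
  -- For `r = 0` rescaling is impossible, but the constraint then holds for every positive `r`, and
  -- the bound passes to the limit `r → 0⁺`.
  · have hlim : Tendsto (fun r : ℝ => r * c) (𝓝[>] 0) (𝓝 (0 * c)) :=
      ((continuous_id.mul continuous_const).tendsto 0).mono_left nhdsWithin_le_nhds
    refine ge_of_tendsto hlim ?_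
    filter_upwards [self_mem_nhdsWithin] with r (hr : 0 < r)
    refine hpos r hr fun x y => ?_
    have := hφψ x y
    have h2 : 0 ≤ r * dist x y := by positivity
    linarith
  · exact hpos r hr hφψ

/-- A Hahn–Banach argument: the functional prescribed by the marginals on the functions `φ(x) +
ψ(y)` extends to one that is nonnegative on a suitable cone, and Riesz–Markov represents the
extension by a plan. -/
theorem exists_transportPlan_integral_dist_le (μ ν : Measure X) [IsProbabilityMeasure μ]
    [IsProbabilityMeasure ν] {c : ℝ}
    (h : ∀ φ : X → ℝ, LipschitzWith 1 φ → ∫ x, φ x ∂μ - ∫ x, φ x ∂ν ≤ c) :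
    ∃ γ ∈ transportPlans μ ν, IsProbabilityMeasure γ ∧ ∫ z, dist z.1 z.2 ∂γ ≤ c := by
  have hint : ∀ (f : C(X × X, ℝ)) (ρ : Measure (X × X)) [IsFiniteMeasure ρ],
      Integrable f ρ := fun f ρ _ => by
    rw [← integrableOn_univ]
    exact f.continuous.continuousOn.integrableOn_compact isCompact_univ
  let A : (C(X, ℝ) × C(X, ℝ)) →ₗ[ℝ] C(X × X, ℝ) :=
    { toFun := fun p => p.1.comp ContinuousMap.fst + p.2.comp ContinuousMap.snd
      map_add' := fun p q => by ext z; simp; ring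
      map_smul' := fun a p => by ext z; simp }
  -- Integration against the product measure is only a convenient way to have a well-defined
  -- functional. It matters on the range of `A` alone, where any plan with the same marginals would
  -- give the same values.
  let I : C(X × X, ℝ) →ₗ[ℝ] ℝ :=
    { toFun := fun f => ∫ z, f z ∂(μ.prod ν)
      map_add' := fun f g => integral_add (hint f _) (hint g _)
      map_smul' := fun a f => integral_const_mul a _ }
  have hIA : ∀ φ ψ : C(X, ℝ), I (A (φ, ψ)) = ∫ x, φ x ∂μ + ∫ x, ψ x ∂ν := by
    intro φ ψ
    change ∫ z, (φ z.1 + ψ z.2) ∂(μ.prod ν) = _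
    rw [integral_add (f := fun z : X × X => φ z.1) (g := fun z : X × X => ψ z.2)
      (hint (φ.comp ContinuousMap.fst) _) (hint (ψ.comp ContinuousMap.snd) _)]
    rw [integral_fun_fst (fun x => φ x), integral_fun_snd (fun x => ψ x)]
    simp
  -- The cone contains the nonnegative functions (`r = 0`) and `c - dist` (`r = 1`), so
  -- nonnegativity on it encodes both the positivity of the plan and the bound on its cost.
  let S : PointedCone ℝ C(X × X, ℝ) :=
    { carrier := {F | ∃ r : ℝ, 0 ≤ r ∧ ∀ x y, r * (c - dist x y) ≤ F (x, y)}
      add_mem' := by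
        rintro F F' ⟨r, hr, hF⟩ ⟨r', hr', hF'⟩
        refine ⟨r + r', add_nonneg hr hr', fun x y => ?_⟩
        have := hF x y
        have := hF' x y
        simp only [ContinuousMap.add_apply]
        linarith
      zero_mem' := ⟨0, le_rfl, fun x y => by simp⟩
      smul_mem' := by
        rintro ⟨a, ha⟩ F ⟨r, hr, hF⟩
        refine ⟨a * r, mul_nonneg ha hr, fun x y => ?_⟩
        have := mul_le_mul_of_nonneg_left (hF x y) ha
        change a * r * (c - dist x y) ≤ a * F (x, y)
        linarith }
  obtain ⟨g, hg, hgS⟩ := riesz_extension S (I.toPMap (LinearMap.range A)) (by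
      rintro ⟨_, ⟨⟨φ, ψ⟩, rfl⟩⟩ ⟨r, hr, hF⟩
      change 0 ≤ I (A (φ, ψ))
      rw [hIA]
      -- Nonnegativity on the range of `A` is the dual bound for the pair `(r c - φ, -ψ)`, since `r
      -- (c - dist) ≤ φ + ψ` is exactly its constraint.
      have := integral_add_integral_le_mul_of_lipschitz_bound μ ν h
        (ContinuousMap.const X (r * c) - φ) (-ψ) hr (fun x y => by
          have := hF x y
          change r * (c - dist x y) ≤ φ x + ψ y at this
          simp only [ContinuousMap.sub_apply, ContinuousMap.const_apply, ContinuousMap.neg_apply]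
          linarith)
      simp only [ContinuousMap.sub_apply, ContinuousMap.const_apply,
        ContinuousMap.neg_apply, integral_neg] at this
      rw [integral_sub (integrable_const _) ?_] at this
      · simp at this
        linarith
      · rw [← integrableOn_univ]
        exact φ.continuous.continuousOn.integrableOn_compact isCompact_univ) (by
      intro F
      -- The range of `A` contains the constants, so every `F` is moved into the cone by adding
      -- `‖F‖`.
      refine ⟨⟨A (ContinuousMap.const X ‖F‖, 0), ⟨_, rfl⟩⟩, 0, le_rfl, fun x y => ?_⟩
      have := F.neg_norm_le_apply (x, y)
      change 0 * (c - dist x y) ≤ ‖F‖ + 0 + F (x, y)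
      linarith)
  have hgA : ∀ φ ψ : C(X, ℝ), g (A (φ, ψ)) = ∫ x, φ x ∂μ + ∫ x, ψ x ∂ν := fun φ ψ => by
    rw [← hIA]
    exact hg ⟨A (φ, ψ), ⟨_, rfl⟩⟩
  have hgpos : ∀ F : C(X × X, ℝ), (∀ z, 0 ≤ F z) → 0 ≤ g F := fun F hF =>
    hgS F ⟨0, le_rfl, fun x y => by simpa using hF (x, y)⟩
  open CompactlySupported in
  let Λ : C_c(X × X, ℝ) →ₚ[ℝ] ℝ :=
    { toFun := fun f => g f.toContinuousMap
      map_add' := fun f f' => g.map_add f.toContinuousMap f'.toContinuousMap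
      map_smul' := fun a f => g.map_smul a f.toContinuousMap
      monotone' := fun f f' hff' => by
        have h0 := hgpos (f'.toContinuousMap - f.toContinuousMap)
          (fun z => sub_nonneg.2 (hff' z))
        rw [map_sub] at h0
        exact sub_nonneg.1 h0 }
  have hΛ : ∀ F : C(X × X, ℝ), ∫ z, F z ∂(RealRMK.rieszMeasure Λ) = g F := fun F =>
    RealRMK.integral_rieszMeasure Λ ⟨F, HasCompactSupport.of_compactSpace F⟩
  have hfst : (RealRMK.rieszMeasure Λ).map Prod.fst = μ := by
    apply ext_of_forall_integral_eq_of_IsFiniteMeasure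
    intro f
    rw [integral_map measurable_fst.aemeasurable f.continuous.aestronglyMeasurable]
    have := hΛ (A (f.toContinuousMap, 0))
    rw [hgA] at this
    change ∫ z : X × X, (f z.1 + 0) ∂(RealRMK.rieszMeasure Λ) = ∫ x, f x ∂μ + ∫ x, (0 : ℝ) ∂ν
      at this
    simpa using this
  have hsnd : (RealRMK.rieszMeasure Λ).map Prod.snd = ν := by
    apply ext_of_forall_integral_eq_of_IsFiniteMeasure
    intro f
    rw [integral_map measurable_snd.aemeasurable f.continuous.aestronglyMeasurable]
    have := hΛ (A (0, f.toContinuousMap))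
    rw [hgA] at this
    change ∫ z : X × X, (0 + f z.2) ∂(RealRMK.rieszMeasure Λ) = ∫ x, (0 : ℝ) ∂μ + ∫ x, f x ∂ν
      at this
    simpa using this
  refine ⟨RealRMK.rieszMeasure Λ, ⟨hfst, hsnd⟩, ⟨?_⟩, ?_⟩
  · have h1 := Measure.map_apply_of_aemeasurable (μ := RealRMK.rieszMeasure Λ)
      (measurable_fst (α := X) (β := X)).aemeasurable MeasurableSet.univ
    rw [hfst, measure_univ, preimage_univ] at h1
    exact h1.symm
  · let D : C(X × X, ℝ) := ⟨fun z => dist z.1 z.2, continuous_dist⟩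
    have h1 := hgS (A (ContinuousMap.const X c, 0) - D) ⟨1, zero_le_one, fun x y => by
      change 1 * (c - dist x y) ≤ c + 0 - dist x y
      linarith⟩
    rw [map_sub, hgA] at h1
    have h2 := hΛ D
    change ∫ z : X × X, dist z.1 z.2 ∂(RealRMK.rieszMeasure Λ) = _ at h2
    rw [h2]
    simp at h1
    exact h1

end Duality

/-! ### Estimates for the Wasserstein distances -/

theorem wassersteinDist_le_of_plan {X : Type*} [MeasurableSpace X] [PseudoEMetricSpace X]
    {p : ℝ} (hp : 0 < p) {μ ν : Measure X} {γ : Measure (X × X)} (hγ : γ ∈ transportPlans μ ν)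
    (hfin : transportCost p γ ≠ ∞) :
    wassersteinDist p μ ν ≤ (transportCost p γ).toReal ^ (1 / p) := by
  rw [wassersteinDist, ENNReal.toReal_rpow]
  refine ENNReal.toReal_mono (ENNReal.rpow_ne_top_of_nonneg (by positivity) hfin) ?_
  exact ENNReal.rpow_le_rpow (iInf₂_le γ hγ) (by positivity)

theorem wassersteinDist_one_le_integral {X : Type*} [MeasurableSpace X] [PseudoMetricSpace X]
    {μ ν : Measure X} {γ : Measure (X × X)} (hγ : γ ∈ transportPlans μ ν)
    (hint : Integrable (fun z : X × X => dist z.1 z.2) γ) :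
    wassersteinDist 1 μ ν ≤ ∫ z, dist z.1 z.2 ∂γ := by
  have h : transportCost 1 γ = ENNReal.ofReal (∫ z, dist z.1 z.2 ∂γ) := by
    rw [ofReal_integral_eq_lintegral_ofReal hint (Eventually.of_forall fun _ => dist_nonneg)]
    simp [transportCost, edist_dist]
  refine (wassersteinDist_le_of_plan one_pos hγ (by rw [h]; exact ENNReal.ofReal_ne_top)).trans ?_
  rw [h, ENNReal.toReal_ofReal (integral_nonneg fun _ => dist_nonneg)]
  simp

theorem transportPlans_map_prodMk {Ω X : Type*} [MeasurableSpace Ω] [MeasurableSpace X]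
    {μ : Measure Ω} {f g : Ω → X} (hf : AEMeasurable f μ) (hg : AEMeasurable g μ) :
    μ.map (fun y => (f y, g y)) ∈ transportPlans (μ.map f) (μ.map g) := by
  constructor
  · rw [AEMeasurable.map_map_of_aemeasurable measurable_fst.aemeasurable (hf.prodMk hg)]
    rfl
  · rw [AEMeasurable.map_map_of_aemeasurable measurable_snd.aemeasurable (hf.prodMk hg)]
    rfl

theorem wassersteinDist_one_map_le {Ω : Type*} [MeasurableSpace Ω] {d : ℕ} {μ : Measure Ω}
    {f g : Ω → Rd d} (hf : AEMeasurable f μ) (hg : AEMeasurable g μ)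
    (hint : Integrable (fun y => f y - g y) μ) :
    wassersteinDist 1 (μ.map f) (μ.map g) ≤ ∫ y, ‖f y - g y‖ ∂μ := by
  have hm : AEStronglyMeasurable (fun z : Rd d × Rd d => dist z.1 z.2)
      (μ.map fun y => (f y, g y)) := continuous_dist.aestronglyMeasurable
  refine (wassersteinDist_one_le_integral (transportPlans_map_prodMk hf hg) ?_).trans_eq ?_
  · rw [integrable_map_measure hm (hf.prodMk hg)]
    simpa [Function.comp_def, dist_eq_norm] using hint.norm
  · rw [integral_map (hf.prodMk hg) hm]
    simp [dist_eq_norm]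

/-- Mollification by a probability density supported in the ball of radius `ε`: an average of
translates keeps the Lipschitz constant 1 and moves values by at most `ε`. -/
theorem exists_contDiff_lipschitzWith_dist_le {d : ℕ} {φ : Rd d → ℝ} (hφ : LipschitzWith 1 φ)
    {ε : ℝ} (hε : 0 < ε) :
    ∃ g : Rd d → ℝ, ContDiff ℝ (⊤ : ℕ∞) g ∧ LipschitzWith 1 g ∧ ∀ x, dist (g x) (φ x) ≤ ε := by
  let b : ContDiffBump (0 : Rd d) := ⟨ε / 2, ε, half_pos hε, half_lt_self hε⟩
  have hloc : LocallyIntegrable φ (volume : Measure (Rd d)) := hφ.continuous.locallyIntegrable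
  have hex : ∀ x, ConvolutionExistsAt (b.normed volume) φ x (ContinuousLinearMap.lsmul ℝ ℝ)
      volume := fun x =>
    b.hasCompactSupport_normed.convolutionExists_left _ b.continuous_normed hloc x
  refine ⟨_, b.hasCompactSupport_normed.contDiff_convolution_left
    (ContinuousLinearMap.lsmul ℝ ℝ) (b.contDiff_normed (μ := volume)) hloc, ?_, fun x => ?_⟩
  · refine LipschitzWith.of_dist_le_mul fun x y => ?_
    rw [dist_eq_norm, convolution, convolution, ← integral_sub (hex x) (hex y)]
    calc ‖∫ t, (ContinuousLinearMap.lsmul ℝ ℝ) (b.normed volume t) (φ (x - t)) -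
          (ContinuousLinearMap.lsmul ℝ ℝ) (b.normed volume t) (φ (y - t))‖
        ≤ ∫ t, b.normed volume t * dist x y := by
          refine norm_integral_le_of_norm_le (b.integrable_normed.mul_const _) ?_
          refine Eventually.of_forall fun t => ?_
          rw [← map_sub]
          simp only [ContinuousLinearMap.lsmul_apply, smul_eq_mul, norm_mul,
            Real.norm_of_nonneg (b.nonneg_normed t)]
          refine mul_le_mul_of_nonneg_left ?_ (b.nonneg_normed t)
          have := hφ.dist_le_mul (x - t) (y - t)
          rwa [dist_sub_right, dist_eq_norm, NNReal.coe_one, one_mul] at this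
      _ = _ := by rw [integral_mul_const, b.integral_normed]; simp
  · refine b.dist_normed_convolution_le hφ.continuous.aestronglyMeasurable fun y hy => ?_
    have := hφ.dist_le_mul y x
    simp only [NNReal.coe_one, one_mul] at this
    exact this.trans (Metric.mem_ball.1 hy).le

/-- A bound for `W_1` by duality with smooth `1`-Lipschitz functions. -/
theorem wassersteinDist_one_le_of_contDiff_bound {d : ℕ} {K : Set (Rd d)} (hK : IsCompact K)
    {μ ν : Measure (Rd d)} (hμ : ProbOn K μ) (hν : ProbOn K ν) {c : ℝ}
    (h : ∀ φ : Rd d → ℝ, ContDiff ℝ (⊤ : ℕ∞) φ → LipschitzWith 1 φ →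
      ∫ x, φ x ∂μ - ∫ x, φ x ∂ν ≤ c) :
    wassersteinDist 1 μ ν ≤ c := by
  have := hμ.1
  have := hν.1
  have : CompactSpace K := isCompact_iff_compactSpace.1 hK
  have hemb := MeasurableEmbedding.subtype_coe hK.measurableSet
  have hmap : ∀ ρ : Measure (Rd d), ρ Kᶜ = 0 → (ρ.comap ((↑) : K → Rd d)).map (↑) = ρ := by
    intro ρ hρ
    rw [hemb.map_comap, Subtype.range_coe]
    exact Measure.restrict_eq_self_of_ae_mem (mem_ae_iff.2 hρ)
  have hprob : ∀ ρ : Measure (Rd d), ProbOn K ρ →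
      IsProbabilityMeasure (ρ.comap ((↑) : K → Rd d)) := by
    intro ρ hρ
    have := hρ.1
    refine ⟨?_⟩
    rw [hemb.comap_apply, image_univ, Subtype.range_coe]
    exact (prob_compl_eq_zero_iff hK.measurableSet).1 hρ.2
  have := hprob μ hμ
  have := hprob ν hν
  have hint : ∀ (ρ : Measure (Rd d)) (f : Rd d → ℝ), ProbOn K ρ → Continuous f →
      Integrable f ρ := by
    intro ρ f hρ hf
    have := hρ.1
    rw [← Measure.restrict_eq_self_of_ae_mem (mem_ae_iff.2 hρ.2 : ∀ᵐ x ∂ρ, x ∈ K)]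
    exact hf.continuousOn.integrableOn_compact hK
  obtain ⟨γ, hγ, hγp, hγc⟩ := exists_transportPlan_integral_dist_le
    (μ.comap ((↑) : K → Rd d)) (ν.comap ((↑) : K → Rd d)) (c := c) (by
      intro φ hφ
      -- A 1-Lipschitz function on `K` is extended to the whole space with the same constant and
      -- then mollified, which brings it under the smooth hypothesis at the price of `ε`.
      obtain ⟨φ', hφ', hext⟩ : ∃ φ' : Rd d → ℝ, LipschitzWith 1 φ' ∧ ∀ x : K, φ x = φ' x := by
        have hφK : LipschitzOnWith 1 (Function.extend (↑) φ (fun _ => 0) : Rd d → ℝ) K := by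
          refine LipschitzOnWith.of_dist_le_mul fun x hx y hy => ?_
          have hx' := Subtype.val_injective.extend_apply φ (fun _ => 0) (⟨x, hx⟩ : K)
          have hy' := Subtype.val_injective.extend_apply φ (fun _ => 0) (⟨y, hy⟩ : K)
          simp only at hx' hy'
          rw [hx', hy']
          exact hφ.dist_le_mul _ _
        obtain ⟨φ', h1, h2⟩ := hφK.extend_real
        refine ⟨φ', h1, fun x => ?_⟩
        rw [← h2 x.2]
        exact (Subtype.val_injective.extend_apply φ _ x).symm
      refine le_of_forall_pos_le_add fun ε hε => ?_
      obtain ⟨g, hg, hgl, hgφ⟩ := exists_contDiff_lipschitzWith_dist_le hφ' (half_pos hε)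
      have h1 := h g hg hgl
      have h2 : ∫ x, φ x ∂(μ.comap ((↑) : K → Rd d)) = ∫ x, φ' x ∂μ := by
        conv_rhs => rw [← hmap μ hμ.2]
        rw [hemb.integral_map]
        simp only [hext]
      have h3 : ∫ x, φ x ∂(ν.comap ((↑) : K → Rd d)) = ∫ x, φ' x ∂ν := by
        conv_rhs => rw [← hmap ν hν.2]
        rw [hemb.integral_map]
        simp only [hext]
      have h4 : ∫ x, φ' x ∂μ ≤ ∫ x, g x ∂μ + ε / 2 := by
        have : ∫ x, g x ∂μ + ε / 2 = ∫ x, (g x + ε / 2) ∂μ := by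
          rw [integral_add (hint μ g hμ hgl.continuous) (integrable_const _)]
          simp
        rw [this]
        refine integral_mono (hint μ _ hμ hφ'.continuous)
          ((hint μ g hμ hgl.continuous).add (integrable_const _)) fun x => ?_
        have := (abs_le.1 (Real.dist_eq _ _ ▸ hgφ x)).1
        simp only
        linarith
      have h5 : ∫ x, g x ∂ν ≤ ∫ x, φ' x ∂ν + ε / 2 := by
        have : ∫ x, φ' x ∂ν + ε / 2 = ∫ x, (φ' x + ε / 2) ∂ν := by
          rw [integral_add (hint ν _ hν hφ'.continuous) (integrable_const _)]
          simp
        rw [this]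
        refine integral_mono (hint ν g hν hgl.continuous)
          ((hint ν _ hν hφ'.continuous).add (integrable_const _)) fun x => ?_
        have := (abs_le.1 (Real.dist_eq _ _ ▸ hgφ x)).2
        simp only
        linarith
      rw [h2, h3]
      linarith)
  have hfm : ∀ (i : K × K → K), Measurable i → AEMeasurable (fun z => (i z : Rd d)) γ :=
    fun i hi => (measurable_subtype_coe.comp hi).aemeasurable
  have hplan := transportPlans_map_prodMk (hfm _ measurable_fst) (hfm _ measurable_snd)
  have h1 : γ.map (fun z : K × K => (z.1 : Rd d)) = μ := by
    rw [← hmap μ hμ.2, ← hγ.1, Measure.map_map measurable_subtype_coe measurable_fst]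
    rfl
  have h2 : γ.map (fun z : K × K => (z.2 : Rd d)) = ν := by
    rw [← hmap ν hν.2, ← hγ.2, Measure.map_map measurable_subtype_coe measurable_snd]
    rfl
  have hcont : Continuous fun z : K × K => (z.1 : Rd d) - (z.2 : Rd d) := by fun_prop
  have := wassersteinDist_one_map_le (hfm _ measurable_fst) (hfm _ measurable_snd)
    (by
      rw [← integrableOn_univ]
      exact hcont.continuousOn.integrableOn_compact isCompact_univ)
  rw [h1, h2] at this
  refine this.trans ?_
  simpa [Subtype.dist_eq, dist_eq_norm] using hγc

end

noncomputable section

/-! ### Test functions and the tangent space -/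

theorem integrable_of_ae_mem_isCompact {X E : Type*} [TopologicalSpace X] [MeasurableSpace X]
    [OpensMeasurableSpace X] [T2Space X] [TopologicalSpace.PseudoMetrizableSpace X]
    [NormedAddCommGroup E] {μ : Measure X} [IsFiniteMeasure μ] {K : Set X} (hK : IsCompact K)
    (hμ : μ Kᶜ = 0) {f : X → E} (hf : ContinuousOn f K) : Integrable f μ := by
  rw [← Measure.restrict_eq_self_of_ae_mem (mem_ae_iff.2 hμ : ∀ᵐ x ∂μ, x ∈ K)]
  exact hf.integrableOn_compact hK

theorem aemeasurable_of_ae_mem_isCompact {X Y : Type*} [TopologicalSpace X] [MeasurableSpace X]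
    [OpensMeasurableSpace X] [T2Space X] [TopologicalSpace Y] [MeasurableSpace Y] [BorelSpace Y]
    {μ : Measure X} {K : Set X} (hK : IsCompact K)
    (hμ : μ Kᶜ = 0) {f : X → Y} (hf : ContinuousOn f K) : AEMeasurable f μ := by
  rw [← Measure.restrict_eq_self_of_ae_mem (mem_ae_iff.2 hμ : ∀ᵐ x ∂μ, x ∈ K)]
  exact hf.aemeasurable hK.measurableSet

theorem ProbOn.ae_mem {d : ℕ} {K : Set (Rd d)} {μ : Measure (Rd d)} (h : ProbOn K μ) :
    ∀ᵐ x ∂μ, x ∈ K := mem_ae_iff.2 h.2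

theorem ProbOn.mono {d : ℕ} {K K' : Set (Rd d)} {μ : Measure (Rd d)} (h : ProbOn K μ)
    (hK : K ⊆ K') : ProbOn K' μ :=
  ⟨h.1, measure_mono_null (compl_subset_compl.2 hK) h.2⟩

theorem ProbOn.map {d : ℕ} {K K' : Set (Rd d)} {μ : Measure (Rd d)} (h : ProbOn K μ)
    {f : Rd d → Rd d} (hf : AEMeasurable f μ) (hK' : MeasurableSet K') (hfK : MapsTo f K K') :
    ProbOn K' (μ.map f) := by
  have := h.1
  refine ⟨Measure.isProbabilityMeasure_map hf, ?_⟩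
  rw [Measure.map_apply_of_aemeasurable hf hK'.compl]
  exact measure_mono_null (fun x hx hxK => hx (hfK hxK)) h.2

/-- Smooth compactly supported functions. -/
def IsTestFunction {d : ℕ} (ψ : Rd d → ℝ) : Prop :=
  ContDiff ℝ (⊤ : ℕ∞) ψ ∧ HasCompactSupport ψ

section TestFunctions

variable {d : ℕ} {ψ ψ' : Rd d → ℝ}

theorem ContDiff.gradient_of_top (h : ContDiff ℝ (⊤ : ℕ∞) ψ) :
    ContDiff ℝ (⊤ : ℕ∞) (gradient ψ) :=
  (InnerProductSpace.toDual ℝ (Rd d)).symm.contDiff.comp (h.fderiv_right (by simp))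

namespace IsTestFunction

theorem differentiable (h : IsTestFunction ψ) : Differentiable ℝ ψ :=
  h.1.differentiable (by simp)

theorem continuous_gradient (h : IsTestFunction ψ) : Continuous (gradient ψ) :=
  h.1.gradient_of_top.continuous

theorem hasCompactSupport_gradient (h : IsTestFunction ψ) : HasCompactSupport (gradient ψ) :=
  (h.2.fderiv ℝ).comp_left (g := (InnerProductSpace.toDual ℝ (Rd d)).symm) (map_zero _)

theorem exists_bound_gradient (h : IsTestFunction ψ) : ∃ C, 0 ≤ C ∧ ∀ x, ‖gradient ψ x‖ ≤ C := by
  obtain ⟨C, hC⟩ := h.hasCompactSupport_gradient.exists_bound_of_continuous h.continuous_gradient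
  exact ⟨C, (norm_nonneg _).trans (hC 0), hC⟩

theorem sum {ι : Type*} {s : Finset ι} {f : ι → Rd d → ℝ} (c : ι → ℝ)
    (h : ∀ i ∈ s, IsTestFunction (f i)) : IsTestFunction fun x => ∑ i ∈ s, c i * f i x := by
  classical
  constructor
  · exact ContDiff.sum fun i hi => contDiff_const.mul (h i hi).1
  · induction s using Finset.induction_on with
    | empty =>
      simp only [Finset.sum_empty]
      exact HasCompactSupport.zero
    | insert a s ha ih =>
      simp only [Finset.sum_insert ha]
      exact (HasCompactSupport.mul_left (f := fun _ => c a)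
        (h a (Finset.mem_insert_self _ _)).2).add
        (ih fun i hi => h i (Finset.mem_insert_of_mem hi))

theorem add (h : IsTestFunction ψ) (h' : IsTestFunction ψ') :
    IsTestFunction (fun x => ψ x + ψ' x) :=
  ⟨h.1.add h'.1, h.2.add h'.2⟩

theorem const_mul (h : IsTestFunction ψ) (c : ℝ) : IsTestFunction (fun x => c * ψ x) :=
  ⟨contDiff_const.mul h.1, HasCompactSupport.mul_left (f := fun _ => c) h.2⟩

theorem zero : IsTestFunction (fun _ : Rd d => (0 : ℝ)) := ⟨contDiff_const, HasCompactSupport.zero⟩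

theorem gradient_add (h : IsTestFunction ψ) (h' : IsTestFunction ψ') (x : Rd d) :
    gradient (fun x => ψ x + ψ' x) x = gradient ψ x + gradient ψ' x := by
  simp only [gradient]
  rw [fderiv_fun_add (h.differentiable x) (h'.differentiable x), map_add]

theorem gradient_const_mul (h : IsTestFunction ψ) (c : ℝ) (x : Rd d) :
    gradient (fun x => c * ψ x) x = c • gradient ψ x := by
  simp only [gradient]
  rw [fderiv_const_mul (h.differentiable x)]
  exact map_smul (InnerProductSpace.toDual ℝ (Rd d)).symm c _

theorem memLp_gradient (h : IsTestFunction ψ) (μ : Measure (Rd d)) [IsFiniteMeasure μ] :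
    MemLp (gradient ψ) 2 μ := by
  obtain ⟨C, -, hC⟩ := h.exists_bound_gradient
  exact MemLp.of_bound h.continuous_gradient.aestronglyMeasurable C (Eventually.of_forall hC)

theorem isTangent (h : IsTestFunction ψ) (μ : Measure (Rd d)) [IsFiniteMeasure μ] :
    IsTangent μ (gradient ψ) :=
  ⟨h.memLp_gradient μ, fun ε _ => ⟨ψ, h.1, h.2, by simp⟩⟩

/-- The derivative of `ψ` is smooth with compact support, hence Lipschitz. -/
theorem exists_taylor_bound (h : IsTestFunction ψ) : ∃ C, 0 ≤ C ∧ ∀ x y,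
    |ψ y - ψ x - inner ℝ (gradient ψ x) (y - x)| ≤ C * ‖y - x‖ ^ 2 := by
  obtain ⟨C, hC⟩ := ContDiff.lipschitzWith_of_hasCompactSupport (h.2.fderiv ℝ)
    ((h.1.fderiv_right (m := (⊤ : ℕ∞)) (by simp)).of_le (by exact_mod_cast le_top)) one_ne_zero
  refine ⟨C, C.2, fun x y => ?_⟩
  rw [inner_gradient_left]
  have := (convex_segment x y).norm_image_sub_le_of_norm_fderiv_le' (f := ψ) (𝕜 := ℝ)
    (φ := fderiv ℝ ψ x) (C := C * ‖y - x‖) (fun z _ => h.differentiable z) (fun z hz => by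
      have h1 := hC.dist_le_mul z x
      rw [dist_eq_norm, dist_eq_norm] at h1
      refine h1.trans (mul_le_mul_of_nonneg_left ?_ C.2)
      exact norm_sub_le_of_mem_segment hz) (left_mem_segment _ _ _) (right_mem_segment _ _ _)
  rw [Real.norm_eq_abs] at this
  refine this.trans_eq (by ring)

end IsTestFunction

/-- One constant serves all combinations at once, so `∑ e_i ψ_i` meets the optimality criterion of
`map_id_add_mem_optimalPlans` as soon as `C ‖e‖ ≤ 1/2`. -/
theorem exists_small_combination {ι : Type*} [Fintype ι] {ψ : ι → Rd d → ℝ}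
    (h : ∀ i, IsTestFunction (ψ i)) : ∃ C, 0 ≤ C ∧ ∀ e : EuclideanSpace ℝ ι,
      (∀ x, ‖∑ i, e i • gradient (ψ i) x‖ ≤ C * ‖e‖) ∧
      ∀ x y, |(∑ i, e i * ψ i y) - (∑ i, e i * ψ i x) -
        inner ℝ (∑ i, e i • gradient (ψ i) x) (y - x)| ≤ C * ‖e‖ * ‖y - x‖ ^ 2 := by
  choose C hC0 hC using fun i => (h i).exists_bound_gradient
  choose D hD0 hD using fun i => (h i).exists_taylor_bound
  have hei : ∀ (e : EuclideanSpace ℝ ι) i, |e i| ≤ ‖e‖ := fun e i => by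
    simpa using PiLp.norm_apply_le e i
  have hsC : 0 ≤ ∑ i, C i := Finset.sum_nonneg fun i _ => hC0 i
  have hsD : 0 ≤ ∑ i, D i := Finset.sum_nonneg fun i _ => hD0 i
  refine ⟨(∑ i, C i) + ∑ i, D i, by positivity, fun e => ⟨fun x => ?_, fun x y => ?_⟩⟩
  · calc ‖∑ i, e i • gradient (ψ i) x‖ ≤ ∑ i, ‖e‖ * C i := by
          refine norm_sum_le_of_le _ fun i _ => ?_
          rw [norm_smul]
          exact mul_le_mul (hei e i) (hC i x) (norm_nonneg _) (norm_nonneg _)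
      _ = (∑ i, C i) * ‖e‖ := by rw [← Finset.mul_sum, mul_comm]
      _ ≤ _ := by
        refine mul_le_mul_of_nonneg_right ?_ (norm_nonneg _)
        linarith
  · have : (∑ i, e i * ψ i y) - (∑ i, e i * ψ i x) -
        inner ℝ (∑ i, e i • gradient (ψ i) x) (y - x) =
        ∑ i, e i * (ψ i y - ψ i x - inner ℝ (gradient (ψ i) x) (y - x)) := by
      rw [sum_inner, ← Finset.sum_sub_distrib, ← Finset.sum_sub_distrib]
      refine Finset.sum_congr rfl fun i _ => ?_
      rw [real_inner_smul_left]
      ring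
    rw [this]
    calc |∑ i, e i * (ψ i y - ψ i x - inner ℝ (gradient (ψ i) x) (y - x))|
        ≤ ∑ i, ‖e‖ * (D i * ‖y - x‖ ^ 2) := by
          refine (Finset.abs_sum_le_sum_abs _ _).trans (Finset.sum_le_sum fun i _ => ?_)
          rw [abs_mul]
          exact mul_le_mul (hei e i) (hD i x y) (abs_nonneg _) (norm_nonneg _)
      _ = (∑ i, D i) * ‖e‖ * ‖y - x‖ ^ 2 := by
          rw [← Finset.mul_sum, ← Finset.sum_mul]
          ring
      _ ≤ _ := by
        refine mul_le_mul_of_nonneg_right (mul_le_mul_of_nonneg_right ?_ (norm_nonneg _))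
          (by positivity)
        linarith

end TestFunctions

section Tangent

theorem inner_toLp_eq_integral {d : ℕ} {μ : Measure (Rd d)}
    {f g : Rd d → Rd d} (hf : MemLp f 2 μ) (hg : MemLp g 2 μ) :
    inner ℝ (hf.toLp f) (hg.toLp g) = ∫ x, inner ℝ (f x) (g x) ∂μ := by
  rw [L2.inner_def]
  refine integral_congr_ae ?_
  filter_upwards [hf.coeFn_toLp, hg.coeFn_toLp] with x h1 h2
  rw [h1, h2]

theorem integrable_inner_of_memLp {d : ℕ} {μ : Measure (Rd d)}
    {f g : Rd d → Rd d} (hf : MemLp f 2 μ) (hg : MemLp g 2 μ) :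
    Integrable (fun x => inner ℝ (f x) (g x)) μ := by
  refine (L2.integrable_inner (𝕜 := ℝ) (hf.toLp f) (hg.toLp g)).congr ?_
  filter_upwards [hf.coeFn_toLp, hg.coeFn_toLp] with x h1 h2
  rw [h1, h2]

variable {d : ℕ} (μ : Measure (Rd d)) [IsProbabilityMeasure μ]

/-- The gradients of test functions, as a subspace of `L²(μ)`. -/
def gradientSubmodule : Submodule ℝ (Lp (Rd d) 2 μ) where
  carrier := {g | ∃ ψ, IsTestFunction ψ ∧ g =ᵐ[μ] gradient ψ}
  add_mem' := by
    rintro f g ⟨ψ, hψ, hf⟩ ⟨ψ', hψ', hg⟩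
    refine ⟨_, hψ.add hψ', ?_⟩
    filter_upwards [Lp.coeFn_add f g, hf, hg] with x h1 h2 h3
    rw [h1, Pi.add_apply, h2, h3, hψ.gradient_add hψ']
  zero_mem' := ⟨_, IsTestFunction.zero, by
    filter_upwards [Lp.coeFn_zero (Rd d) 2 μ] with x hx
    rw [hx]
    simp⟩
  smul_mem' := by
    rintro c f ⟨ψ, hψ, hf⟩
    refine ⟨_, hψ.const_mul c, ?_⟩
    filter_upwards [Lp.coeFn_smul c f, hf] with x h1 h2
    rw [h1, Pi.smul_apply, h2, hψ.gradient_const_mul]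

variable {μ}

theorem IsTestFunction.toLp_mem {ψ : Rd d → ℝ} (h : IsTestFunction ψ) :
    (h.memLp_gradient μ).toLp _ ∈ gradientSubmodule μ :=
  ⟨ψ, h, (h.memLp_gradient μ).coeFn_toLp⟩

theorem IsTangent.toLp_mem {ξ : Rd d → Rd d} (h : IsTangent μ ξ) :
    h.1.toLp ξ ∈ (gradientSubmodule μ).topologicalClosure := by
  rw [← SetLike.mem_coe, Submodule.topologicalClosure_coe, Metric.mem_closure_iff]
  intro ε hε
  obtain ⟨ψ, hψ, hψc, hle⟩ := h.2 (ε / 2) (half_pos hε)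
  have hT : IsTestFunction ψ := ⟨hψ, hψc⟩
  refine ⟨_, hT.toLp_mem, ?_⟩
  rw [dist_eq_norm, ← MemLp.toLp_sub, Lp.norm_toLp]
  refine (ENNReal.toReal_le_of_le_ofReal (half_pos hε).le hle).trans_lt (half_lt_self hε)

theorem abs_integral_inner_le {f g : Rd d → Rd d} (hf : MemLp f 2 μ) (hg : MemLp g 2 μ) :
    |∫ x, inner ℝ (f x) (g x) ∂μ| ≤ (eLpNorm f 2 μ).toReal * (eLpNorm g 2 μ).toReal := by
  rw [← inner_toLp_eq_integral hf hg, ← Lp.norm_toLp f hf, ← Lp.norm_toLp g hg]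
  exact abs_real_inner_le_norm _ _

theorem integral_norm_le_eLpNorm_two {f : Rd d → Rd d} (hf : MemLp f 2 μ) :
    ∫ x, ‖f x‖ ∂μ ≤ (eLpNorm f 2 μ).toReal := by
  have h1 : eLpNorm f 1 μ ≤ eLpNorm f 2 μ :=
    eLpNorm_le_eLpNorm_of_exponent_le (by norm_num) hf.1
  rw [integral_norm_eq_lintegral_enorm hf.1, ← eLpNorm_one_eq_lintegral_enorm]
  exact ENNReal.toReal_mono hf.2.ne h1

theorem eLpNorm_two_toReal_le_of_bound {f : Rd d → Rd d} {C : ℝ} (hC : 0 ≤ C)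
    (h : ∀ᵐ x ∂μ, ‖f x‖ ≤ C) : (eLpNorm f 2 μ).toReal ≤ C := by
  have := eLpNorm_le_of_ae_bound (p := 2) h
  simp only [measure_univ, ENNReal.one_rpow, one_mul] at this
  exact ENNReal.toReal_le_of_le_ofReal hC (by simpa using this)

/-- Decomposition of a vector field into a gradient, a field that is orthogonal to the tangent
space, and a small remainder. -/
theorem exists_gradient_add_orthogonal {h : Rd d → Rd d} (hh : MemLp h 2 μ) {η : ℝ} (hη : 0 < η) :
    ∃ (ψ : Rd d → ℝ) (q : Rd d → Rd d), IsTestFunction ψ ∧ MemLp q 2 μ ∧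
      (∀ ξ, IsTangent μ ξ → ∫ x, inner ℝ (ξ x) (q x) ∂μ = 0) ∧
      MemLp (fun x => h x - gradient ψ x - q x) 2 μ ∧
      (eLpNorm (fun x => h x - gradient ψ x - q x) 2 μ).toReal ≤ η := by
  set V := (gradientSubmodule μ).topologicalClosure with hV
  have hVc : IsClosed (V : Set (Lp (Rd d) 2 μ)) := Submodule.isClosed_topologicalClosure _
  have : CompleteSpace V := hVc.completeSpace_coe
  set H := hh.toLp h
  -- The orthogonal field is `q = H - p`. The projection `p` lies only in the closure of the
  -- gradients, so replacing it by a true gradient costs the remainder `η`.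
  set p := V.starProjection H
  have hp : p ∈ V := Submodule.starProjection_apply_mem _ _
  have hp' := hp
  rw [hV, ← SetLike.mem_coe, Submodule.topologicalClosure_coe, Metric.mem_closure_iff] at hp'
  obtain ⟨g, ⟨ψ, hψ, hgψ⟩, hg⟩ := hp' η hη
  have hq := Submodule.sub_starProjection_mem_orthogonal (K := V) H
  have hm : MemLp (fun x => h x - gradient ψ x - (H - p : Lp (Rd d) 2 μ) x) 2 μ :=
    (hh.sub (hψ.memLp_gradient μ)).sub (Lp.memLp (H - p))
  refine ⟨ψ, (H - p : Lp (Rd d) 2 μ), hψ, Lp.memLp _, fun ξ hξ => ?_, hm, ?_⟩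
  · have h1 := (Submodule.mem_orthogonal _ _).1 hq _ hξ.toLp_mem
    rw [← inner_toLp_eq_integral hξ.1 (Lp.memLp _), Lp.toLp_coeFn]
    exact h1
  · have h1 : eLpNorm (fun x => h x - gradient ψ x - (H - p : Lp (Rd d) 2 μ) x) 2 μ =
        eLpNorm (p - g : Lp (Rd d) 2 μ) 2 μ := by
      refine eLpNorm_congr_ae ?_
      filter_upwards [hh.coeFn_toLp, Lp.coeFn_sub H p, Lp.coeFn_sub p g, hgψ] with x h1 h2 h3 h4
      rw [h2, h3, Pi.sub_apply, Pi.sub_apply, h4, ← h1]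
      abel
    rw [h1, ← Lp.norm_def, ← dist_eq_norm]
    exact hg.le

/-- The difference is a limit of gradients and orthogonal to all gradients, hence orthogonal to
itself. -/
theorem IsTangent.ae_eq_of_integral_inner_gradient_eq {ξ ξ' : Rd d → Rd d} (hξ : IsTangent μ ξ)
    (hξ' : IsTangent μ ξ') (h : ∀ ψ, IsTestFunction ψ →
      ∫ x, inner ℝ (ξ x) (gradient ψ x) ∂μ = ∫ x, inner ℝ (ξ' x) (gradient ψ x) ∂μ) :
    ξ =ᵐ[μ] ξ' := by
  rw [← MemLp.toLp_eq_toLp_iff hξ.1 hξ'.1, ← sub_eq_zero]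
  set D := hξ.1.toLp ξ - hξ'.1.toLp ξ' with hD
  have hDmem : D ∈ (gradientSubmodule μ).topologicalClosure :=
    Submodule.sub_mem _ hξ.toLp_mem hξ'.toLp_mem
  have hcl : closure (gradientSubmodule μ : Set (Lp (Rd d) 2 μ)) ⊆ {g | inner ℝ D g = 0} := by
    refine closure_minimal ?_ (isClosed_eq (by fun_prop) continuous_const)
    rintro g ⟨ψ, hψ, hgψ⟩
    have hg : g = (hψ.memLp_gradient μ).toLp _ := by
      apply Lp.ext
      filter_upwards [hgψ, (hψ.memLp_gradient μ).coeFn_toLp] with x h1 h2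
      rw [h1, h2]
    simp only [mem_ofPred_eq]
    rw [hD, inner_sub_left, hg, inner_toLp_eq_integral, inner_toLp_eq_integral, h ψ hψ, sub_self]
  exact inner_self_eq_zero.1 (hcl hDmem)

/-- On a probability space the `L¹` norm is at most the `L²` norm, so the bound extends by density
to the closure of the gradients, where it may be tested on `ξ` itself: `‖ξ‖² ≤ L ‖ξ‖`. -/
theorem IsTangent.eLpNorm_le {ξ : Rd d → Rd d} (hξ : IsTangent μ ξ) {L : ℝ} (hL : 0 ≤ L)
    (h : ∀ ψ, IsTestFunction ψ →
      ∫ x, inner ℝ (ξ x) (gradient ψ x) ∂μ ≤ L * ∫ x, ‖gradient ψ x‖ ∂μ) :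
    (eLpNorm ξ 2 μ).toReal ≤ L := by
  rw [← Lp.norm_toLp ξ hξ.1]
  set D := hξ.1.toLp ξ with hD
  have hcl : closure (gradientSubmodule μ : Set (Lp (Rd d) 2 μ)) ⊆
      {g | inner ℝ D g ≤ L * ‖g‖} := by
    refine closure_minimal ?_ (isClosed_le (by fun_prop) (by fun_prop))
    rintro g ⟨ψ, hψ, hgψ⟩
    have hg : g = (hψ.memLp_gradient μ).toLp _ := by
      apply Lp.ext
      filter_upwards [hgψ, (hψ.memLp_gradient μ).coeFn_toLp] with x h1 h2
      rw [h1, h2]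
    simp only [mem_ofPred_eq]
    rw [hD, hg, inner_toLp_eq_integral, Lp.norm_toLp]
    exact (h ψ hψ).trans (mul_le_mul_of_nonneg_left
      (integral_norm_le_eLpNorm_two (hψ.memLp_gradient μ)) hL)
  have h1 : inner ℝ D D ≤ L * ‖D‖ := hcl hξ.toLp_mem
  rw [real_inner_self_eq_norm_mul_norm] at h1
  by_contra hlt
  push Not at hlt
  have := hL.trans_lt hlt
  nlinarith

end Tangent

end

noncomputable section

/-! ### Optimality of small gradient perturbations of the identity -/

section Optimal

variable {d : ℕ}

theorem transportCost_two_eq {γ : Measure (Rd d × Rd d)}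
    (h : Integrable (fun z : Rd d × Rd d => ‖z.1 - z.2‖ ^ 2) γ) :
    transportCost 2 γ = ENNReal.ofReal (∫ z, ‖z.1 - z.2‖ ^ 2 ∂γ) := by
  rw [ofReal_integral_eq_lintegral_ofReal h (Eventually.of_forall fun _ => by positivity),
    transportCost]
  refine lintegral_congr fun z => ?_
  rw [edist_dist, ENNReal.ofReal_rpow_of_nonneg dist_nonneg (by norm_num), dist_eq_norm]
  norm_num

theorem transportPlans_compl_prod_eq_zero {K K' : Set (Rd d)} {μ ν : Measure (Rd d)}
    (hK : MeasurableSet K) (hK' : MeasurableSet K') (hμ : μ Kᶜ = 0) (hν : ν K'ᶜ = 0)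
    {γ : Measure (Rd d × Rd d)} (hγ : γ ∈ transportPlans μ ν) : γ (K ×ˢ K')ᶜ = 0 := by
  rw [compl_prod_eq_union]
  refine measure_union_null ?_ ?_
  · rw [← hγ.1, Measure.map_apply measurable_fst hK.compl] at hμ
    exact measure_mono_null (fun z hz => hz.1) hμ
  · rw [← hγ.2, Measure.map_apply measurable_snd hK'.compl] at hν
    exact measure_mono_null (fun z hz => hz.2) hν

theorem isFiniteMeasure_of_mem_transportPlans {μ ν : Measure (Rd d)} [IsFiniteMeasure μ]
    {γ : Measure (Rd d × Rd d)} (hγ : γ ∈ transportPlans μ ν) : IsFiniteMeasure γ := by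
  have h := hγ.1
  constructor
  have h1 := Measure.map_apply (μ := γ) measurable_fst (MeasurableSet.univ (α := Rd d))
  rw [preimage_univ] at h1
  rw [← h1, h]
  exact measure_lt_top _ _

/-- The Taylor bound makes `x + g x` a subgradient at `x` of `u = |x|²/2 + ψ`. Thus the graph of `id
+ g` lies where Fenchel's inequality for `u` and its conjugate is an equality, and the two
potentials certify optimality. -/
theorem map_id_add_mem_optimalPlans {K : Set (Rd d)} (hK : IsCompact K) {μ : Measure (Rd d)}
    (hμ : ProbOn K μ) {g : Rd d → Rd d} (hg : Continuous g) {ψ : Rd d → ℝ} (hψ : Continuous ψ)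
    (h : ∀ x y, |ψ y - ψ x - inner ℝ (g x) (y - x)| ≤ 1 / 2 * ‖y - x‖ ^ 2) :
    μ.map (fun x => (x, x + g x)) ∈ optimalPlans μ (μ.map fun x => x + g x) := by
  have := hμ.1
  have hT : Continuous fun x => x + g x := continuous_id.add hg
  have hpl : μ.map (fun x => (x, x + g x)) ∈ transportPlans μ (μ.map fun x => x + g x) := by
    have := transportPlans_map_prodMk (μ := μ) aemeasurable_id hT.measurable.aemeasurable
    simpa only [Measure.map_id, id] using this
  refine ⟨hpl, fun γ' hγ' => ?_⟩
  set K' := (fun x => x + g x) '' K with hK'def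
  have hK' : IsCompact K' := hK.image hT
  have hν : ProbOn K' (μ.map fun x => x + g x) :=
    hμ.map hT.measurable.aemeasurable hK'.measurableSet (mapsTo_image _ _)
  have hint : ∀ γ ∈ transportPlans μ (μ.map fun x => x + g x), ∀ f : Rd d × Rd d → ℝ,
      Continuous f → Integrable f γ := fun γ hγ f hf => by
    have := isFiniteMeasure_of_mem_transportPlans hγ
    exact integrable_of_ae_mem_isCompact (hK.prod hK') (transportPlans_compl_prod_eq_zero
      hK.measurableSet hK'.measurableSet hμ.2 hν.2 hγ) hf.continuousOn
  have hc : Continuous fun z : Rd d × Rd d => ‖z.1 - z.2‖ ^ 2 := by fun_prop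
  rw [transportCost_two_eq (hint _ hpl _ hc), transportCost_two_eq (hint _ hγ' _ hc)]
  refine ENNReal.ofReal_le_ofReal ?_
  set u : Rd d → ℝ := fun x => ‖x‖ ^ 2 / 2 + ψ x with hu
  have huc : Continuous u := by fun_prop
  -- The conjugate is taken over `K` only. This keeps it finite and continuous, and it is enough
  -- because the first marginal is carried by `K`.
  set us : Rd d → ℝ := fun y => sSup ((fun x => inner ℝ x y - u x) '' K) with hus
  have husc : Continuous us :=
    hK.continuous_sSup (f := fun y x => inner ℝ x y - u x) (by
      change Continuous fun p : Rd d × Rd d => inner ℝ p.2 p.1 - u p.2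
      fun_prop)
  have hfen : ∀ x ∈ K, ∀ y, inner ℝ x y ≤ u x + us y := fun x hx y => by
    have hbdd : BddAbove ((fun x => inner ℝ x y - u x) '' K) :=
      (hK.image (by fun_prop)).bddAbove
    linarith [le_csSup hbdd (mem_image_of_mem _ hx)]
  have heq : ∀ x ∈ K, us (x + g x) ≤ inner ℝ x (x + g x) - u x := fun x hx => by
    refine csSup_le (Set.Nonempty.image _ ⟨x, hx⟩) ?_
    rintro _ ⟨x', hx', rfl⟩
    have h1 := (abs_le.1 (h x x')).1
    have h2 : ‖x' - x‖ ^ 2 = ‖x'‖ ^ 2 - 2 * inner ℝ x' x + ‖x‖ ^ 2 := norm_sub_sq_real x' x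
    simp only [hu, inner_add_right, inner_sub_right, real_inner_self_eq_norm_sq] at h1 ⊢
    rw [real_inner_comm x' (g x), real_inner_comm x (g x)] at h1
    rw [h2] at h1
    linarith
  -- For `x ∈ K`, `a x + b y ≤ |x - y|²`, with equality when `y = x + g x`. The integral of `a + b`
  -- depends only on the marginals, so it is the same for both plans.
  set a : Rd d → ℝ := fun x => ‖x‖ ^ 2 - 2 * u x with ha
  set b : Rd d → ℝ := fun y => ‖y‖ ^ 2 - 2 * us y with hb
  have hac : Continuous a := by fun_prop
  have hbc : Continuous b := by fun_prop
  have hsq : ∀ x y : Rd d, ‖x - y‖ ^ 2 = ‖x‖ ^ 2 - 2 * inner ℝ x y + ‖y‖ ^ 2 :=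
    fun x y => norm_sub_sq_real x y
  have hab : ∀ γ ∈ transportPlans μ (μ.map fun x => x + g x),
      ∫ z, (a z.1 + b z.2) ∂γ = ∫ x, a x ∂μ + ∫ y, b y ∂(μ.map fun x => x + g x) := by
    intro γ hγ
    rw [integral_add (f := fun z : Rd d × Rd d => a z.1) (g := fun z : Rd d × Rd d => b z.2)
      (hint γ hγ _ (hac.comp continuous_fst)) (hint γ hγ _ (hbc.comp continuous_snd))]
    congr 1
    · conv_rhs => rw [← hγ.1]
      exact (integral_map measurable_fst.aemeasurable hac.aestronglyMeasurable).symm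
    · conv_rhs => rw [← hγ.2]
      exact (integral_map measurable_snd.aemeasurable hbc.aestronglyMeasurable).symm
  calc ∫ z, ‖z.1 - z.2‖ ^ 2 ∂(μ.map fun x => (x, x + g x))
      = ∫ x, ‖x - (x + g x)‖ ^ 2 ∂μ :=
        integral_map (continuous_id.prodMk hT).measurable.aemeasurable hc.aestronglyMeasurable
    _ ≤ ∫ x, (a x + b (x + g x)) ∂μ := by
        refine integral_mono_ae
          (integrable_of_ae_mem_isCompact hK hμ.2 (by fun_prop))
          (integrable_of_ae_mem_isCompact hK hμ.2 (by fun_prop)) ?_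
        filter_upwards [hμ.ae_mem] with x hx
        rw [hsq]
        have := heq x hx
        simp only [ha, hb]
        linarith
    _ = ∫ z, (a z.1 + b z.2) ∂(μ.map fun x => (x, x + g x)) :=
        (integral_map (f := fun z : Rd d × Rd d => a z.1 + b z.2)
          (continuous_id.prodMk hT).measurable.aemeasurable
          (by fun_prop : Continuous fun z : Rd d × Rd d => a z.1 + b z.2).aestronglyMeasurable).symm
    _ = ∫ z, (a z.1 + b z.2) ∂γ' := by rw [hab _ hpl, hab _ hγ']
    _ ≤ ∫ z, ‖z.1 - z.2‖ ^ 2 ∂γ' := by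
        refine integral_mono_ae (hint _ hγ' _ (by fun_prop)) (hint _ hγ' _ hc) ?_
        have h0 := transportPlans_compl_prod_eq_zero
          hK.measurableSet hK'.measurableSet hμ.2 hν.2 hγ'
        filter_upwards [(mem_ae_iff.2 h0 : ∀ᵐ z ∂γ', z ∈ K ×ˢ K')] with z hz
        rw [hsq]
        have := hfen z.1 hz.1 z.2
        simp only [ha, hb]
        linarith

theorem wassersteinDist_two_map_id_add_le {μ : Measure (Rd d)} [IsProbabilityMeasure μ]
    {g : Rd d → Rd d} (hg : Continuous g) {b : ℝ} (hb : 0 ≤ b) (hgb : ∀ x, ‖g x‖ ≤ b) :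
    wassersteinDist 2 μ (μ.map fun x => x + g x) ≤ b := by
  have hT : Continuous fun x => x + g x := continuous_id.add hg
  have hpl : μ.map (fun x => (x, x + g x)) ∈ transportPlans μ (μ.map fun x => x + g x) := by
    have := transportPlans_map_prodMk (μ := μ) aemeasurable_id hT.measurable.aemeasurable
    simpa only [Measure.map_id, id] using this
  have hc : Continuous fun z : Rd d × Rd d => ‖z.1 - z.2‖ ^ 2 := by fun_prop
  have hm : AEMeasurable (fun x => (x, x + g x)) μ :=
    (continuous_id.prodMk hT).measurable.aemeasurable
  have hint : Integrable (fun x => ‖g x‖ ^ 2) μ := by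
    refine Integrable.of_bound (by fun_prop) (b ^ 2) (Eventually.of_forall fun x => ?_)
    rw [Real.norm_of_nonneg (by positivity)]
    exact pow_le_pow_left₀ (norm_nonneg _) (hgb x) 2
  have hint' : Integrable (fun z : Rd d × Rd d => ‖z.1 - z.2‖ ^ 2)
      (μ.map fun x => (x, x + g x)) := by
    rw [integrable_map_measure hc.aestronglyMeasurable hm]
    simpa [Function.comp_def] using hint
  have hcost := transportCost_two_eq hint'
  refine (wassersteinDist_le_of_plan two_pos hpl
    (by rw [hcost]; exact ENNReal.ofReal_ne_top)).trans ?_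
  rw [hcost, ENNReal.toReal_ofReal (integral_nonneg fun _ => by positivity),
    integral_map hm hc.aestronglyMeasurable, ← Real.sqrt_eq_rpow]
  refine Real.sqrt_le_iff.2 ⟨hb, ?_⟩
  calc ∫ x, ‖x - (x + g x)‖ ^ 2 ∂μ ≤ ∫ _, b ^ 2 ∂μ := by
        refine integral_mono (by simpa using hint) (integrable_const _) fun x => ?_
        simpa using pow_le_pow_left₀ (norm_nonneg _) (hgb x) 2
    _ = b ^ 2 := by simp

end Optimal

/-! ### First-order expansion along gradient perturbations -/

section Expansion

variable {d : ℕ} {ι : Type*} {K : Set (Rd d)} {S : Set ι} {φ : ι → Measure (Rd d) → ℝ}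
  {μ : Measure (Rd d)} {ξ : ι → Rd d → Rd d}

theorem integral_inner_map_id_add [IsFiniteMeasure μ] {ζ g : Rd d → Rd d}
    (hζ : AEStronglyMeasurable ζ μ) (hg : Continuous g) :
    ∫ z, inner ℝ (ζ z.1) (z.2 - z.1) ∂(μ.map fun x => (x, x + g x)) =
      ∫ x, inner ℝ (ζ x) (g x) ∂μ := by
  have hm : Measurable (fun x : Rd d => (x, x + g x)) :=
    (continuous_id.prodMk (continuous_id.add hg)).measurable
  rw [integral_map hm.aemeasurable]
  · simp
  · refine AEStronglyMeasurable.inner ?_ (by fun_prop)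
    have hfst : (μ.map fun x => (x, x + g x)).map Prod.fst = μ := by
      rw [Measure.map_map measurable_fst hm]
      exact Measure.map_id
    refine AEStronglyMeasurable.comp_measurable (f := Prod.fst) ?_ measurable_fst
    rwa [hfst]

/-- Along small gradient perturbations of the identity (which are optimal), the gradient gives
the first-order expansion, uniformly. -/
theorem HasWassersteinGradientOn.expansion_gradient {B : Set (Rd d)} (hB : IsCompact B)
    (hμ : ProbOn B μ) (h : HasWassersteinGradientOn K S φ μ ξ) {ε : ℝ} (hε : 0 < ε) :
    ∃ δ > 0, ∀ a ∈ S, ∀ (g : Rd d → Rd d) (ψ : Rd d → ℝ) (b : ℝ), Continuous g → Continuous ψ →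
      (∀ x y, |ψ y - ψ x - inner ℝ (g x) (y - x)| ≤ 1 / 2 * ‖y - x‖ ^ 2) →
      0 ≤ b → (∀ x, ‖g x‖ ≤ b) → b < δ → ProbOn K (μ.map fun x => x + g x) →
      |φ a (μ.map fun x => x + g x) - φ a μ - ∫ x, inner ℝ (ξ a x) (g x) ∂μ| ≤ ε * b := by
  have := hμ.1
  obtain ⟨ht, h1, h2⟩ := h
  obtain ⟨δ₁, hδ₁, H₁⟩ := h1 ε hε
  obtain ⟨δ₂, hδ₂, H₂⟩ := h2 ε hε
  refine ⟨min δ₁ δ₂, lt_min hδ₁ hδ₂, fun a ha g ψ b hg hψ hgψ hb hgb hbδ hν => ?_⟩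
  have hW := wassersteinDist_two_map_id_add_le (μ := μ) hg hb hgb
  have hopt := map_id_add_mem_optimalPlans hB hμ hg hψ hgψ
  have e1 := H₁ a ha _ hν (hW.trans_lt (hbδ.trans_le (min_le_left _ _))) _ hopt
  have e2 := H₂ a ha _ hν (hW.trans_lt (hbδ.trans_le (min_le_right _ _))) _ hopt
  rw [integral_inner_map_id_add (ht a ha).1.1 hg] at e1
  rw [integral_inner_map_id_add (ζ := fun x => -ξ a x) (ht a ha).1.1.neg hg] at e2
  simp only [inner_neg_left, integral_neg] at e2
  have hεb := mul_le_mul_of_nonneg_left hW hε.le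
  rw [abs_le]
  constructor <;> linarith

theorem HasWassersteinGradientOn.mono {K' : Set (Rd d)} {S' : Set ι} (hK : K' ⊆ K) (hS : S' ⊆ S)
    (h : HasWassersteinGradientOn K S φ μ ξ) : HasWassersteinGradientOn K' S' φ μ ξ := by
  refine ⟨fun a ha => h.1 a (hS ha), fun ε hε => ?_, fun ε hε => ?_⟩
  · obtain ⟨δ, hδ, H⟩ := h.2.1 ε hε
    exact ⟨δ, hδ, fun a ha ν hν => H a (hS ha) ν (hν.mono hK)⟩
  · obtain ⟨δ, hδ, H⟩ := h.2.2 ε hε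
    exact ⟨δ, hδ, fun a ha ν hν => H a (hS ha) ν (hν.mono hK)⟩

theorem HasWassersteinGradientOn.comp {κ : Type*} {S' : Set κ} {i : κ → ι} (hi : MapsTo i S' S)
    (h : HasWassersteinGradientOn K S φ μ ξ) :
    HasWassersteinGradientOn K S' (fun a => φ (i a)) μ (fun a => ξ (i a)) := by
  refine ⟨fun a ha => h.1 _ (hi ha), fun ε hε => ?_, fun ε hε => ?_⟩
  · obtain ⟨δ, hδ, H⟩ := h.2.1 ε hε
    exact ⟨δ, hδ, fun a ha ν hν => H _ (hi ha) ν hν⟩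
  · obtain ⟨δ, hδ, H⟩ := h.2.2 ε hε
    exact ⟨δ, hδ, fun a ha ν hν => H _ (hi ha) ν hν⟩

theorem IsTangent.congr {ζ ζ' : Rd d → Rd d} (h : IsTangent μ ζ) (hζ : ζ =ᵐ[μ] ζ') :
    IsTangent μ ζ' := by
  refine ⟨(memLp_congr_ae hζ).1 h.1, fun ε hε => ?_⟩
  obtain ⟨ψ, h1, h2, h3⟩ := h.2 ε hε
  refine ⟨ψ, h1, h2, ?_⟩
  rwa [eLpNorm_congr_ae (g := fun x => ζ x - gradient ψ x)]
  filter_upwards [hζ] with x hx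
  rw [hx]

theorem HasWassersteinGradientOn.congr {ξ' : ι → Rd d → Rd d}
    (h : HasWassersteinGradientOn K S φ μ ξ) (hξ : ∀ a ∈ S, ξ a =ᵐ[μ] ξ' a) :
    HasWassersteinGradientOn K S φ μ ξ' := by
  have key : ∀ a ∈ S, ∀ ν, ∀ γ ∈ optimalPlans μ ν,
      (fun z : Rd d × Rd d => ξ a z.1) =ᵐ[γ] fun z => ξ' a z.1 := by
    intro a ha ν γ hγ
    have h1 := hξ a ha
    rw [← hγ.1.1] at h1
    exact ae_of_ae_map measurable_fst.aemeasurable h1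
  refine ⟨fun a ha => (h.1 a ha).congr (hξ a ha), fun ε hε => ?_, fun ε hε => ?_⟩
  · obtain ⟨δ, hδ, H⟩ := h.2.1 ε hε
    refine ⟨δ, hδ, fun a ha ν hν hW γ hγ => ?_⟩
    refine le_trans (le_of_eq ?_) (H a ha ν hν hW γ hγ)
    congr 1
    refine integral_congr_ae ?_
    filter_upwards [key a ha ν γ hγ] with z hz
    rw [hz]
  · obtain ⟨δ, hδ, H⟩ := h.2.2 ε hε
    refine ⟨δ, hδ, fun a ha ν hν hW γ hγ => ?_⟩
    refine le_trans (le_of_eq ?_) (H a ha ν hν hW γ hγ)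
    congr 1
    refine integral_congr_ae ?_
    filter_upwards [key a ha ν γ hγ] with z hz
    rw [hz]

open Metric in
theorem probOn_map_id_add {R b : ℝ} (hμ : ProbOn (closedBall 0 R) μ) (hb : b ≤ 1)
    {g : Rd d → Rd d} (hg : Continuous g) (hgb : ∀ x, ‖g x‖ ≤ b) :
    ProbOn (closedBall 0 (R + 1)) (μ.map fun x => x + g x) := by
  refine hμ.map (continuous_id.add hg).measurable.aemeasurable
    isClosed_closedBall.measurableSet fun x hx => ?_
  rw [mem_closedBall_zero_iff] at hx ⊢
  exact (norm_add_le _ _).trans (add_le_add hx ((hgb x).trans hb))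

open Metric in
/-- The difference quotients along a gradient direction converge. -/
theorem HasWassersteinGradientOn.tendsto_quotient {R : ℝ} (hμ : ProbOn (closedBall 0 R) μ)
    (hK : closedBall 0 (R + 1) ⊆ K) (h : HasWassersteinGradientOn K S φ μ ξ) {a : ι} (ha : a ∈ S)
    {ψ : Rd d → ℝ} (hψ : IsTestFunction ψ) :
    Tendsto (fun r : ℝ => r⁻¹ * (φ a (μ.map fun x => x + r • gradient ψ x) - φ a μ)) (𝓝[>] 0)
      (𝓝 (∫ x, inner ℝ (ξ a x) (gradient ψ x) ∂μ)) := by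
  obtain ⟨C, hC0, hC⟩ := hψ.exists_bound_gradient
  obtain ⟨D, hD0, hD⟩ := hψ.exists_taylor_bound
  rw [Metric.tendsto_nhds]
  intro ε hε
  obtain ⟨δ, hδ, H⟩ := h.expansion_gradient (isCompact_closedBall _ _) hμ
    (ε := ε / (2 * (C + 1))) (by positivity)
  -- The three smallness conditions serve, in order, the remainder estimate, staying in the ball of
  -- radius `R + 1`, and the optimality of the perturbation.
  have hev : ∀ᶠ r : ℝ in 𝓝[>] 0, 0 < r ∧ r * C < δ ∧ r * C < 1 ∧ r * D < 1 / 2 := by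
    have hlim : ∀ c e : ℝ, 0 < e → ∀ᶠ r : ℝ in 𝓝[>] 0, r * c < e := fun c e he => by
      have : Tendsto (fun r : ℝ => r * c) (𝓝[>] 0) (𝓝 (0 * c)) :=
        ((continuous_id.mul continuous_const).tendsto 0).mono_left nhdsWithin_le_nhds
      rw [zero_mul] at this
      exact this.eventually_lt_const he
    filter_upwards [self_mem_nhdsWithin, hlim C δ hδ, hlim C 1 one_pos, hlim D (1 / 2) (by norm_num)]
      with r h1 h2 h3 h4 using ⟨h1, h2, h3, h4⟩
  filter_upwards [hev] with r ⟨hr, hr1, hr2, hr3⟩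
  have hbound : ∀ x, ‖r • gradient ψ x‖ ≤ r * C := fun x => by
    rw [norm_smul, Real.norm_of_nonneg hr.le]
    exact mul_le_mul_of_nonneg_left (hC x) hr.le
  have hcont : Continuous fun x => r • gradient ψ x := hψ.continuous_gradient.const_smul r
  have := H a ha (fun x => r • gradient ψ x) (fun x => r * ψ x) (r * C) hcont
    (continuous_const.mul hψ.1.continuous) (fun x y => by
      rw [real_inner_smul_left]
      have h1 := hD x y
      have h2 : r * ψ y - r * ψ x - r * inner ℝ (gradient ψ x) (y - x) =
        r * (ψ y - ψ x - inner ℝ (gradient ψ x) (y - x)) := by ring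
      rw [h2, abs_mul, abs_of_pos hr]
      calc r * |ψ y - ψ x - inner ℝ (gradient ψ x) (y - x)| ≤ r * (D * ‖y - x‖ ^ 2) :=
            mul_le_mul_of_nonneg_left h1 hr.le
        _ = (r * D) * ‖y - x‖ ^ 2 := by ring
        _ ≤ _ := mul_le_mul_of_nonneg_right hr3.le (by positivity)) (by positivity) hbound hr1
      ((probOn_map_id_add hμ hr2.le hcont hbound).mono hK)
  simp only [real_inner_smul_right, integral_const_mul] at this
  rw [Real.dist_eq]
  set A := φ a (μ.map fun x => x + r • gradient ψ x) - φ a μ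
  set I := ∫ x, inner ℝ (ξ a x) (gradient ψ x) ∂μ
  have h3 : r⁻¹ * A - I = r⁻¹ * (A - r * I) := by field_simp
  rw [h3, abs_mul, abs_of_pos (inv_pos.2 hr)]
  calc r⁻¹ * |A - r * I| ≤ r⁻¹ * (ε / (2 * (C + 1)) * (r * C)) :=
        mul_le_mul_of_nonneg_left this (inv_pos.2 hr).le
    _ = ε * (C / (2 * (C + 1))) := by field_simp
    _ < ε * 1 := by
        refine mul_lt_mul_of_pos_left ?_ hε
        rw [div_lt_one (by positivity)]
        linarith
    _ = ε := mul_one _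

open Metric in
-- The pairing of a gradient with any `∇ψ` is a limit of difference quotients, which involves
-- neither `K` nor the parameter set, and a tangent vector is determined by these pairings.
theorem HasWassersteinGradientOn.ae_eq {R : ℝ} {K' : Set (Rd d)} {S' : Set ι}
    {ξ' : ι → Rd d → Rd d} (hμ : ProbOn (closedBall 0 R) μ)
    (hK : closedBall 0 (R + 1) ⊆ K) (hK' : closedBall 0 (R + 1) ⊆ K')
    (h : HasWassersteinGradientOn K S φ μ ξ) (h' : HasWassersteinGradientOn K' S' φ μ ξ')
    {a : ι} (ha : a ∈ S) (ha' : a ∈ S') : ξ a =ᵐ[μ] ξ' a := by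
  have := hμ.1
  refine (h.1 a ha).ae_eq_of_integral_inner_gradient_eq (h'.1 a ha') fun ψ hψ => ?_
  exact tendsto_nhds_unique (h.tendsto_quotient hμ hK ha hψ) (h'.tendsto_quotient hμ hK' ha' hψ)

open Metric in
/-- The Wasserstein gradient is a gradient over all compact sets, uniformly in the parameter. -/
theorem hasWassersteinGradientOn_wassersteinGradient {R : ℝ} {s : Set ℝ}
    {f : ℝ × Rd d → Measure (Rd d) → ℝ} (hμ : ProbOn (closedBall 0 R) μ)
    (hf : ∀ K : Set (Rd d), IsCompact K → IsWassersteinDifferentiableOn K (s ×ˢ K) f)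
    {K : Set (Rd d)} (hK : IsCompact K) :
    HasWassersteinGradientOn K (s ×ˢ K) f μ (fun a => wassersteinGradient (f a) μ) := by
  have hball : ∀ r, R + 1 ≤ r → ∃ ξ, HasWassersteinGradientOn (closedBall 0 r)
      (s ×ˢ closedBall 0 r) f μ ξ := fun r hr =>
    hf _ (isCompact_closedBall _ _) μ (hμ.mono (closedBall_subset_closedBall (by linarith)))
  have hgrad : ∀ a ∈ s ×ˢ (univ : Set (Rd d)),
      IsWassersteinGradient (f a) μ (wassersteinGradient (f a) μ) := by
    rintro ⟨τ, x⟩ ⟨hτ, -⟩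
    have hex : ∃ ζ, IsWassersteinGradient (f (τ, x)) μ ζ := by
      obtain ⟨ζ, hζ⟩ := hball (max (R + 1) ‖x‖) (le_max_left _ _)
      refine ⟨ζ (τ, x), fun K' hK' => ?_⟩
      obtain ⟨r, hr⟩ := hK'.isBounded.subset_closedBall 0
      obtain ⟨ζ', hζ'⟩ := hball (max (max (R + 1) ‖x‖) r)
        ((le_max_left _ _).trans (le_max_left _ _))
      -- The same ball limits both the measures and the positions, so it must contain the position
      -- `x` as well as the room `R + 1` needed for uniqueness. A further compact `K'` requires a
      -- larger ball, whose gradient agrees almost everywhere with the first.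
      have hx : x ∈ closedBall (0 : Rd d) (max (R + 1) ‖x‖) := by simp
      have hx' : x ∈ closedBall (0 : Rd d) (max (max (R + 1) ‖x‖) r) := by simp
      have hae := hζ'.ae_eq hμ (closedBall_subset_closedBall
        ((le_max_left _ _).trans (le_max_left _ _)))
        (closedBall_subset_closedBall (le_max_left _ _)) hζ (a := (τ, x)) ⟨hτ, hx'⟩ ⟨hτ, hx⟩
      have hmaps : MapsTo (fun _ : Unit => (τ, x)) univ
          (s ×ˢ closedBall 0 (max (max (R + 1) ‖x‖) r)) := fun _ _ => ⟨hτ, hx'⟩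
      have h1 := hζ'.comp hmaps
      exact (h1.mono (hr.trans (closedBall_subset_closedBall (le_max_right _ _)))
        subset_rfl).congr fun _ _ => hae
    rw [wassersteinGradient, dif_pos hex]
    exact hex.choose_spec
  obtain ⟨r, hr⟩ := hK.isBounded.subset_closedBall 0
  obtain ⟨ζ, hζ⟩ := hball (max (R + 1) r) (le_max_left _ _)
  have hKr : K ⊆ closedBall 0 (max (R + 1) r) :=
    hr.trans (closedBall_subset_closedBall (le_max_right _ _))
  -- A gradient family with uniform remainder exists on a large ball. The canonical representatives
  -- equal it almost everywhere for each parameter, and the remainder estimates are insensitive to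
  -- null sets.
  refine (hζ.congr fun a ha => ?_).mono hKr (prod_mono subset_rfl hKr)
  have h1 := hζ.comp (S' := (univ : Set Unit)) (i := fun _ => a) (fun _ _ => ha)
  have h2 := hgrad a ⟨ha.1, mem_univ _⟩ _ (isCompact_closedBall (0 : Rd d) (R + 1))
  exact h1.ae_eq hμ (closedBall_subset_closedBall (le_max_left _ _)) subset_rfl h2
    (mem_univ ()) (mem_univ ())

end Expansion

end

noncomputable section

/-! ### A `W_1` estimate for fields that differ from a gradient by an orthogonal field -/

section Orthogonal

variable {d : ℕ} {μ : Measure (Rd d)} {R : ℝ}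

open Metric in
theorem exists_isTestFunction_eventuallyEq {f : Rd d → ℝ} (hf : ContDiff ℝ (⊤ : ℕ∞) f) (R : ℝ) :
    ∃ ψ, IsTestFunction ψ ∧ ∀ x ∈ closedBall (0 : Rd d) R, ψ =ᶠ[𝓝 x] f := by
  let χ : ContDiffBump (0 : Rd d) := ⟨|R| + 1, |R| + 2, by positivity, by linarith⟩
  refine ⟨fun x => χ x * f x, ⟨χ.contDiff.mul hf, χ.hasCompactSupport.mul_right⟩, fun x hx => ?_⟩
  have hx' : x ∈ ball (0 : Rd d) χ.rIn := by
    rw [mem_closedBall] at hx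
    rw [mem_ball]
    exact hx.trans_lt ((le_abs_self R).trans_lt (lt_add_one _))
  filter_upwards [χ.eventuallyEq_one_of_mem_ball hx'] with y hy
  simp [hy]

open Metric in
-- Compact support of the test function is no restriction: `μ` lives in a ball, and a cutoff does
-- not change `f` near it.
theorem integral_fderiv_apply_eq_zero (hμ : ProbOn (closedBall 0 R) μ) {q : Rd d → Rd d}
    (hq : MemLp q 2 μ)
    (hq0 : ∀ ψ, IsTestFunction ψ → ∫ x, inner ℝ (gradient ψ x) (q x) ∂μ = 0)
    {f : Rd d → ℝ} (hf : ContDiff ℝ (⊤ : ℕ∞) f) :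
    Integrable (fun x => fderiv ℝ f x (q x)) μ ∧ ∫ x, fderiv ℝ f x (q x) ∂μ = 0 := by
  have := hμ.1
  obtain ⟨ψ, hψ, hψf⟩ := exists_isTestFunction_eventuallyEq hf R
  have hae : (fun x => inner ℝ (gradient ψ x) (q x)) =ᵐ[μ] fun x => fderiv ℝ f x (q x) := by
    filter_upwards [hμ.ae_mem] with x hx
    rw [inner_gradient_left, (hψf x hx).fderiv_eq]
  exact ⟨(integrable_inner_of_memLp (hψ.memLp_gradient μ) hq).congr hae,
    (integral_congr_ae hae).symm.trans (hq0 ψ hψ)⟩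

open Metric in
-- Along the interpolation `T s` from `id + g` to `id + h`, the derivative of `∫ φ(T s) dμ` may be
-- corrected by `∫ D(φ ∘ T s) q dμ = 0`. The field `q` then survives only through `D(T s) - id`,
-- which is bounded by `C`. When `h`, `g`, `q` and `C` are all of order `‖e‖`, the contribution of
-- `q` is therefore quadratic.
theorem wassersteinDist_one_map_id_add_le (hμ : ProbOn (closedBall 0 R) μ) {h g q : Rd d → Rd d}
    (hh : ContDiff ℝ (⊤ : ℕ∞) h) (hg : ContDiff ℝ (⊤ : ℕ∞) g) (hq : MemLp q 2 μ)
    (hq0 : ∀ ψ, IsTestFunction ψ → ∫ x, inner ℝ (gradient ψ x) (q x) ∂μ = 0)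
    {C : ℝ} (hhC : ∀ x ∈ closedBall (0 : Rd d) R, ‖fderiv ℝ h x‖ ≤ C)
    (hgC : ∀ x ∈ closedBall (0 : Rd d) R, ‖fderiv ℝ g x‖ ≤ C) :
    wassersteinDist 1 (μ.map fun x => x + h x) (μ.map fun x => x + g x) ≤
      ∫ x, ‖h x - g x - q x‖ ∂μ + C * ∫ x, ‖q x‖ ∂μ := by
  have := hμ.1
  set B := closedBall (0 : Rd d) R
  have hB : IsCompact B := isCompact_closedBall _ _
  have hhT : Continuous fun x => x + h x := continuous_id.add hh.continuous
  have hgT : Continuous fun x => x + g x := continuous_id.add hg.continuous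
  have hqi : Integrable q μ := hq.integrable (by norm_num)
  set K := (fun x => x + h x) '' B ∪ (fun x => x + g x) '' B
  have hK : IsCompact K := (hB.image hhT).union (hB.image hgT)
  refine wassersteinDist_one_le_of_contDiff_bound hK
    (hμ.map hhT.measurable.aemeasurable hK.measurableSet
      fun x hx => Or.inl (mem_image_of_mem _ hx))
    (hμ.map hgT.measurable.aemeasurable hK.measurableSet
      fun x hx => Or.inr (mem_image_of_mem _ hx)) fun φ hφ hφl => ?_
  rw [integral_map hhT.measurable.aemeasurable hφ.continuous.aestronglyMeasurable,
    integral_map hgT.measurable.aemeasurable hφ.continuous.aestronglyMeasurable]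
  set T : ℝ → Rd d → Rd d := fun s x => x + g x + s • (h x - g x) with hT
  have hTs : ∀ s, ContDiff ℝ (⊤ : ℕ∞) (T s) := fun s =>
    (contDiff_id.add hg).add ((hh.sub hg).const_smul s)
  have hφd : Differentiable ℝ φ := hφ.differentiable (by simp)
  have hφ1 : ∀ x, ‖fderiv ℝ φ x‖ ≤ 1 := fun x => by
    simpa using norm_fderiv_le_of_lipschitz ℝ hφl (x₀ := x)
  have hφc : Continuous (fderiv ℝ φ) := hφ.continuous_fderiv (by simp)
  set F' : ℝ → Rd d → ℝ := fun s x => fderiv ℝ φ (T s x) (h x - g x) with hF'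
  have hF'c : ∀ s, Continuous (F' s) := fun s =>
    (hφc.comp (hTs s).continuous).clm_apply (hh.continuous.sub hg.continuous)
  have hder : ∀ s, HasDerivAt (fun s => ∫ x, φ (T s x) ∂μ) (∫ x, F' s x ∂μ) s := fun s =>
    (hasDerivAt_integral_of_dominated_loc_of_deriv_le (bound := fun x => ‖h x - g x‖)
      univ_mem
      (Eventually.of_forall fun s' =>
        (hφ.continuous.comp (hTs s').continuous).aestronglyMeasurable)
      (integrable_of_ae_mem_isCompact hB hμ.2
        (hφ.continuous.comp (hTs s).continuous).continuousOn)
      (hF'c s).aestronglyMeasurable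
      (Eventually.of_forall fun x s' _ => by
        refine (ContinuousLinearMap.le_opNorm _ _).trans ?_
        exact mul_le_of_le_one_left (norm_nonneg _) (hφ1 _))
      (integrable_of_ae_mem_isCompact hB hμ.2
        (hh.continuous.sub hg.continuous).norm.continuousOn)
      (Eventually.of_forall fun x s' _ => by
        have h1 : HasDerivAt (fun s => T s x) (h x - g x) s' := by
          have h2 := ((hasDerivAt_id s').smul_const (h x - g x)).const_add (x + g x)
          rw [one_smul] at h2
          exact h2
        exact (hφd (T s' x)).hasFDerivAt.comp_hasDerivAt s' h1)).2
  have hbound : ∀ s ∈ Ico (0 : ℝ) 1, ‖∫ x, F' s x ∂μ‖ ≤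
      ∫ x, ‖h x - g x - q x‖ ∂μ + C * ∫ x, ‖q x‖ ∂μ := by
    intro s hs
    obtain ⟨hqint, hqzero⟩ := integral_fderiv_apply_eq_zero hμ hq hq0 (hφ.comp (hTs s))
    have h1 : ∫ x, F' s x ∂μ = ∫ x, (F' s x - fderiv ℝ (φ ∘ T s) x (q x)) ∂μ := by
      rw [integral_sub (integrable_of_ae_mem_isCompact hB hμ.2 (hF'c s).continuousOn) hqint,
        hqzero, sub_zero]
    have hi1 : Integrable (fun x => ‖h x - g x - q x‖) μ :=
      ((integrable_of_ae_mem_isCompact hB hμ.2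
        (hh.continuous.sub hg.continuous).continuousOn).sub hqi).norm
    have hi2 : Integrable (fun x => C * ‖q x‖) μ := hqi.norm.const_mul C
    rw [h1, ← integral_const_mul, ← integral_add hi1 hi2]
    refine norm_integral_le_of_norm_le (hi1.add hi2) ?_
    filter_upwards [hμ.ae_mem] with x hx
    have hgx : HasFDerivAt g (fderiv ℝ g x) x := (hg.differentiable (by simp) x).hasFDerivAt
    have hhx : HasFDerivAt h (fderiv ℝ h x) x := (hh.differentiable (by simp) x).hasFDerivAt
    have hTx : HasFDerivAt (T s) (ContinuousLinearMap.id ℝ (Rd d) + fderiv ℝ g x +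
        s • (fderiv ℝ h x - fderiv ℝ g x)) x :=
      ((hasFDerivAt_id x).add hgx).add ((hhx.sub hgx).const_smul s)
    -- By the chain rule the identity part of `D(T s)` produces `q x` itself, which cancels the
    -- `q`-component of `h - g`. The other two terms form a convex combination bounded by `C ‖q x‖`.
    have hcomp : fderiv ℝ (φ ∘ T s) x (q x) = fderiv ℝ φ (T s x)
        (q x + ((1 - s) • fderiv ℝ g x (q x) + s • fderiv ℝ h x (q x))) := by
      rw [((hφd (T s x)).hasFDerivAt.comp x hTx).fderiv]
      simp only [ContinuousLinearMap.comp_apply, add_apply,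
        ContinuousLinearMap.id_apply, smul_apply,
        sub_apply]
      congr 1
      module
    rw [hcomp, hF', ← map_sub]
    have h3 : ‖(1 - s) • fderiv ℝ g x (q x) + s • fderiv ℝ h x (q x)‖ ≤ C * ‖q x‖ := by
      have hg1 := (fderiv ℝ g x).le_of_opNorm_le (hgC x hx) (q x)
      have hh1 := (fderiv ℝ h x).le_of_opNorm_le (hhC x hx) (q x)
      calc _ ≤ (1 - s) * ‖fderiv ℝ g x (q x)‖ + s * ‖fderiv ℝ h x (q x)‖ := by
            refine (norm_add_le _ _).trans_eq ?_
            rw [norm_smul, norm_smul, Real.norm_of_nonneg hs.1,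
              Real.norm_of_nonneg (sub_nonneg.2 hs.2.le)]
        _ ≤ (1 - s) * (C * ‖q x‖) + s * (C * ‖q x‖) :=
            add_le_add (mul_le_mul_of_nonneg_left hg1 (sub_nonneg.2 hs.2.le))
              (mul_le_mul_of_nonneg_left hh1 hs.1)
        _ = _ := by ring
    refine (ContinuousLinearMap.le_opNorm _ _).trans
      ((mul_le_of_le_one_left (norm_nonneg _) (hφ1 _)).trans ?_)
    rw [← sub_sub]
    exact (norm_sub_le _ _).trans (add_le_add_right h3 _)
  have := norm_image_sub_le_of_norm_deriv_le_segment_01'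
    (fun s _ => (hder s).hasDerivWithinAt) hbound
  have hT1 : ∀ x, T 1 x = x + h x := fun x => by simp [hT]
  have hT0 : ∀ x, T 0 x = x + g x := fun x => by simp [hT]
  simp only [hT1, hT0] at this
  exact (le_abs_self _).trans this

/-- A continuous function on a compact set is approximated by smooth functions of any continuous
injection of the set. -/
theorem exists_contDiff_comp_approx {K : Set (Rd d)} (hK : IsCompact K) {Φ Z : Rd d → Rd d}
    (hΦ : ContinuousOn Φ K) (hinj : InjOn Φ K) (hZ : ContinuousOn Z K) {η : ℝ} (hη : 0 < η) :
    ∃ h : Rd d → Rd d, ContDiff ℝ (⊤ : ℕ∞) h ∧ ∀ y ∈ K, ‖Z y - h (Φ y)‖ ≤ η := by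
  have : CompactSpace K := isCompact_iff_compactSpace.1 hK
  have : TietzeExtension (Rd d) := TietzeExtension.of_homeo
    (EuclideanSpace.equiv (Fin d) ℝ).toHomeomorph
  -- A continuous injection of a compact set is a closed embedding, so `Z ∘ Φ⁻¹` is continuous on
  -- `Φ(K)` and extends by Tietze. Density of smooth maps for uniform convergence on compact sets
  -- then yields `h`.
  have hemb : IsClosedEmbedding (K.domRestrict Φ) :=
    (continuousOn_iff_continuous_domRestrict.1 hΦ).isClosedEmbedding
      (injOn_iff_injective.1 hinj)
  obtain ⟨g, hg⟩ := ContinuousMap.exists_extension' hemb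
    ⟨K.domRestrict Z, continuousOn_iff_continuous_domRestrict.1 hZ⟩
  have hopen : IsOpen {f : C(Rd d, Rd d) | MapsTo (f - g) (Φ '' K) (Metric.ball 0 η)} :=
    (ContinuousMap.isOpen_setOfPred_mapsTo (hK.image_of_continuousOn hΦ)
      Metric.isOpen_ball).preimage
      (f := fun f : C(Rd d, Rd d) => f - g) (by fun_prop)
  obtain ⟨h, hhs, hh⟩ := ContinuousMap.dense_setOfPred_contDiff.exists_mem_open hopen
    ⟨g, fun x _ => by simp [hη]⟩
  refine ⟨h, hhs, fun y hy => ?_⟩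
  have h1 := hh (mem_image_of_mem Φ hy)
  have h2 : g (Φ y) = Z y := congrFun hg ⟨y, hy⟩
  rw [mem_ball_zero_iff, ContinuousMap.coe_sub, Pi.sub_apply, h2, norm_sub_rev] at h1
  exact h1.le

end Orthogonal

end

noncomputable section

/-! ### First-order expansion along arbitrary perturbations -/

section Key

open Metric

variable {d : ℕ} {ι : Type*} {K : Set (Rd d)} {S : Set ι} {φ : ι → Measure (Rd d) → ℝ}
  {μ : Measure (Rd d)} {ξ : ι → Rd d → Rd d} {R L : ℝ}

/-- By the `W_1`-Lipschitz bound the difference quotients along `∇ψ` are at most `L ∫ ‖∇ψ‖`; the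
bound for tangent vectors does the rest. -/
theorem HasWassersteinGradientOn.eLpNorm_le (hμ : ProbOn (closedBall 0 R) μ)
    (hK : closedBall 0 (R + 1) ⊆ K) (h : HasWassersteinGradientOn K S φ μ ξ) (hL : 0 ≤ L)
    (hLip : ∀ a ∈ S, ∀ ν ν', ProbCompact ν → ProbCompact ν' →
      |φ a ν - φ a ν'| ≤ L * wassersteinDist 1 ν ν') {a : ι} (ha : a ∈ S) :
    (eLpNorm (ξ a) 2 μ).toReal ≤ L := by
  have := hμ.1
  refine (h.1 a ha).eLpNorm_le hL fun ψ hψ => ?_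
  refine le_of_tendsto (h.tendsto_quotient hμ hK ha hψ) ?_
  filter_upwards [self_mem_nhdsWithin] with r (hr : 0 < r)
  have hgc : Continuous fun x => r • gradient ψ x := hψ.continuous_gradient.const_smul r
  have hT : Continuous fun x => x + r • gradient ψ x := continuous_id.add hgc
  have hcpt : IsCompact ((fun x => x + r • gradient ψ x) '' closedBall 0 R) :=
    (isCompact_closedBall _ _).image hT
  have h1 := hLip a ha _ _ ⟨_, hcpt, hμ.map hT.measurable.aemeasurable hcpt.measurableSet
    (mapsTo_image _ _)⟩ ⟨_, isCompact_closedBall _ _, hμ⟩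
  have hi : Integrable (fun x => r • gradient ψ x) μ :=
    integrable_of_ae_mem_isCompact (isCompact_closedBall _ _) hμ.2 hgc.continuousOn
  have h2 := wassersteinDist_one_map_le (μ := μ) hT.measurable.aemeasurable aemeasurable_id
    (by simpa using hi)
  rw [Measure.map_id] at h2
  simp only [id, add_sub_cancel_left, norm_smul, Real.norm_of_nonneg hr.le,
    integral_const_mul] at h2
  rw [inv_mul_le_iff₀ hr]
  calc φ a (μ.map fun x => x + r • gradient ψ x) - φ a μ ≤ _ := le_abs_self _
    _ ≤ _ := h1
    _ ≤ L * (r * ∫ x, ‖gradient ψ x‖ ∂μ) := mul_le_mul_of_nonneg_left h2 hL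
    _ = _ := by ring

theorem norm_sum_smul_le {κ E : Type*} [Fintype κ] [NormedAddCommGroup E] [NormedSpace ℝ E]
    (e : EuclideanSpace ℝ κ) {f : κ → E} {C : κ → ℝ} (h : ∀ k, ‖f k‖ ≤ C k) :
    ‖∑ k, e k • f k‖ ≤ ‖e‖ * ∑ k, C k := by
  rw [Finset.mul_sum]
  refine norm_sum_le_of_le _ fun k _ => ?_
  rw [norm_smul]
  exact mul_le_mul (PiLp.norm_apply_le e k) (h k) (norm_nonneg _) (norm_nonneg _)

theorem memLp_two_of_ae_mem_isCompact {X : Type*} [TopologicalSpace X] [MeasurableSpace X]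
    [OpensMeasurableSpace X] [T2Space X] [TopologicalSpace.PseudoMetrizableSpace X]
    {μ : Measure X} [IsFiniteMeasure μ] {K : Set X} (hK : IsCompact K)
    (hμ : μ Kᶜ = 0) {f : X → Rd d} (hf : ContinuousOn f K) : MemLp f 2 μ := by
  have hae : ∀ᵐ x ∂μ, x ∈ K := mem_ae_iff.2 hμ
  obtain ⟨C, hC⟩ := hK.exists_bound_of_continuousOn hf
  refine MemLp.of_bound (integrable_of_ae_mem_isCompact hK hμ hf).1 C ?_
  filter_upwards [hae] with x hx using hC x hx

set_option maxHeartbeats 1000000 in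
/-- The first-order expansion of functionals with a Wasserstein gradient along perturbations
`Φ + ∑ k, e k • Z k` of a continuous injection, uniformly in the functional. -/
theorem HasWassersteinGradientOn.expansion_map {κ : Type*} [Fintype κ] {K₀ : Set (Rd d)}
    (hK₀ : IsCompact K₀) (hμ : ProbOn K₀ μ) {Φ : Rd d → Rd d} (hΦ : ContinuousOn Φ K₀)
    (hinj : InjOn Φ K₀) (hΦR : MapsTo Φ K₀ (closedBall 0 R)) {Z : κ → Rd d → Rd d}
    (hZ : ∀ k, ContinuousOn (Z k) K₀) (hK : closedBall 0 (R + 1) ⊆ K)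
    (h : HasWassersteinGradientOn K S φ (μ.map Φ) ξ) (hL : 0 ≤ L)
    (hLip : ∀ a ∈ S, ∀ ν ν', ProbCompact ν → ProbCompact ν' →
      |φ a ν - φ a ν'| ≤ L * wassersteinDist 1 ν ν') {η : ℝ} (hη : 0 < η) :
    ∃ δ > 0, ∀ e : EuclideanSpace ℝ κ, ‖e‖ < δ → ∀ a ∈ S,
      |φ a (μ.map fun y => Φ y + ∑ k, e k • Z k y) - φ a (μ.map Φ) -
        ∑ k, e k * ∫ y, inner ℝ (ξ a (Φ y)) (Z k y) ∂μ| ≤ η * ‖e‖ := by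
  classical
  have := hμ.1
  have hΦm : AEMeasurable Φ μ := aemeasurable_of_ae_mem_isCompact hK₀ hμ.2 hΦ
  set m := μ.map Φ with hm
  have hmB : ProbOn (closedBall 0 R) m := hμ.map hΦm isClosed_closedBall.measurableSet hΦR
  have := hmB.1
  set n : ℝ := (Fintype.card κ : ℝ) with hn
  have hn0 : 0 ≤ n := Nat.cast_nonneg _
  -- The first-order errors below add up to `(4 L n + 1) η₁ ‖e‖`: `L n` from smoothing, `L n` from
  -- the decomposition, `1` from the gradient expansion and `2 L n` from the linear terms. This uses
  -- half of `η ‖e‖`; the other half is left for the quadratic error.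
  set η₁ := η / (2 * (4 * L * n + 1)) with hη₁def
  have hη₁ : 0 < η₁ := by positivity
  choose H hH hHZ using fun k => exists_contDiff_comp_approx hK₀ hΦ hinj (hZ k) hη₁
  have hHm : ∀ k, MemLp (H k) 2 m := fun k =>
    memLp_two_of_ae_mem_isCompact (isCompact_closedBall _ _) hmB.2 (hH k).continuous.continuousOn
  choose ψ q hψ hq hξq hrm hr using fun k => exists_gradient_add_orthogonal (hHm k) hη₁
  obtain ⟨C₁, hC₁, hψC⟩ := exists_small_combination hψ
  have hDb : ∀ f : Rd d → Rd d, ContDiff ℝ (⊤ : ℕ∞) f →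
      ∃ C, ∀ x ∈ closedBall (0 : Rd d) R, ‖fderiv ℝ f x‖ ≤ C := fun f hf =>
    (isCompact_closedBall _ _).exists_bound_of_continuousOn
      (hf.continuous_fderiv (by simp)).continuousOn
  choose D hD using fun k => hDb (H k) (hH k)
  choose D' hD' using fun k => hDb (gradient (ψ k)) (hψ k).1.gradient_of_top
  set Dm : κ → ℝ := fun k => max (max (D k) (D' k)) 0 with hDm
  have hqn : ∀ k, 0 ≤ ∫ x, ‖q k x‖ ∂m := fun k => integral_nonneg fun _ => norm_nonneg _
  set Q := ∑ k, ∫ x, ‖q k x‖ ∂m with hQ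
  have hQ0 : 0 ≤ Q := Finset.sum_nonneg fun k _ => hqn k
  set C₂ := ∑ k, Dm k with hC₂
  have hC₂0 : 0 ≤ C₂ := Finset.sum_nonneg fun k _ => le_max_right _ _
  obtain ⟨δ₀, hδ₀, hexp⟩ := h.expansion_gradient (isCompact_closedBall _ _) hmB
    (ε := η₁ / (C₁ + 1)) (by positivity)
  -- The first bound on `‖e‖` puts the gradient perturbation within the range `δ₀`. The second gives
  -- `C₁ ‖e‖ ≤ 1/2`, hence optimality and containment in the enlarged ball. The third makes the
  -- quadratic error `L C₂ Q ‖e‖²` at most `η ‖e‖ / 2`.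
  refine ⟨min (min (δ₀ / (C₁ + 1)) (1 / (2 * (C₁ + 1)))) (η / (2 * (L * (C₂ * Q) + 1))),
    by positivity, fun e he a ha => ?_⟩
  have he1 : ‖e‖ < δ₀ / (C₁ + 1) :=
    he.trans_le ((min_le_left _ _).trans (min_le_left _ _))
  have he2 : ‖e‖ < 1 / (2 * (C₁ + 1)) :=
    he.trans_le ((min_le_left _ _).trans (min_le_right _ _))
  have he3 : ‖e‖ < η / (2 * (L * (C₂ * Q) + 1)) := he.trans_le (min_le_right _ _)
  rw [lt_div_iff₀ (by positivity)] at he1 he2 he3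
  have hene := norm_nonneg e
  have hek : ∀ k, |e k| ≤ ‖e‖ := fun k => PiLp.norm_apply_le e k
  -- the two combinations
  set hh : Rd d → Rd d := fun x => ∑ k, e k • H k x with hhdef
  set gg : Rd d → Rd d := fun x => ∑ k, e k • gradient (ψ k) x with ggdef
  set qq : Rd d → Rd d := fun x => ∑ k, e k • q k x with qqdef
  have hhs : ContDiff ℝ (⊤ : ℕ∞) hh := ContDiff.sum fun k _ => (hH k).const_smul (e k)
  have ggs : ContDiff ℝ (⊤ : ℕ∞) gg :=
    ContDiff.sum fun k _ => (hψ k).1.gradient_of_top.const_smul (e k)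
  have hhT : Continuous fun x => x + hh x := continuous_id.add hhs.continuous
  have ggT : Continuous fun x => x + gg x := continuous_id.add ggs.continuous
  have hqq : MemLp qq 2 m := memLp_finsetSum _ fun k _ => (hq k).const_smul (e k)
  have hqi : ∀ k, Integrable (q k) m := fun k => (hq k).integrable (by norm_num)
  have hri : ∀ k, Integrable (fun x => H k x - gradient (ψ k) x - q k x) m :=
    fun k => (hrm k).integrable (by norm_num)
  have hcomp : ∀ T : Rd d → Rd d, Continuous T → ProbCompact (m.map T) := fun T hT => by
    have hc : IsCompact (T '' closedBall 0 R) := (isCompact_closedBall _ _).image hT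
    exact ⟨_, hc, hmB.map hT.measurable.aemeasurable hc.measurableSet (mapsTo_image _ _)⟩
  have hZc : ContinuousOn (fun y => Φ y + ∑ k, e k • Z k y) K₀ :=
    hΦ.add (continuousOn_finsetSum _ fun k _ => (hZ k).const_smul (e k))
  have hHc : ContinuousOn (fun y => Φ y + hh (Φ y)) K₀ :=
    hΦ.add (hhs.continuous.comp_continuousOn hΦ)
  -- replacing `Z` by a smooth field
  have step1 : |φ a (μ.map fun y => Φ y + ∑ k, e k • Z k y) - φ a (m.map fun x => x + hh x)| ≤
      L * (‖e‖ * (n * η₁)) := by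
    have hmap : m.map (fun x => x + hh x) = μ.map fun y => Φ y + hh (Φ y) := by
      rw [hm, AEMeasurable.map_map_of_aemeasurable hhT.measurable.aemeasurable hΦm]
      rfl
    have hcZ : IsCompact ((fun y => Φ y + ∑ k, e k • Z k y) '' K₀) :=
      hK₀.image_of_continuousOn hZc
    refine (hLip a ha _ _ ⟨_, hcZ, hμ.map (aemeasurable_of_ae_mem_isCompact hK₀ hμ.2 hZc)
      hcZ.measurableSet (mapsTo_image _ _)⟩
      (hcomp _ hhT)).trans ?_
    refine mul_le_mul_of_nonneg_left ?_ hL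
    rw [hmap]
    refine (wassersteinDist_one_map_le (aemeasurable_of_ae_mem_isCompact hK₀ hμ.2 hZc)
      (aemeasurable_of_ae_mem_isCompact hK₀ hμ.2 hHc)
      (integrable_of_ae_mem_isCompact hK₀ hμ.2 (hZc.sub hHc))).trans ?_
    have hle : ∀ᵐ y ∂μ, ‖(Φ y + ∑ k, e k • Z k y) - (Φ y + hh (Φ y))‖ ≤ ‖e‖ * (n * η₁) := by
      filter_upwards [hμ.ae_mem] with y hy
      rw [add_sub_add_left_eq_sub, hhdef]
      simp only
      rw [← Finset.sum_sub_distrib]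
      simp only [← smul_sub]
      refine (norm_sum_smul_le e (fun k => hHZ k y hy)).trans_eq ?_
      simp [hn]
    calc _ ≤ ∫ _, ‖e‖ * (n * η₁) ∂μ :=
          integral_mono_ae (integrable_of_ae_mem_isCompact hK₀ hμ.2 (hZc.sub hHc)).norm
            (integrable_const _) hle
      _ = _ := by simp
  -- replacing the smooth field by a gradient
  have step2 : |φ a (m.map fun x => x + hh x) - φ a (m.map fun x => x + gg x)| ≤
      L * (‖e‖ * (n * η₁) + (‖e‖ * C₂) * (‖e‖ * Q)) := by
    refine (hLip a ha _ _ (hcomp _ hhT)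
      (hcomp _ ggT)).trans ?_
    refine mul_le_mul_of_nonneg_left ?_ hL
    refine (wassersteinDist_one_map_id_add_le hmB hhs ggs hqq (C := ‖e‖ * C₂) ?_ ?_ ?_).trans ?_
    · intro ψ' hψ'
      simp only [qqdef, inner_sum, real_inner_smul_right]
      rw [integral_finsetSum]
      · refine Finset.sum_eq_zero fun k _ => ?_
        rw [integral_const_mul, hξq k _ (hψ'.isTangent m), mul_zero]
      · exact fun k _ => (integrable_inner_of_memLp (hψ'.memLp_gradient m) (hq k)).const_mul _
    · intro x hx
      have hder : HasFDerivAt hh (∑ k, e k • fderiv ℝ (H k) x) x := HasFDerivAt.fun_sum fun k _ =>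
        ((hH k).differentiable (by simp) x).hasFDerivAt.const_smul (e k)
      rw [hder.fderiv]
      exact norm_sum_smul_le e fun k =>
        (hD k x hx).trans ((le_max_left _ _).trans (le_max_left _ _))
    · intro x hx
      have hder : HasFDerivAt gg (∑ k, e k • fderiv ℝ (gradient (ψ k)) x) x :=
        HasFDerivAt.fun_sum fun k _ =>
          ((hψ k).1.gradient_of_top.differentiable (by simp) x).hasFDerivAt.const_smul (e k)
      rw [hder.fderiv]
      exact norm_sum_smul_le e fun k =>
        (hD' k x hx).trans ((le_max_right _ _).trans (le_max_left _ _))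
    · have hsumint : ∀ (f : κ → Rd d → Rd d), (∀ k, Integrable (f k) m) →
          ∫ x, ‖∑ k, e k • f k x‖ ∂m ≤ ‖e‖ * ∑ k, ∫ x, ‖f k x‖ ∂m := by
        intro f hf
        calc ∫ x, ‖∑ k, e k • f k x‖ ∂m ≤ ∫ x, ‖e‖ * ∑ k, ‖f k x‖ ∂m := by
              refine integral_mono
                (integrable_finsetSum _ fun k _ => (hf k).smul (e k)).norm
                ((integrable_finsetSum _ fun k _ => (hf k).norm).const_mul _) fun x => ?_
              exact norm_sum_smul_le e fun k => le_rfl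
          _ = _ := by
              rw [integral_const_mul, integral_finsetSum _ fun k _ => (hf k).norm]
      refine add_le_add ?_ (mul_le_mul_of_nonneg_left (hsumint q hqi) (by positivity))
      have heq : ∀ x, hh x - gg x - qq x =
          ∑ k, e k • (H k x - gradient (ψ k) x - q k x) := fun x => by
        simp only [hhdef, ggdef, qqdef, smul_sub, Finset.sum_sub_distrib]
      simp only [heq]
      refine (hsumint _ hri).trans (mul_le_mul_of_nonneg_left ?_ hene)
      calc ∑ k, ∫ x, ‖H k x - gradient (ψ k) x - q k x‖ ∂m ≤ ∑ _k : κ, η₁ :=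
            Finset.sum_le_sum fun k _ => (integral_norm_le_eLpNorm_two (hrm k)).trans (hr k)
        _ = n * η₁ := by simp [hn]
  -- expansion along the gradient
  have step3 : |φ a (m.map fun x => x + gg x) - φ a m - ∫ x, inner ℝ (ξ a x) (gg x) ∂m| ≤
      ‖e‖ * η₁ := by
    have hb : C₁ * ‖e‖ ≤ 1 / 2 := by nlinarith
    have := hexp a ha gg (fun x => ∑ k, e k * ψ k x) (C₁ * ‖e‖) ggs.continuous
      (IsTestFunction.sum (fun k => e k) (s := Finset.univ) (fun k _ => hψ k)).1.continuous
      (fun x y => ((hψC e).2 x y).trans (mul_le_mul_of_nonneg_right hb (by positivity)))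
      (by positivity) (hψC e).1 (by nlinarith)
      ((probOn_map_id_add hmB (by linarith) ggs.continuous (hψC e).1).mono hK)
    refine this.trans ?_
    rw [div_mul_eq_mul_div, div_le_iff₀ (by positivity)]
    nlinarith [mul_nonneg hη₁.le hene]
  -- comparison of the linear terms
  have hξL := h.eLpNorm_le hmB hK hL hLip ha
  have hξm := (h.1 a ha).1
  have hξμ : MemLp (fun y => ξ a (Φ y)) 2 μ := by
    rw [hm] at hξm
    exact hξm.comp_of_map hΦm
  have hξLμ : (eLpNorm (fun y => ξ a (Φ y)) 2 μ).toReal ≤ L := by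
    rw [hm, eLpNorm_map_measure hξm.1 hΦm] at hξL
    exact hξL
  have step4 : |∫ x, inner ℝ (ξ a x) (gg x) ∂m -
      ∑ k, e k * ∫ y, inner ℝ (ξ a (Φ y)) (Z k y) ∂μ| ≤ ‖e‖ * (n * (2 * L * η₁)) := by
    have h1 : ∫ x, inner ℝ (ξ a x) (gg x) ∂m =
        ∑ k, e k * ∫ x, inner ℝ (ξ a x) (gradient (ψ k) x) ∂m := by
      simp only [ggdef, inner_sum, real_inner_smul_right]
      rw [integral_finsetSum _ fun k _ =>
        (integrable_inner_of_memLp hξm ((hψ k).memLp_gradient m)).const_mul _]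
      simp only [integral_const_mul]
    rw [h1, ← Finset.sum_sub_distrib]
    simp only [← mul_sub]
    -- Passing from `∇ψ_k` to `H_k` costs only the small remainder, because the tangent vector `ξ a`
    -- is orthogonal to `q_k`. Passing from `H_k ∘ Φ` to `Z_k` costs the approximation error. Each
    -- is at most `L η₁`, as `ξ a` has `L²` norm at most `L`.
    have hk : ∀ k, ‖∫ x, inner ℝ (ξ a x) (gradient (ψ k) x) ∂m -
        ∫ y, inner ℝ (ξ a (Φ y)) (Z k y) ∂μ‖ ≤ 2 * L * η₁ := by
      intro k
      have hZm : MemLp (Z k) 2 μ := memLp_two_of_ae_mem_isCompact hK₀ hμ.2 (hZ k)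
      have hHΦc : ContinuousOn (fun y => H k (Φ y)) K₀ :=
        (hH k).continuous.comp_continuousOn hΦ
      have hHΦ : MemLp (fun y => H k (Φ y)) 2 μ :=
        memLp_two_of_ae_mem_isCompact hK₀ hμ.2 hHΦc
      have e1 : ∫ x, inner ℝ (ξ a x) (H k x) ∂m = ∫ y, inner ℝ (ξ a (Φ y)) (H k (Φ y)) ∂μ := by
        rw [hm, integral_map hΦm]
        rw [← hm]
        exact hξm.1.inner (hHm k).1
      have e2 : ∫ x, inner ℝ (ξ a x) (H k x - gradient (ψ k) x - q k x) ∂m =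
          ∫ x, inner ℝ (ξ a x) (H k x) ∂m - ∫ x, inner ℝ (ξ a x) (gradient (ψ k) x) ∂m := by
        simp only [inner_sub_right]
        rw [integral_sub (f := fun x => inner ℝ (ξ a x) (H k x) -
            inner ℝ (ξ a x) (gradient (ψ k) x)) ((integrable_inner_of_memLp hξm (hHm k)).sub
          (integrable_inner_of_memLp hξm ((hψ k).memLp_gradient m)))
          (integrable_inner_of_memLp hξm (hq k)),
          integral_sub (integrable_inner_of_memLp hξm (hHm k))
          (integrable_inner_of_memLp hξm ((hψ k).memLp_gradient m)), hξq k _ (h.1 a ha), sub_zero]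
      have e3 : ∫ y, inner ℝ (ξ a (Φ y)) (Z k y - H k (Φ y)) ∂μ =
          ∫ y, inner ℝ (ξ a (Φ y)) (Z k y) ∂μ - ∫ y, inner ℝ (ξ a (Φ y)) (H k (Φ y)) ∂μ := by
        simp only [inner_sub_right]
        exact integral_sub (integrable_inner_of_memLp hξμ hZm)
          (integrable_inner_of_memLp hξμ hHΦ)
      have b1 := (abs_integral_inner_le hξm (hrm k)).trans
        (mul_le_mul hξL (hr k) ENNReal.toReal_nonneg hL)
      have b2 := (abs_integral_inner_le hξμ (hZm.sub hHΦ)).trans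
        (mul_le_mul hξLμ (eLpNorm_two_toReal_le_of_bound (μ := μ) (C := η₁) hη₁.le (by
          filter_upwards [hμ.ae_mem] with y hy using hHZ k y hy)) ENNReal.toReal_nonneg hL)
      simp only [Pi.sub_apply] at b2
      rw [e2] at b1
      rw [e3] at b2
      rw [e1] at b1
      rw [Real.norm_eq_abs]
      rw [abs_le] at b1 b2 ⊢
      constructor <;> linarith [b1.1, b1.2, b2.1, b2.2]
    have := norm_sum_smul_le e hk
    simpa [hn] using this
  have hηn : 4 * L * n * η₁ + η₁ = η / 2 := by
    rw [hη₁def]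
    field_simp
  have hfin : L * (C₂ * Q) * ‖e‖ ≤ η / 2 := by nlinarith
  have hfin' := mul_le_mul_of_nonneg_left hfin hene
  have hηn' : ‖e‖ * (4 * L * n * η₁ + η₁) = ‖e‖ * (η / 2) := by rw [hηn]
  rw [abs_le] at step1 step2 step3 step4 ⊢
  constructor <;>
    linarith [step1.1, step1.2, step2.1, step2.2, step3.1, step3.2, step4.1, step4.2]

end Key

end

noncomputable section

/-! ### Integral inequalities -/

/-- The supremum is finite by the a priori bound and satisfies `m ≤ m / 2 + A`. Working with a
supremum spares any measurability of `u`. -/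
theorem le_two_mul_of_bootstrap {α : Type*} {I : Set α} {u : α → ℝ} {A b₀ : ℝ} (hA : 0 ≤ A)
    (hb : ∀ t ∈ I, u t ≤ b₀)
    (h : ∀ b, 0 ≤ b → (∀ t ∈ I, u t ≤ b) → ∀ t ∈ I, u t ≤ b / 2 + A) :
    ∀ t ∈ I, u t ≤ 2 * A := by
  intro t ht
  set m := sSup (u '' I) with hm
  have hbdd : BddAbove (u '' I) := ⟨b₀, by rintro _ ⟨x, hx, rfl⟩; exact hb x hx⟩
  have hle : ∀ x ∈ I, u x ≤ max m 0 := fun x hx =>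
    (le_csSup hbdd (mem_image_of_mem u hx)).trans (le_max_left _ _)
  have h1 := h (max m 0) (le_max_right _ _) hle
  have h2 : m ≤ max m 0 / 2 + A := by
    refine csSup_le ⟨u t, mem_image_of_mem u ht⟩ ?_
    rintro _ ⟨x, hx, rfl⟩
    exact h1 x hx
  have h3 : max m 0 ≤ max m 0 / 2 + A := max_le h2 (by positivity)
  linarith [hle t ht]

/-- The weight integrates to at most its final value divided by `l`, forwards and backwards in time;
this gain of `1 / l` absorbs the Lipschitz terms. -/
theorem abs_integral_exp_abs_le {l : ℝ} (hl : 0 < l) (s t : ℝ) :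
    |∫ τ in s..t, Real.exp (l * |τ - s|)| ≤ Real.exp (l * |t - s|) / l := by
  rcases le_total s t with hst | hst
  · have h1 : ∫ τ in s..t, Real.exp (l * |τ - s|) = ∫ τ in s..t, Real.exp (l * (τ - s)) := by
      refine intervalIntegral.integral_congr fun τ hτ => ?_
      rw [uIcc_of_le hst] at hτ
      simp only [abs_of_nonneg (sub_nonneg.2 hτ.1)]
    have h2 : ∫ τ in s..t, Real.exp (l * (τ - s)) =
        Real.exp (l * (t - s)) / l - Real.exp (l * (s - s)) / l := by
      refine intervalIntegral.integral_eq_sub_of_hasDerivAt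
        (f := fun τ => Real.exp (l * (τ - s)) / l) (fun τ _ => ?_)
        (Continuous.intervalIntegrable (by fun_prop) _ _)
      have := ((((hasDerivAt_id τ).sub_const s).const_mul l).exp).div_const l
      simpa [hl.ne'] using this
    rw [h1, h2, abs_of_nonneg (sub_nonneg.2 hst), sub_self, mul_zero, Real.exp_zero,
      ← sub_div, abs_of_nonneg]
    · gcongr
      linarith
    · refine div_nonneg (sub_nonneg.2 (Real.one_le_exp ?_)) hl.le
      exact mul_nonneg hl.le (sub_nonneg.2 hst)
  · have h1 : ∫ τ in s..t, Real.exp (l * |τ - s|) = ∫ τ in s..t, Real.exp (l * (s - τ)) := by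
      refine intervalIntegral.integral_congr fun τ hτ => ?_
      rw [uIcc_of_ge hst] at hτ
      simp only [abs_of_nonpos (sub_nonpos.2 hτ.2), neg_sub]
    have h2 : ∫ τ in s..t, Real.exp (l * (s - τ)) =
        -Real.exp (l * (s - t)) / l - -Real.exp (l * (s - s)) / l := by
      refine intervalIntegral.integral_eq_sub_of_hasDerivAt
        (f := fun τ => -Real.exp (l * (s - τ)) / l) (fun τ _ => ?_)
        (Continuous.intervalIntegrable (by fun_prop) _ _)
      have := ((((hasDerivAt_id τ).const_sub s).const_mul l).exp).neg.div_const l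
      exact this.congr_deriv (by simp [hl.ne'])
    rw [h1, h2, abs_of_nonpos (sub_nonpos.2 hst), neg_sub, sub_self, mul_zero, Real.exp_zero,
      ← sub_div, abs_of_nonpos, neg_div', neg_sub]
    · gcongr
      linarith
    · refine div_nonpos_of_nonpos_of_nonneg ?_ hl.le
      have : 1 ≤ Real.exp (l * (s - t)) :=
        Real.one_le_exp (mul_nonneg hl.le (sub_nonneg.2 hst))
      linarith

section Gronwall

variable {E : Type*} [NormedAddCommGroup E] [NormedSpace ℝ E]

theorem uIoc_subset_of_ordConnected {I : Set ℝ} (hI : I.OrdConnected) {s t : ℝ} (hs : s ∈ I)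
    (ht : t ∈ I) : uIoc s t ⊆ I :=
  uIoc_subset_uIcc.trans (hI.uIcc_subset hs ht)

theorem norm_integral_le_of_exp_bound {I : Set ℝ} (hI : I.OrdConnected) {s t : ℝ} (hs : s ∈ I)
    (ht : t ∈ I) {q : ℝ → E} {g : ℝ → ℝ} {c l G : ℝ} (hl : 0 < l) (hc : 0 ≤ c)
    (hq : ∀ τ ∈ I, ‖q τ‖ ≤ c * Real.exp (l * |τ - s|) + g τ)
    (hg : IntervalIntegrable g volume s t) (hgG : |∫ τ in s..t, g τ| ≤ G) :
    ‖∫ τ in s..t, q τ‖ ≤ c * (Real.exp (l * |t - s|) / l) + G := by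
  have hi : IntervalIntegrable (fun τ => c * Real.exp (l * |τ - s|)) volume s t :=
    Continuous.intervalIntegrable (by fun_prop) _ _
  refine (intervalIntegral.norm_integral_le_abs_of_norm_le
    (g := fun τ => c * Real.exp (l * |τ - s|) + g τ) ?_ (hi.add hg)).trans ?_
  · exact ae_restrict_of_forall_mem measurableSet_uIoc
      fun τ hτ => hq τ (uIoc_subset_of_ordConnected hI hs ht hτ)
  · rw [intervalIntegral.integral_add hi hg, intervalIntegral.integral_const_mul]
    refine (abs_add_le _ _).trans (add_le_add ?_ hgG)
    rw [abs_mul, abs_of_nonneg hc]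
    exact mul_le_mul_of_nonneg_left (abs_integral_exp_abs_le hl s t) hc

/-- A Grönwall inequality which asks for no measurability of the solution. -/
theorem norm_le_of_integral_inequality {I : Set ℝ} (hI : I.OrdConnected) {s : ℝ} (hs : s ∈ I)
    {r q : ℝ → E} {g : ℝ → ℝ} {r₀ : E} {L c l G b₀ : ℝ} (hL : 0 ≤ L) (hc : 0 ≤ c)
    (hl : 0 < l) (hLl : 2 * L ≤ l) (hr : ∀ t ∈ I, r t = r₀ + ∫ τ in s..t, q τ)
    (hq : ∀ τ ∈ I, ‖q τ‖ ≤ L * ‖r τ‖ + c * Real.exp (l * |τ - s|) + g τ)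
    (hg : ∀ t ∈ I, IntervalIntegrable g volume s t) (hgG : ∀ t ∈ I, |∫ τ in s..t, g τ| ≤ G)
    (hb : ∀ t ∈ I, ‖r t‖ ≤ b₀) :
    ∀ t ∈ I, ‖r t‖ ≤ Real.exp (l * |t - s|) * (2 * (c / l) + 2 * (‖r₀‖ + G)) := by
  have hG : 0 ≤ G := (abs_nonneg _).trans (hgG s hs)
  have hexp : ∀ t, 1 ≤ Real.exp (l * |t - s|) := fun t => Real.one_le_exp (by positivity)
  have key := le_two_mul_of_bootstrap (I := I) (u := fun t => ‖r t‖ / Real.exp (l * |t - s|))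
    (A := c / l + (‖r₀‖ + G)) (b₀ := b₀) (by positivity)
    (fun t ht => (div_le_self (norm_nonneg _) (hexp t)).trans (hb t ht)) (by
      intro b hb0 hbt t ht
      rw [div_le_iff₀ (Real.exp_pos _), hr t ht]
      have h1 : ∀ τ ∈ I, ‖q τ‖ ≤ (L * b + c) * Real.exp (l * |τ - s|) + g τ := by
        intro τ hτ
        have h2 := hbt τ hτ
        rw [div_le_iff₀ (Real.exp_pos _)] at h2
        have h3 := mul_le_mul_of_nonneg_left h2 hL
        linarith [hq τ hτ]
      have h2 := norm_integral_le_of_exp_bound hI hs ht hl (by positivity) h1 (hg t ht) (hgG t ht)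
      -- This is where `2 L ≤ l` is used: after the gain of `1 / l`, the unknown returns with the
      -- factor `1/2` required by the bootstrap.
      have h3 : L * b ≤ l * b / 2 := by nlinarith
      have h4 : (L * b + c) * (Real.exp (l * |t - s|) / l) ≤
          (b / 2 + c / l) * Real.exp (l * |t - s|) := by
        calc (L * b + c) * (Real.exp (l * |t - s|) / l)
            ≤ (l * b / 2 + c) * (Real.exp (l * |t - s|) / l) := by gcongr
          _ = _ := by field_simp
      have h5 : ‖r₀‖ + G ≤ (‖r₀‖ + G) * Real.exp (l * |t - s|) :=
        le_mul_of_one_le_right (by positivity) (hexp t)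
      linarith [norm_add_le r₀ (∫ τ in s..t, q τ)])
  intro t ht
  have := key t ht
  rw [div_le_iff₀ (Real.exp_pos _)] at this
  linarith

end Gronwall

/-! ### Volterra equations -/

section Volterra

variable {X E : Type*} [TopologicalSpace X] [NormedAddCommGroup E] [NormedSpace ℝ E]

theorem continuous_primitive_of_dominated [FirstCountableTopology X] {n : X → ℝ → E} (s : ℝ)
    {ω : X → ℝ} {κ : ℝ → ℝ} (hω : Continuous ω) (hκ : Continuous κ) (hκ0 : ∀ τ, 0 ≤ κ τ)
    (hmeas : ∀ x, AEStronglyMeasurable (n x) volume) (hcont : ∀ τ, Continuous fun x => n x τ)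
    (hbound : ∀ x τ, ‖n x τ‖ ≤ ω x * κ τ) :
    Continuous fun p : ℝ × X => ∫ τ in s..p.1, n p.2 τ := by
  rw [continuous_iff_continuousAt]
  rintro ⟨t, x⟩
  have h1 : ContinuousAt (fun p : X × ℝ => ∫ τ in s..p.2, n p.1 τ) (x, t) := by
    refine intervalIntegral.continuousAt_parametric_primitive_of_dominated (μ := volume)
      (fun τ => (ω x + 1) * κ τ) (min s t - 1) (max s t + 1)
      (fun y => (hmeas y).restrict) ?_ ?_
      (Eventually.of_forall fun τ => (hcont τ).continuousAt) ?_ ?_ (by simp)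
    · have : ∀ᶠ y in 𝓝 x, ω y < ω x + 1 := hω.continuousAt.eventually_lt_const (lt_add_one _)
      filter_upwards [this] with y hy
      exact Eventually.of_forall fun τ =>
        (hbound y τ).trans (mul_le_mul_of_nonneg_right hy.le (hκ0 τ))
    · exact (hκ.const_mul _).intervalIntegrable _ _
    · exact ⟨by linarith [min_le_left s t], by linarith [le_max_left s t]⟩
    · exact ⟨by linarith [min_le_right s t], by linarith [le_max_right s t]⟩
  exact ContinuousAt.comp (x := (t, x)) (f := Prod.swap) h1 continuous_swap.continuousAt

open BoundedContinuousFunction in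
/-- Existence of solutions of Volterra integral equations `f t x = ∫ τ in s..t, N τ (f τ) x`. -/
theorem exists_volterra_solution [FirstCountableTopology X] [CompleteSpace E] (s : ℝ) {ω : X → ℝ}
    (hω : Continuous ω) (hω0 : ∀ x, 0 < ω x) (N : ℝ → (X → E) → X → E) {C : ℝ} (hC : 0 < C)
    (hmeas : ∀ f : ℝ → X → E, Continuous (Function.uncurry f) →
      (∀ t, ∃ b, ∀ x, ‖f t x‖ ≤ b * ω x) → ∀ x, AEStronglyMeasurable (fun τ => N τ (f τ) x) volume)
    (hcont : ∀ τ g, Continuous g → (∃ b, ∀ x, ‖g x‖ ≤ b * ω x) → Continuous (N τ g))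
    (hzero : ∀ τ x, ‖N τ (fun _ => 0) x‖ ≤ C * ω x)
    (hlip : ∀ τ g g' b, Continuous g → Continuous g' → (∃ b, ∀ x, ‖g x‖ ≤ b * ω x) →
      (∃ b, ∀ x, ‖g' x‖ ≤ b * ω x) → 0 ≤ b → (∀ x, ‖g x - g' x‖ ≤ b * ω x) →
      ∀ x, ‖N τ g x - N τ g' x‖ ≤ C * b * ω x) :
    ∃ f : ℝ → X → E, Continuous (Function.uncurry f) ∧ (∀ t, ∃ b, ∀ x, ‖f t x‖ ≤ b * ω x) ∧
      ∀ t x, IntervalIntegrable (fun τ => N τ (f τ) x) volume s t ∧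
        f t x = ∫ τ in s..t, N τ (f τ) x := by
  -- A Bielecki weight: the rate `2 C` turns the Lipschitz constant `C` into a contraction factor
  -- `1/2` on the whole time line, with no short-time iteration.
  set κ : ℝ → ℝ := fun τ => Real.exp (2 * C * |τ - s|) with hκ
  have hκc : Continuous κ := by fun_prop
  have hκ0 : ∀ τ, 0 < κ τ := fun τ => Real.exp_pos _
  have hκ1 : ∀ τ, 1 ≤ κ τ := fun τ => Real.one_le_exp (by positivity)
  -- The unknown is written as `κ ω F` with `F` bounded and continuous, so that the weighted space
  -- is the complete space of bounded continuous functions.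
  let sl : (ℝ × X →ᵇ E) → ℝ → X → E := fun F τ x => (κ τ * ω x) • F (τ, x)
  have hslc : ∀ F, Continuous (Function.uncurry (sl F)) := fun F => by
    change Continuous fun p : ℝ × X => (κ p.1 * ω p.2) • F (p.1, p.2)
    fun_prop
  have hslc' : ∀ F τ, Continuous (sl F τ) := fun F τ => by
    change Continuous fun x => (κ τ * ω x) • F (τ, x)
    fun_prop
  have hslb' : ∀ F τ x, ‖sl F τ x‖ ≤ ‖F‖ * κ τ * ω x := fun F τ x => by
    rw [norm_smul, Real.norm_of_nonneg (mul_pos (hκ0 τ) (hω0 x)).le]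
    calc _ ≤ κ τ * ω x * ‖F‖ :=
          mul_le_mul_of_nonneg_left (F.norm_coe_le_norm _) (mul_pos (hκ0 τ) (hω0 x)).le
      _ = _ := by ring
  have hslb : ∀ F τ, ∃ b, ∀ x, ‖sl F τ x‖ ≤ b * ω x := fun F τ => ⟨_, hslb' F τ⟩
  have hm : ∀ F x, AEStronglyMeasurable (fun τ => N τ (sl F τ) x) volume := fun F x =>
    hmeas _ (hslc F) (hslb F) x
  have hz : ∃ b : ℝ, ∀ x : X, ‖(0 : E)‖ ≤ b * ω x := ⟨0, fun x => by simp⟩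
  have hNb : ∀ F x τ, ‖N τ (sl F τ) x‖ ≤ C * (1 + ‖F‖) * ω x * κ τ := by
    intro F x τ
    have h1 := hlip τ (sl F τ) (fun _ => 0) (‖F‖ * κ τ) (hslc' F τ) continuous_const (hslb F τ)
      hz (mul_nonneg (norm_nonneg _) (hκ0 τ).le) (fun x => by simpa using hslb' F τ x) x
    have h2 : C * ω x ≤ C * ω x * κ τ :=
      le_mul_of_one_le_right (mul_nonneg hC.le (hω0 x).le) (hκ1 τ)
    calc ‖N τ (sl F τ) x‖ ≤ ‖N τ (sl F τ) x - N τ (fun _ => 0) x‖ + ‖N τ (fun _ => 0) x‖ := by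
          simpa using norm_add_le (N τ (sl F τ) x - N τ (fun _ => 0) x) (N τ (fun _ => 0) x)
      _ ≤ C * (‖F‖ * κ τ) * ω x + C * ω x := add_le_add h1 (hzero τ x)
      _ ≤ C * (‖F‖ * κ τ) * ω x + C * ω x * κ τ := by gcongr
      _ = _ := by ring
  have hNd : ∀ F F' x τ, ‖N τ (sl F τ) x - N τ (sl F' τ) x‖ ≤ C * ‖F - F'‖ * ω x * κ τ := by
    intro F F' x τ
    have h1 := hlip τ (sl F τ) (sl F' τ) (‖F - F'‖ * κ τ) (hslc' F τ) (hslc' F' τ) (hslb F τ)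
      (hslb F' τ) (mul_nonneg (norm_nonneg _) (hκ0 τ).le) (fun x => by
        have := hslb' (F - F') τ x
        simpa [sl, smul_sub] using this) x
    exact h1.trans_eq (by ring)
  have hint : ∀ F t x, IntervalIntegrable (fun τ => N τ (sl F τ) x) volume s t := by
    intro F t x
    refine IntervalIntegrable.mono_fun' (g := fun τ => C * (1 + ‖F‖) * ω x * κ τ)
      ((hκc.const_mul _).intervalIntegrable _ _) (hm F x).restrict ?_
    exact Eventually.of_forall fun τ => hNb F x τ
  have hexp : ∀ {q : ℝ → E} {c : ℝ} (t : ℝ), 0 ≤ c → (∀ τ, ‖q τ‖ ≤ c * κ τ) →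
      ‖∫ τ in s..t, q τ‖ ≤ c * κ t / (2 * C) := by
    intro q c t hc hq
    have := norm_integral_le_of_exp_bound (I := univ) ordConnected_univ (s := s) (t := t)
      (mem_univ _) (mem_univ _) (g := fun _ => 0) (G := 0) (l := 2 * C) (by positivity) hc
      (fun τ _ => by simpa using hq τ) (by simp) (by simp)
    rw [add_zero, ← mul_div_assoc] at this
    exact this
  let P : (ℝ × X →ᵇ E) → ℝ × X → E := fun F p => ∫ τ in s..p.1, N τ (sl F τ) p.2
  have hPc : ∀ F, Continuous (P F) := fun F =>
    continuous_primitive_of_dominated (n := fun x τ => N τ (sl F τ) x) s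
      (hω.const_mul (C * (1 + ‖F‖))) hκc (fun τ => (hκ0 τ).le) (hm F)
      (fun τ => hcont τ _ (hslc' F τ) (hslb F τ)) (hNb F)
  have hinv : ∀ (p : ℝ × X) (v : E) (c : ℝ), ‖v‖ ≤ c * ω p.2 * κ p.1 / (2 * C) →
      ‖(κ p.1 * ω p.2)⁻¹ • v‖ ≤ c / (2 * C) := by
    intro p v c hv
    have hpos : 0 < κ p.1 * ω p.2 := mul_pos (hκ0 _) (hω0 _)
    rw [norm_smul, norm_inv, Real.norm_of_nonneg hpos.le, inv_mul_le_iff₀ hpos]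
    exact hv.trans_eq (by ring)
  let T : (ℝ × X →ᵇ E) → (ℝ × X →ᵇ E) := fun F =>
    BoundedContinuousFunction.ofNormedAddCommGroup (fun p => (κ p.1 * ω p.2)⁻¹ • P F p)
      (((hκc.comp continuous_fst).mul (hω.comp continuous_snd)).inv₀
        (fun p => (mul_pos (hκ0 _) (hω0 _)).ne') |>.smul (hPc F)) (C * (1 + ‖F‖) / (2 * C))
      (fun p => hinv p _ _ (hexp p.1
        (mul_nonneg (mul_nonneg hC.le (by positivity)) (hω0 _).le) (hNb F p.2)))
  have hT : ContractingWith (1 / 2) T := by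
    refine ⟨by
      rw [← NNReal.coe_lt_coe]
      norm_num, LipschitzWith.of_dist_le_mul fun F F' => ?_⟩
    rw [dist_eq_norm, dist_eq_norm, BoundedContinuousFunction.norm_le (by positivity)]
    intro p
    have h1 : (T F - T F') p = (κ p.1 * ω p.2)⁻¹ • ∫ τ in s..p.1,
        (N τ (sl F τ) p.2 - N τ (sl F' τ) p.2) := by
      rw [intervalIntegral.integral_sub (hint F _ _) (hint F' _ _), smul_sub]
      rfl
    rw [h1]
    refine (hinv p _ (C * ‖F - F'‖) (hexp p.1
      (mul_nonneg (mul_nonneg hC.le (norm_nonneg _)) (hω0 _).le) (hNd F F' p.2))).trans_eq ?_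
    rw [mul_comm 2 C, mul_div_mul_left _ _ hC.ne', NNReal.coe_div, NNReal.coe_one, NNReal.coe_ofNat]
    ring
  set F := ContractingWith.fixedPoint T hT with hF
  have hFT : T F = F := hT.fixedPoint_isFixedPt
  refine ⟨sl F, hslc F, hslb F, fun t x => ⟨hint F t x, ?_⟩⟩
  have h1 : F (t, x) = (κ t * ω x)⁻¹ • P F (t, x) := by
    conv_lhs => rw [← hFT]
    rfl
  change (κ t * ω x) • F (t, x) = P F (t, x)
  rw [h1, smul_inv_smul₀ (mul_pos (hκ0 t) (hω0 x)).ne']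

end Volterra

/-! ### Carathéodory functions -/

section Caratheodory

variable {E : Type*} [NormedAddCommGroup E]

/-- A Carathéodory argument: if the first variable is rounded to the grid of step `1 / (n + 1)`, the
diagonal is measurable on each of countably many strips, and continuity in that variable allows `n →
∞`. -/
theorem aestronglyMeasurable_diag {F : ℝ → ℝ → E}
    (hm : ∀ c, AEStronglyMeasurable (F c) volume) (hc : ∀ τ, Continuous fun c => F c τ) :
    AEStronglyMeasurable (fun τ => F τ τ) volume := by
  refine aestronglyMeasurable_of_tendsto_ae (u := atTop)
    (f := fun (n : ℕ) τ => F (⌊(n + 1 : ℝ) * τ⌋ / (n + 1 : ℝ)) τ) (fun n => ?_)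
    (Eventually.of_forall fun τ => ?_)
  · have hcover : (⋃ k : ℤ, {τ : ℝ | ⌊(n + 1 : ℝ) * τ⌋ = k}) = univ := by
      ext τ
      simp
    rw [← Measure.restrict_univ (μ := (volume : Measure ℝ)), ← hcover,
      aestronglyMeasurable_iUnion_iff]
    intro k
    refine (hm ((k : ℝ) / (n + 1 : ℝ))).restrict.congr ?_
    have hmeas : MeasurableSet {τ : ℝ | ⌊(n + 1 : ℝ) * τ⌋ = k} :=
      (Int.measurable_floor.comp (measurable_const_mul (n + 1 : ℝ))) (measurableSet_singleton k)
    refine ae_restrict_of_forall_mem hmeas fun τ hτ => ?_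
    have : ⌊(n + 1 : ℝ) * τ⌋ = k := hτ
    simp only [this]
  · have h1 : Tendsto (fun n : ℕ => (⌊(n + 1 : ℝ) * τ⌋ : ℝ) / (n + 1 : ℝ)) atTop (𝓝 τ) := by
      rw [tendsto_iff_dist_tendsto_zero]
      refine squeeze_zero (fun _ => dist_nonneg) (fun n => ?_)
        tendsto_one_div_add_atTop_nhds_zero_nat
      have hn : (0 : ℝ) < n + 1 := by positivity
      have h2 : (⌊(n + 1 : ℝ) * τ⌋ : ℝ) / (n + 1) - τ =
          (⌊(n + 1 : ℝ) * τ⌋ - (n + 1 : ℝ) * τ) / (n + 1) := by field_simp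
      rw [Real.dist_eq, h2, abs_div, abs_of_pos hn]
      gcongr
      rw [abs_le]
      constructor <;> linarith [Int.floor_le ((n + 1 : ℝ) * τ), Int.lt_floor_add_one ((n + 1 : ℝ) * τ)]
    exact ((hc τ).tendsto τ).comp h1

theorem aestronglyMeasurable_clm_apply {d : ℕ} [NormedSpace ℝ E] {A : ℝ → Rd d →L[ℝ] E}
    {u : ℝ → Rd d} (hA : ∀ w, AEStronglyMeasurable (fun τ => A τ w) volume)
    (hu : AEStronglyMeasurable u volume) :
    AEStronglyMeasurable (fun τ => A τ (u τ)) volume := by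
  have h : ∀ τ, A τ (u τ) = ∑ i, u τ i • A τ (EuclideanSpace.basisFun (Fin d) ℝ i) := by
    intro τ
    conv_lhs => rw [← (EuclideanSpace.basisFun (Fin d) ℝ).sum_repr (u τ)]
    simp
  simp only [h]
  refine Finset.aestronglyMeasurable_fun_sum _ fun i _ => ?_
  exact ((EuclideanSpace.proj (𝕜 := ℝ) i).continuous.comp_aestronglyMeasurable hu).smul (hA _)

end Caratheodory

end

noncomputable section

/-! ### Non-local velocity fields and their flows -/

/-- The hypotheses (H') with explicit constants. -/
structure HypothesesWith {d : ℕ} (v : Measure (Rd d) → ℝ → Rd d → Rd d) (M L₁ L₂ : ℝ) :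
    Prop where
  M_pos : 0 < M
  L₁_pos : 0 < L₁
  L₂_pos : 0 < L₂
  measurable_time : ∀ μ, ProbCompact μ → ∀ x,
    AEStronglyMeasurable (fun t => v μ t x) (volume : Measure ℝ)
  contDiff_space : ∀ μ, ProbCompact μ → ∀ t, ContDiff ℝ 1 (v μ t)
  sublinear : ∀ μ, ProbCompact μ → ∀ t x, ‖v μ t x‖ ≤ M * (1 + ‖x‖)
  lipschitz_space : ∀ μ, ProbCompact μ → ∀ t x y, ‖v μ t x - v μ t y‖ ≤ L₁ * ‖x - y‖
  lipschitz_measure : ∀ μ ν, ProbCompact μ → ProbCompact ν → ∀ t x,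
    ‖v μ t x - v ν t x‖ ≤ L₂ * wassersteinDist 1 μ ν

theorem HypothesesH.exists_with {d : ℕ} {v : Measure (Rd d) → ℝ → Rd d → Rd d}
    (hv : HypothesesH v) : ∃ M L₁ L₂, HypothesesWith v M L₁ L₂ := by
  obtain ⟨M, hM, h1⟩ := hv.sublinear
  obtain ⟨L₁, hL₁, h2⟩ := hv.lipschitz_space
  obtain ⟨L₂, hL₂, h3⟩ := hv.lipschitz_measure
  exact ⟨M, L₁, L₂, hM, hL₁, hL₂, hv.measurable_time, hv.contDiff_space, h1, h2, h3⟩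

section Flow

variable {d : ℕ} {v : Measure (Rd d) → ℝ → Rd d → Rd d} {M L₁ L₂ : ℝ} {K : Set (Rd d)}
  {μ : Measure (Rd d)}

theorem ProbOn.probCompact_map (hK : IsCompact K) (hμ : ProbOn K μ) {f : Rd d → Rd d}
    (hf : ContinuousOn f K) : ProbCompact (μ.map f) := by
  have hc := hK.image_of_continuousOn hf
  exact ⟨_, hc, hμ.map (aemeasurable_of_ae_mem_isCompact hK hμ.2 hf) hc.measurableSet
    (mapsTo_image _ _)⟩

theorem integral_norm_le_of_forall_mem {E : Type*} [NormedAddCommGroup E] (hμ : ProbOn K μ)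
    {f : Rd d → E} {C : ℝ} (h : ∀ y ∈ K, ‖f y‖ ≤ C) : ∫ y, ‖f y‖ ∂μ ≤ C := by
  have := hμ.1
  have hae : ∀ᵐ y ∂μ, ‖‖f y‖‖ ≤ C := by
    filter_upwards [hμ.ae_mem] with y hy
    rw [norm_norm]
    exact h y hy
  have := norm_integral_le_of_norm_le_const hae
  simp only [probReal_univ, mul_one] at this
  exact (le_abs_self _).trans this

namespace HypothesesWith

/-- Coupling `f_# μ` and `g_# μ` through `μ` turns the `W_1`-Lipschitz dependence on measures into
an `L¹(μ)`-Lipschitz dependence on maps, the form used in the integral inequalities. -/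
theorem norm_sub_map_le (hv : HypothesesWith v M L₁ L₂) (hK : IsCompact K) (hμ : ProbOn K μ)
    {f g : Rd d → Rd d} (hf : ContinuousOn f K) (hg : ContinuousOn g K) (t : ℝ) (x y : Rd d) :
    ‖v (μ.map f) t x - v (μ.map g) t y‖ ≤ L₁ * ‖x - y‖ + L₂ * ∫ y, ‖f y - g y‖ ∂μ := by
  have := hμ.1
  have h1 := hv.lipschitz_space _ (hμ.probCompact_map hK hf) t x y
  have h2 := hv.lipschitz_measure _ _ (hμ.probCompact_map hK hf) (hμ.probCompact_map hK hg) t y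
  have h3 := wassersteinDist_one_map_le (aemeasurable_of_ae_mem_isCompact hK hμ.2 hf)
    (aemeasurable_of_ae_mem_isCompact hK hμ.2 hg)
    (integrable_of_ae_mem_isCompact hK hμ.2 (hf.sub hg))
  have h4 := mul_le_mul_of_nonneg_left h3 hv.L₂_pos.le
  calc _ ≤ ‖v (μ.map f) t x - v (μ.map f) t y‖ + ‖v (μ.map f) t y - v (μ.map g) t y‖ :=
        norm_sub_le_norm_sub_add_norm_sub _ _ _
    _ ≤ _ := by linarith

theorem continuous_integral_norm_sub (hK : IsCompact K) (hμ : ProbOn K μ) {f : ℝ → Rd d → Rd d}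
    (hf : ContinuousOn (Function.uncurry f) (univ ×ˢ K)) (c₀ : ℝ) :
    Tendsto (fun c => ∫ y, ‖f c y - f c₀ y‖ ∂μ) (𝓝 c₀) (𝓝 0) := by
  have := hμ.1
  have hfc : ∀ c, ContinuousOn (f c) K := fun c =>
    hf.comp (f := fun y => (c, y)) (by fun_prop) fun y hy => ⟨mem_univ _, hy⟩
  have hcpt : IsCompact (Icc (c₀ - 1) (c₀ + 1) ×ˢ K) := isCompact_Icc.prod hK
  obtain ⟨C, hC⟩ := hcpt.exists_bound_of_continuousOn
    (hf.mono (prod_mono (subset_univ _) subset_rfl))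
  have hnear : ∀ᶠ c in 𝓝 c₀, c ∈ Icc (c₀ - 1) (c₀ + 1) :=
    Icc_mem_nhds (by linarith) (by linarith)
  have h0 : ∫ y, ‖f c₀ y - f c₀ y‖ ∂μ = 0 := by simp
  rw [← h0]
  refine tendsto_integral_filter_of_dominated_convergence (fun _ => C + C) ?_ ?_
    (integrable_const _) ?_
  · exact Eventually.of_forall fun c =>
      (integrable_of_ae_mem_isCompact hK hμ.2 ((hfc c).sub (hfc c₀)).norm).1
  · filter_upwards [hnear] with c hc
    filter_upwards [hμ.ae_mem] with y hy
    rw [norm_norm]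
    exact (norm_sub_le _ _).trans (add_le_add (hC (c, y) ⟨hc, hy⟩)
      (hC (c₀, y) ⟨⟨by linarith, by linarith⟩, hy⟩))
  · filter_upwards [hμ.ae_mem] with y hy
    have h1 : Continuous fun c => f c y := by
      rw [← continuousOn_univ]
      exact hf.comp (f := fun c => (c, y)) (by fun_prop) fun c hc => ⟨hc, hy⟩
    exact ((h1.sub continuous_const).norm).tendsto c₀

/-- Measurability in time is assumed only for a frozen measure and a frozen point; the diagonal
argument allows both to move continuously. -/
theorem aestronglyMeasurable_along (hv : HypothesesWith v M L₁ L₂) (hK : IsCompact K)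
    (hμ : ProbOn K μ) {f : ℝ → Rd d → Rd d}
    (hf : ContinuousOn (Function.uncurry f) (univ ×ˢ K)) {z : ℝ → Rd d} (hz : Continuous z) :
    AEStronglyMeasurable (fun τ => v (μ.map (f τ)) τ (z τ)) volume := by
  have hfc : ∀ c, ContinuousOn (f c) K := fun c =>
    hf.comp (f := fun y => (c, y)) (by fun_prop) fun y hy => ⟨mem_univ _, hy⟩
  refine aestronglyMeasurable_diag (F := fun c τ => v (μ.map (f c)) τ (z c))
    (fun c => hv.measurable_time _ (hμ.probCompact_map hK (hfc c)) (z c)) fun τ => ?_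
  rw [continuous_iff_continuousAt]
  intro c₀
  rw [ContinuousAt, tendsto_iff_norm_sub_tendsto_zero]
  refine squeeze_zero (fun _ => norm_nonneg _)
    (fun c => hv.norm_sub_map_le hK hμ (hfc c) (hfc c₀) τ (z c) (z c₀)) ?_
  have h1 : Tendsto (fun c => L₁ * ‖z c - z c₀‖) (𝓝 c₀) (𝓝 0) := by
    have : Continuous fun c => L₁ * ‖z c - z c₀‖ := by fun_prop
    simpa using this.tendsto c₀
  have h2 := (continuous_integral_norm_sub hK hμ hf c₀).const_mul L₂
  rw [mul_zero] at h2
  simpa using h1.add h2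

theorem exists_isNonlocalFlow (hv : HypothesesWith v M L₁ L₂) (hK : IsCompact K)
    (hμ : ProbOn K μ) (s : ℝ) : ∃ Φ, IsNonlocalFlow v s μ Φ := by
  obtain ⟨R, hR⟩ := hK.isBounded.subset_closedBall 0
  have hR' : ∀ y ∈ K, ‖y‖ ≤ |R| := fun y hy =>
    (mem_closedBall_zero_iff.1 (hR hy)).trans (le_abs_self R)
  have hM := hv.M_pos
  have hL₁ := hv.L₁_pos
  have hL₂ := hv.L₂_pos
  obtain ⟨f, hf, -, hfe⟩ := exists_volterra_solution (X := Rd d) (E := Rd d) s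
    (ω := fun x => 1 + ‖x‖) (by fun_prop) (fun x => by positivity)
    -- The unknown is the displacement `Φ - id`, with the weight `1 + |x|` matching the sublinear
    -- growth. In the constant, `M` bounds the field at zero displacement, `L₁` the local variation,
    -- and `L₂ (1 + |R|)` the nonlocal one, since the weight is at most `1 + |R|` on `K`.
    (fun τ g x => v (μ.map fun y => y + g y) τ (x + g x)) (C := M + L₁ + L₂ * (1 + |R|))
    (by positivity) (by
      intro f hf _ x
      have hf' : Continuous fun p : ℝ × Rd d => p.2 + f p.1 p.2 := continuous_snd.add hf
      exact hv.aestronglyMeasurable_along hK hμ (f := fun τ y => y + f τ y) hf'.continuousOn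
        (z := fun τ => x + f τ x) (continuous_const.add (hf.comp (by fun_prop :
          Continuous fun τ : ℝ => (τ, x))))) (by
      intro τ g hg _
      have hc : Continuous fun y => y + g y := continuous_id.add hg
      exact (hv.contDiff_space _ (hμ.probCompact_map hK hc.continuousOn) τ).continuous.comp hc) (by
      intro τ x
      have hc : Continuous fun y : Rd d => y + (0 : Rd d) := by fun_prop
      have h1 := hv.sublinear _ (hμ.probCompact_map hK hc.continuousOn) τ (x + 0)
      refine h1.trans ?_
      rw [add_zero]
      refine mul_le_mul_of_nonneg_right ?_ (by positivity)
      nlinarith [abs_nonneg R]) (by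
      intro τ g g' b hg hg' _ _ hb hgg' x
      have hc : Continuous fun y => y + g y := continuous_id.add hg
      have hc' : Continuous fun y => y + g' y := continuous_id.add hg'
      refine (hv.norm_sub_map_le hK hμ hc.continuousOn hc'.continuousOn τ _ _).trans ?_
      have h1 : ∫ y, ‖(y + g y) - (y + g' y)‖ ∂μ ≤ b * (1 + |R|) := by
        refine integral_norm_le_of_forall_mem hμ fun y hy => ?_
        rw [add_sub_add_left_eq_sub]
        exact (hgg' y).trans (mul_le_mul_of_nonneg_left (by linarith [hR' y hy]) hb)
      rw [add_sub_add_left_eq_sub (g x) (g' x) x]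
      have h2 := mul_le_mul_of_nonneg_left (hgg' x) hL₁.le
      have h3 := mul_le_mul_of_nonneg_left h1 hL₂.le
      have h4 : L₂ * (b * (1 + |R|)) ≤ L₂ * (b * (1 + |R|)) * (1 + ‖x‖) :=
        le_mul_of_one_le_right (by positivity) (by linarith [norm_nonneg x])
      have h5 : 0 ≤ M * b * (1 + ‖x‖) := by positivity
      calc L₁ * ‖g x - g' x‖ + L₂ * ∫ y, ‖(y + g y) - (y + g' y)‖ ∂μ
          ≤ L₁ * (b * (1 + ‖x‖)) + L₂ * (b * (1 + |R|)) * (1 + ‖x‖) + M * b * (1 + ‖x‖) := by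
            linarith
        _ = _ := by ring)
  refine ⟨fun t x => x + f t x, fun t => continuous_id.add
    (hf.comp (by fun_prop : Continuous fun x : Rd d => (t, x))), fun t x => ⟨(hfe t x).1, ?_⟩⟩
  simp only
  rw [add_right_inj]
  exact (hfe t x).2

theorem isNonlocalFlow_nonlocalFlow (hv : HypothesesWith v M L₁ L₂) (hK : IsCompact K)
    (hμ : ProbOn K μ) (s : ℝ) : IsNonlocalFlow v s μ (nonlocalFlow v s μ) := by
  have h := hv.exists_isNonlocalFlow hK hμ s
  rw [nonlocalFlow, dif_pos h]
  exact h.choose_spec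

end HypothesesWith

namespace IsNonlocalFlow

variable {Φ : ℝ → Rd d → Rd d} {s : ℝ}

theorem intervalIntegrable (h : IsNonlocalFlow v s μ Φ) (x : Rd d) (a b : ℝ) :
    IntervalIntegrable (fun τ => v (μ.map (Φ τ)) τ (Φ τ x)) volume a b :=
  (h.2 a x).1.symm.trans (h.2 b x).1

theorem eq_add_integral (h : IsNonlocalFlow v s μ Φ) (x : Rd d) (a b : ℝ) :
    Φ b x = Φ a x + ∫ τ in a..b, v (μ.map (Φ τ)) τ (Φ τ x) := by
  rw [(h.2 a x).2, (h.2 b x).2, add_assoc,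
    intervalIntegral.integral_add_adjacent_intervals (h.2 a x).1 (h.intervalIntegrable x a b)]

theorem initial (h : IsNonlocalFlow v s μ Φ) (x : Rd d) : Φ s x = x := by
  rw [(h.2 s x).2]
  simp

theorem continuous_time (h : IsNonlocalFlow v s μ Φ) (x : Rd d) : Continuous fun t => Φ t x := by
  have h1 := intervalIntegral.continuous_primitive (fun a b => h.intervalIntegrable x a b) s
  have h2 : (fun t => Φ t x) = fun t => x + ∫ τ in s..t, v (μ.map (Φ τ)) τ (Φ τ x) :=
    funext fun t => (h.2 t x).2
  rw [h2]
  exact continuous_const.add h1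

theorem probCompact (h : IsNonlocalFlow v s μ Φ) (hK : IsCompact K) (hμ : ProbOn K μ) (t : ℝ) :
    ProbCompact (μ.map (Φ t)) := hμ.probCompact_map hK (h.1 t).continuousOn

/-- Grönwall's inequality started at an arbitrary time `t'`: the choice `t' = s` gives Lipschitz
dependence on the initial point, and `t = s` gives injectivity. -/
theorem norm_sub_le (h : IsNonlocalFlow v s μ Φ) (hv : HypothesesWith v M L₁ L₂)
    (hK : IsCompact K) (hμ : ProbOn K μ) {a b t t' : ℝ} (ht : t ∈ Icc a b) (ht' : t' ∈ Icc a b)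
    (x y : Rd d) :
    ‖Φ t x - Φ t y‖ ≤ Real.exp (2 * L₁ * (b - a)) * (2 * ‖Φ t' x - Φ t' y‖) := by
  have hL := hv.L₁_pos
  obtain ⟨b₀, hb₀⟩ := (isCompact_Icc (a := a) (b := b)).exists_bound_of_continuousOn
    ((h.continuous_time x).sub (h.continuous_time y)).continuousOn
  have key := norm_le_of_integral_inequality (I := Icc a b) ordConnected_Icc ht'
    (r := fun t => Φ t x - Φ t y)
    (q := fun τ => v (μ.map (Φ τ)) τ (Φ τ x) - v (μ.map (Φ τ)) τ (Φ τ y)) (g := fun _ => 0)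
    (r₀ := Φ t' x - Φ t' y)
    (L := L₁) (c := 0) (l := 2 * L₁) (G := 0) (b₀ := b₀) hL.le le_rfl (by positivity)
    le_rfl (fun t _ => by
      rw [intervalIntegral.integral_sub (h.intervalIntegrable x _ _) (h.intervalIntegrable y _ _),
        h.eq_add_integral x t' t, h.eq_add_integral y t' t]
      abel) (fun τ _ => by
      have := hv.lipschitz_space _ (h.probCompact hK hμ τ) τ (Φ τ x) (Φ τ y)
      simpa using this) (fun _ _ => by simp) (fun t ht => by simp) hb₀ t ht
  refine key.trans ?_
  have h1 : |t - t'| ≤ b - a := by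
    rw [abs_le]
    constructor <;> linarith [ht.1, ht.2, ht'.1, ht'.2]
  refine mul_le_mul (Real.exp_le_exp.2 (mul_le_mul_of_nonneg_left h1 (by positivity))) ?_
    (by positivity) (by positivity)
  simp

theorem injective (h : IsNonlocalFlow v s μ Φ) (hv : HypothesesWith v M L₁ L₂)
    (hK : IsCompact K) (hμ : ProbOn K μ) (t : ℝ) : Function.Injective (Φ t) := by
  intro x y hxy
  have := h.norm_sub_le hv hK hμ (a := min s t) (b := max s t) (t := s) (t' := t)
    ⟨min_le_left _ _, le_max_left _ _⟩ ⟨min_le_right _ _, le_max_right _ _⟩ x y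
  rw [hxy, sub_self, norm_zero, mul_zero, mul_zero, h.initial, h.initial] at this
  exact sub_eq_zero.1 (norm_le_zero_iff.1 this)

theorem continuous_uncurry (h : IsNonlocalFlow v s μ Φ) (hv : HypothesesWith v M L₁ L₂)
    (hK : IsCompact K) (hμ : ProbOn K μ) : Continuous (Function.uncurry Φ) := by
  rw [continuous_iff_continuousAt]
  rintro ⟨t₀, x₀⟩
  set a := min s t₀ - 1
  set b := max s t₀ + 1
  have hs : s ∈ Icc a b :=
    ⟨by linarith [min_le_left s t₀], by linarith [le_max_left s t₀]⟩
  have hnear : ∀ᶠ p : ℝ × Rd d in 𝓝 (t₀, x₀), p.1 ∈ Icc a b :=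
    continuous_fst.continuousAt.eventually (Icc_mem_nhds
      (by linarith [min_le_right s t₀] : a < t₀) (by linarith [le_max_right s t₀] : t₀ < b))
  rw [ContinuousAt, tendsto_iff_norm_sub_tendsto_zero]
  refine squeeze_zero' (g := fun p : ℝ × Rd d =>
      Real.exp (2 * L₁ * (b - a)) * (2 * ‖p.2 - x₀‖) + ‖Φ p.1 x₀ - Φ t₀ x₀‖)
    (Eventually.of_forall fun _ => norm_nonneg _) ?_ ?_
  · filter_upwards [hnear] with p hp
    have h1 := h.norm_sub_le hv hK hμ hp hs p.2 x₀
    rw [h.initial, h.initial] at h1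
    exact (norm_sub_le_norm_sub_add_norm_sub _ (Φ p.1 x₀) _).trans (add_le_add_left h1 _)
  · have h1 := h.continuous_time x₀
    have : Continuous fun p : ℝ × Rd d =>
        Real.exp (2 * L₁ * (b - a)) * (2 * ‖p.2 - x₀‖) + ‖Φ p.1 x₀ - Φ t₀ x₀‖ := by fun_prop
    simpa using this.tendsto (t₀, x₀)

end IsNonlocalFlow

end Flow

end

noncomputable section

/-! ### Dominated convergence and Grönwall for small parameters -/

section LittleO

variable {V E : Type*} [NormedAddCommGroup V] [NormedAddCommGroup E]

/-- Dominated convergence for the quotients `‖g h a‖ / ‖h‖`: a uniform `O(h)` bound and a pointwise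
`o(h)` are enough. -/
theorem isLittleO_integral_norm {α : Type*} [MeasurableSpace α] {ρ : Measure α}
    [IsFiniteMeasure ρ] {l : Filter V} [l.IsCountablyGenerated] {g : V → α → E} {C : ℝ}
    (hC : 0 ≤ C) (hmeas : ∀ᶠ h in l, AEStronglyMeasurable (g h) ρ)
    (hb : ∀ᶠ h in l, ∀ᵐ a ∂ρ, ‖g h a‖ ≤ C * ‖h‖)
    (hlim : ∀ᵐ a ∂ρ, (fun h => g h a) =o[l] fun h => h) :
    (fun h => ∫ a, ‖g h a‖ ∂ρ) =o[l] fun h => h := by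
  rw [← Asymptotics.isLittleO_norm_right]
  have hz : ∀ᶠ h in l, ‖h‖ = 0 → ∫ a, ‖g h a‖ ∂ρ = 0 := by
    filter_upwards [hb] with h hh h0
    rw [← integral_zero α ℝ (μ := ρ)]
    refine integral_congr_ae ?_
    filter_upwards [hh] with a ha
    rw [h0, mul_zero] at ha
    exact le_antisymm ha (norm_nonneg _)
  rw [Asymptotics.isLittleO_iff_tendsto' hz]
  have h0 : (0 : ℝ) = ∫ _, (0 : ℝ) ∂ρ := by simp
  rw [h0]
  simp only [← integral_div]
  refine tendsto_integral_filter_of_dominated_convergence (fun _ => C) ?_ ?_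
    (integrable_const _) ?_
  · filter_upwards [hmeas] with h hh
    simp only [div_eq_mul_inv]
    exact hh.norm.mul_const _
  · filter_upwards [hb] with h hh
    filter_upwards [hh] with a ha
    rw [norm_div, norm_norm, norm_norm]
    exact div_le_of_le_mul₀ (norm_nonneg _) hC ha
  · filter_upwards [hlim] with a ha
    exact ((Asymptotics.isLittleO_norm_right.2 ha).norm_left).tendsto_div_nhds_zero

/-- Grönwall's inequality bounds `r` by the initial error, the constant forcing and the time
integral of `err`. The last is `o(h)` by dominated convergence, so no uniformity in time of the
`o(h)` is needed. -/
theorem isLittleO_of_integral_inequality [NormedSpace ℝ E] {l : Filter V}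
    [l.IsCountablyGenerated] {a b s : ℝ} (hs : s ∈ Icc a b) {r err : V → ℝ → E} {r₀ : V → E}
    {c : V → ℝ} {L C : ℝ} (hL : 0 < L) (hC : 0 ≤ C)
    (hr : ∀ᶠ h in l, ∃ q : ℝ → E, (∀ t ∈ Icc a b, r h t = r₀ h + ∫ τ in s..t, q τ) ∧
      ∀ τ ∈ Icc a b, ‖q τ‖ ≤ L * ‖r h τ‖ + c h + ‖err h τ‖)
    (hb : ∀ᶠ h in l, ∃ b₀, ∀ t ∈ Icc a b, ‖r h t‖ ≤ b₀)
    (hmeas : ∀ᶠ h in l, AEStronglyMeasurable (err h) (volume.restrict (Icc a b)))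
    (herrb : ∀ᶠ h in l, ∀ τ ∈ Icc a b, ‖err h τ‖ ≤ C * ‖h‖)
    (herr : ∀ τ ∈ Icc a b, (fun h => err h τ) =o[l] fun h => h)
    (hr₀ : r₀ =o[l] fun h => h) (hc0 : ∀ h, 0 ≤ c h) (hc : c =o[l] fun h => h) :
    ∀ t ∈ Icc a b, (fun h => r h t) =o[l] fun h => h := by
  intro t ht
  have hA := isLittleO_integral_norm hC hmeas
    (herrb.mono fun h hh => ae_restrict_of_forall_mem measurableSet_Icc hh)
    (ae_restrict_of_forall_mem measurableSet_Icc herr)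
  set A : V → ℝ := fun h => ∫ τ in Icc a b, ‖err h τ‖ with hAdef
  have hsum : (fun h => Real.exp (2 * L * |t - s|) *
      (2 * (c h / (2 * L)) + 2 * (‖r₀ h‖ + A h))) =o[l] fun h => h := by
    refine Asymptotics.IsLittleO.const_mul_left ?_ _
    refine Asymptotics.IsLittleO.add ?_ ?_
    · simp only [div_eq_inv_mul]
      exact (hc.const_mul_left _).const_mul_left _
    · exact (hr₀.norm_left.add hA).const_mul_left _
  refine Asymptotics.IsBigO.trans_isLittleO (Asymptotics.IsBigO.of_bound 1 ?_) hsum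
  filter_upwards [hr, hb, hmeas, herrb] with h ⟨q, h1, h2⟩ ⟨b₀, h3⟩ h4 h5
  have hint : IntegrableOn (fun τ => ‖err h τ‖) (Icc a b) := by
    refine Integrable.of_bound h4.norm (C * ‖h‖) ?_
    exact ae_restrict_of_forall_mem measurableSet_Icc fun τ hτ => by
      rw [norm_norm]
      exact h5 τ hτ
  have hsub : ∀ t' ∈ Icc a b, uIoc s t' ⊆ Icc a b := fun t' ht' =>
    uIoc_subset_of_ordConnected ordConnected_Icc hs ht'
  have key := norm_le_of_integral_inequality (I := Icc a b) ordConnected_Icc hs (r := r h)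
    (q := q) (g := fun τ => ‖err h τ‖) (r₀ := r₀ h) (L := L) (c := c h) (l := 2 * L)
    (G := A h) (b₀ := b₀) hL.le (hc0 h) (by positivity) le_rfl h1 (fun τ hτ => by
      have h6 : c h ≤ c h * Real.exp (2 * L * |τ - s|) :=
        le_mul_of_one_le_right (hc0 h) (Real.one_le_exp (by positivity))
      linarith [h2 τ hτ]) (fun t' ht' => by
      rw [intervalIntegrable_iff]
      exact hint.mono_set (hsub t' ht')) (fun t' ht' => by
      rw [intervalIntegral.abs_integral_eq_abs_integral_uIoc, abs_of_nonneg
        (integral_nonneg fun _ => norm_nonneg _)]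
      exact setIntegral_mono_set hint (Eventually.of_forall fun _ => norm_nonneg _)
        (hsub t' ht').eventuallyLE) h3 t ht
  rw [one_mul]
  exact key.trans (le_abs_self _)

end LittleO

/-- In finite dimension an operator is a finite sum of rank-one operators built from its values on a
basis, so pointwise measurability gives measurability in operator norm. -/
theorem aestronglyMeasurable_clm {E : Type*} [NormedAddCommGroup E] [NormedSpace ℝ E] {d : ℕ}
    {A : ℝ → Rd d →L[ℝ] E} (hA : ∀ w, AEStronglyMeasurable (fun τ => A τ w) volume) :
    AEStronglyMeasurable A volume := by
  have h : A = fun τ => ∑ i, ContinuousLinearMap.smulRightL ℝ (Rd d) E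
      (EuclideanSpace.proj (𝕜 := ℝ) i) (A τ (EuclideanSpace.basisFun (Fin d) ℝ i)) := by
    funext τ
    ext x
    conv_lhs => rw [← (EuclideanSpace.basisFun (Fin d) ℝ).sum_repr x]
    simp
  rw [h]
  exact Finset.aestronglyMeasurable_fun_sum _ fun i _ =>
    (ContinuousLinearMap.continuous _).comp_aestronglyMeasurable (hA _)

/-! ### Differentiability of the flow in space -/

section FlowDerivative

variable {d : ℕ} {v : Measure (Rd d) → ℝ → Rd d → Rd d} {M L₁ L₂ : ℝ} {K : Set (Rd d)}
  {μ : Measure (Rd d)}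

namespace HypothesesWith

theorem norm_fderiv_le (hv : HypothesesWith v M L₁ L₂) (hμ : ProbCompact μ) (t : ℝ) (x : Rd d) :
    ‖fderiv ℝ (v μ t) x‖ ≤ L₁ :=
  HasFDerivAt.le_of_lip' (((hv.contDiff_space μ hμ t).differentiable (by simp)) x).hasFDerivAt
    hv.L₁_pos.le (Eventually.of_forall fun y => hv.lipschitz_space μ hμ t y x)

theorem continuous_fderiv (hv : HypothesesWith v M L₁ L₂) (hμ : ProbCompact μ) (t : ℝ) :
    Continuous (fderiv ℝ (v μ t)) := (hv.contDiff_space μ hμ t).continuous_fderiv (by simp)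

theorem aestronglyMeasurable_fderiv_along (hv : HypothesesWith v M L₁ L₂) (hK : IsCompact K)
    (hμ : ProbOn K μ) {f : ℝ → Rd d → Rd d}
    (hf : ContinuousOn (Function.uncurry f) (univ ×ˢ K)) {z : ℝ → Rd d} (hz : Continuous z) :
    AEStronglyMeasurable (fun τ => fderiv ℝ (v (μ.map (f τ)) τ) (z τ)) volume := by
  have hfc : ∀ c, ContinuousOn (f c) K := fun c =>
    hf.comp (f := fun y => (c, y)) (by fun_prop) fun y hy => ⟨mem_univ _, hy⟩
  refine aestronglyMeasurable_clm fun w => ?_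
  -- The derivative in a fixed direction is a limit of difference quotients of `v`, which are
  -- measurable along the curve.
  refine aestronglyMeasurable_of_tendsto_ae (u := atTop) (f := fun (n : ℕ) τ =>
    (n : ℝ) • (v (μ.map (f τ)) τ (z τ + (n : ℝ)⁻¹ • w) - v (μ.map (f τ)) τ (z τ)))
    (fun n => ?_) (Eventually.of_forall fun τ => ?_)
  · exact ((hv.aestronglyMeasurable_along hK hμ hf (hz.add continuous_const)).sub
      (hv.aestronglyMeasurable_along hK hμ hf hz)).const_smul (n : ℝ)
  · refine HasFDerivAt.lim (((hv.contDiff_space _ (hμ.probCompact_map hK (hfc τ)) τ).differentiable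
      (by simp)) (z τ)).hasFDerivAt w ?_
    simpa using tendsto_natCast_atTop_atTop (R := ℝ)

end HypothesesWith

namespace IsNonlocalFlow

variable {Φ : ℝ → Rd d → Rd d} {s : ℝ}

/-- The flow is differentiable in space and its differential solves the linearized equation. -/
theorem exists_hasFDerivAt (h : IsNonlocalFlow v s μ Φ) (hv : HypothesesWith v M L₁ L₂)
    (hK : IsCompact K) (hμ : ProbOn K μ) :
    ∃ J : ℝ → Rd d → Rd d →L[ℝ] Rd d, Continuous (Function.uncurry J) ∧
      (∀ t x, HasFDerivAt (Φ t) (J t x) x) ∧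
      ∀ t x, IntervalIntegrable (fun τ => (fderiv ℝ (v (μ.map (Φ τ)) τ) (Φ τ x)).comp (J τ x))
        volume s t ∧
        J t x = ContinuousLinearMap.id ℝ (Rd d) +
          ∫ τ in s..t, (fderiv ℝ (v (μ.map (Φ τ)) τ) (Φ τ x)).comp (J τ x) := by
  have hΦc := h.continuous_uncurry hv hK hμ
  have hΦx : ∀ x, Continuous fun τ => Φ τ x := h.continuous_time
  have hpc := h.probCompact hK hμ
  have hL₁ := hv.L₁_pos
  set Db : ℝ → Rd d → Rd d →L[ℝ] Rd d := fun τ x => fderiv ℝ (v (μ.map (Φ τ)) τ) (Φ τ x) with hDb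
  have hDbc : ∀ τ, Continuous (Db τ) := fun τ => (hv.continuous_fderiv (hpc τ) τ).comp (h.1 τ)
  have hDbm : ∀ x, AEStronglyMeasurable (fun τ => Db τ x) volume := fun x =>
    hv.aestronglyMeasurable_fderiv_along hK hμ hΦc.continuousOn (hΦx x)
  have hDbn : ∀ τ x, ‖Db τ x‖ ≤ L₁ := fun τ x => hv.norm_fderiv_le (hpc τ) τ _
  -- The candidate differential is built first, as the identity plus the solution of a linear
  -- Volterra equation; it is then compared with the increments of the flow.
  obtain ⟨f, hf, -, hfe⟩ := exists_volterra_solution (X := Rd d) (E := Rd d →L[ℝ] Rd d) s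
    (ω := fun _ => 1) continuous_const (fun _ => one_pos)
    (fun τ g x => (Db τ x).comp (ContinuousLinearMap.id ℝ (Rd d) + g x)) (C := L₁) hL₁ (by
      intro f hf _ x
      have hc : Continuous fun τ => ContinuousLinearMap.id ℝ (Rd d) + f τ x :=
        continuous_const.add (hf.comp (by fun_prop : Continuous fun τ : ℝ => (τ, x)))
      exact (isBoundedBilinearMap_comp (𝕜 := ℝ)).continuous.comp_aestronglyMeasurable
        ((hDbm x).prodMk hc.aestronglyMeasurable)) (by
      intro τ g hg _
      exact (hDbc τ).clm_comp (continuous_const.add hg)) (by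
      intro τ x
      rw [add_zero, ContinuousLinearMap.comp_id, mul_one]
      exact hDbn τ x) (by
      intro τ g g' b _ _ _ _ hb hgg' x
      rw [← ContinuousLinearMap.comp_sub, add_sub_add_left_eq_sub]
      refine (ContinuousLinearMap.opNorm_comp_le _ _).trans ?_
      rw [mul_one]
      exact mul_le_mul (hDbn τ x) (by simpa using hgg' x) (norm_nonneg _) hL₁.le)
  set J : ℝ → Rd d → Rd d →L[ℝ] Rd d := fun t x => ContinuousLinearMap.id ℝ (Rd d) + f t x with hJ
  have hJc : Continuous (Function.uncurry J) := continuous_const.add hf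
  refine ⟨J, hJc, fun t x => ?_, fun t x => ⟨(hfe t x).1, ?_⟩⟩
  swap
  · simp only [hJ]
    rw [add_right_inj]
    exact (hfe t x).2
  have hJx : Continuous fun τ => J τ x := hJc.comp (by fun_prop : Continuous fun τ : ℝ => (τ, x))
  obtain ⟨CJ, hCJ⟩ := (isCompact_uIcc (a := s) (b := t)).exists_bound_of_continuousOn
    hJx.continuousOn
  have hCJ0 : 0 ≤ CJ := (norm_nonneg _).trans (hCJ s left_mem_uIcc)
  rw [hasFDerivAt_iff_isLittleO_nhds_zero]
  have hJint : ∀ (t : ℝ) (u : Rd d), IntervalIntegrable (fun τ => Db τ x (J τ x u)) volume s t ∧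
      J t x u = u + ∫ τ in s..t, Db τ x (J τ x u) := by
    intro t u
    have h1 := (hfe t x).1
    refine ⟨⟨(ContinuousLinearMap.apply ℝ (Rd d) u).integrable_comp h1.1,
      (ContinuousLinearMap.apply ℝ (Rd d) u).integrable_comp h1.2⟩, ?_⟩
    have h2 := ContinuousLinearMap.intervalIntegral_apply h1 u
    simp only [hJ]
    rw [add_apply, (hfe t x).2, ContinuousLinearMap.id_apply]
    exact congrArg _ h2
  refine isLittleO_of_integral_inequality (l := 𝓝 0) (a := min s t) (b := max s t) (s := s)
    (r := fun u τ => Φ τ (x + u) - Φ τ x - J τ x u)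
    (err := fun u τ => v (μ.map (Φ τ)) τ (Φ τ x + J τ x u) - v (μ.map (Φ τ)) τ (Φ τ x)
      - Db τ x (J τ x u)) (r₀ := fun _ => 0) (c := fun _ => 0) (L := L₁) (C := 2 * L₁ * CJ)
    left_mem_uIcc hL₁ (by positivity) ?_ ?_ ?_ ?_ ?_ (Asymptotics.isLittleO_zero _ _)
    (fun _ => le_rfl) (Asymptotics.isLittleO_zero _ _) t right_mem_uIcc
  · refine Eventually.of_forall fun u => ⟨fun τ => v (μ.map (Φ τ)) τ (Φ τ (x + u)) -
      v (μ.map (Φ τ)) τ (Φ τ x) - Db τ x (J τ x u), fun τ _ => ?_, fun τ _ => ?_⟩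
    · rw [intervalIntegral.integral_sub ((h.intervalIntegrable _ _ _).sub (h.intervalIntegrable _ _ _))
        (hJint τ u).1, intervalIntegral.integral_sub (h.intervalIntegrable _ _ _)
        (h.intervalIntegrable _ _ _), (h.2 τ (x + u)).2, (h.2 τ x).2, (hJint τ u).2]
      abel
    · rw [add_zero]
      have h1 := hv.lipschitz_space _ (hpc τ) τ (Φ τ (x + u)) (Φ τ x + J τ x u)
      rw [← sub_sub] at h1
      refine le_trans ?_ (add_le_add_left h1 _)
      refine le_trans (le_of_eq ?_) (norm_add_le _ _)
      congr 1
      beta_reduce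
      abel
  · refine Eventually.of_forall fun u => ?_
    exact (isCompact_uIcc (a := s) (b := t)).exists_bound_of_continuousOn
      (((hΦx _).sub (hΦx _)).sub (hJx.clm_apply continuous_const)).continuousOn
  · refine Eventually.of_forall fun u => AEStronglyMeasurable.restrict ?_
    have h1 : Continuous fun τ => J τ x u := hJx.clm_apply continuous_const
    exact ((hv.aestronglyMeasurable_along hK hμ hΦc.continuousOn ((hΦx x).add h1)).sub
      (hv.aestronglyMeasurable_along hK hμ hΦc.continuousOn (hΦx x))).sub
      (aestronglyMeasurable_clm_apply (fun w => (hDbm x).apply_continuousLinearMap w)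
        h1.aestronglyMeasurable)
  · refine Eventually.of_forall fun u τ hτ => ?_
    have h1 := hv.lipschitz_space _ (hpc τ) τ (Φ τ x + J τ x u) (Φ τ x)
    rw [add_sub_cancel_left] at h1
    have h2 := (J τ x).le_of_opNorm_le (hCJ τ hτ) u
    have h3 := (Db τ x).le_of_opNorm_le (hDbn τ x) (J τ x u)
    have h4 := mul_le_mul_of_nonneg_left h2 hL₁.le
    refine (_root_.norm_sub_le _ _).trans ?_
    linarith
  · intro τ hτ
    have h1 := (((hv.contDiff_space _ (hpc τ) τ).differentiable (by simp)) (Φ τ x)).hasFDerivAt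
    rw [hasFDerivAt_iff_isLittleO_nhds_zero] at h1
    have h2 : Tendsto (fun u => J τ x u) (𝓝 0) (𝓝 0) := by
      simpa using (J τ x).continuous.tendsto 0
    exact (h1.comp_tendsto h2).trans_isBigO ((J τ x).isBigO_id _)

end IsNonlocalFlow

end FlowDerivative

end

noncomputable section

/-! ### The derivative of the velocity field along perturbations of the measure -/

/-- The components of the field `v` are Wasserstein-differentiable over every `𝒫(K')`, locally
uniformly in space and uniformly in times of `S`. -/
def IsWassersteinDifferentiableField {d : ℕ} (S : Set ℝ)
    (v : Measure (Rd d) → ℝ → Rd d → Rd d) : Prop :=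
  ∀ K' : Set (Rd d), IsCompact K' → ∀ i : Fin d, IsWassersteinDifferentiableOn K' (S ×ˢ K')
    (fun (a : ℝ × Rd d) ν => v ν a.1 a.2 i)

/-- The derivative of `v[Φ_# μ](τ, z)` when `Φ` is perturbed in the direction `Z`. -/
def nonlocalDeriv {d : ℕ} (v : Measure (Rd d) → ℝ → Rd d → Rd d) (μ : Measure (Rd d))
    (Φ : Rd d → Rd d) (τ : ℝ) (Z : Rd d → Rd d) (z : Rd d) : Rd d :=
  ∫ y, Matrix.toEuclideanLin (wassersteinMatrix v (μ.map Φ) τ z (Φ y)) (Z y) ∂μ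

section NonlocalDeriv

open Metric

variable {d : ℕ} {v : Measure (Rd d) → ℝ → Rd d → Rd d} {M L₁ L₂ : ℝ} {K : Set (Rd d)}
  {μ : Measure (Rd d)} {S : Set ℝ} {Φ : Rd d → Rd d} {τ : ℝ}

theorem toEuclideanLin_wassersteinMatrix_apply (ρ : Measure (Rd d)) (t : ℝ) (x y u : Rd d)
    (i : Fin d) : Matrix.toEuclideanLin (wassersteinMatrix v ρ t x y) u i =
      inner ℝ (wassersteinGradient (fun ν => v ν t x i) ρ y) u := by
  simp [wassersteinMatrix, Matrix.toLpLin_apply, Matrix.mulVec, dotProduct, PiLp.inner_apply,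
    mul_comm]

theorem nonlocalDeriv_congr {Z Z' : Rd d → Rd d} (h : Z =ᵐ[μ] Z') (z : Rd d) :
    nonlocalDeriv v μ Φ τ Z z = nonlocalDeriv v μ Φ τ Z' z := by
  refine integral_congr_ae ?_
  filter_upwards [h] with y hy
  rw [hy]

theorem norm_le_mul_of_forall_abs_le {x : Rd d} {c : ℝ} (h : ∀ i, |x i| ≤ c) :
    ‖x‖ ≤ d * c := by
  conv_lhs => rw [← (EuclideanSpace.basisFun (Fin d) ℝ).sum_repr x]
  refine (norm_sum_le_of_le _ (f := fun i => (EuclideanSpace.basisFun (Fin d) ℝ).repr x i •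
    EuclideanSpace.basisFun (Fin d) ℝ i) (n := fun _ => c) fun i _ => ?_).trans (by simp)
  rw [norm_smul, OrthonormalBasis.norm_eq_one, mul_one]
  exact h i

namespace HypothesesWith

theorem hasWassersteinGradientOn_map (hK : IsCompact K) (hμ : ProbOn K μ)
    (hS : IsWassersteinDifferentiableField S v) (hΦ : ContinuousOn Φ K) {K' : Set (Rd d)}
    (hK' : IsCompact K') (i : Fin d) :
    HasWassersteinGradientOn K' (S ×ˢ K') (fun (a : ℝ × Rd d) ν => v ν a.1 a.2 i) (μ.map Φ)
      (fun a => wassersteinGradient (fun ν => v ν a.1 a.2 i) (μ.map Φ)) := by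
  have hc := hK.image_of_continuousOn hΦ
  obtain ⟨R, hR⟩ := hc.isBounded.subset_closedBall 0
  exact hasWassersteinGradientOn_wassersteinGradient ((hμ.map
    (aemeasurable_of_ae_mem_isCompact hK hμ.2 hΦ) hc.measurableSet (mapsTo_image _ _)).mono hR)
    (fun K'' hK'' => hS K'' hK'' i) hK'

theorem memLp_wassersteinGradient_comp (hK : IsCompact K) (hμ : ProbOn K μ)
    (hS : IsWassersteinDifferentiableField S v) (hτ : τ ∈ S) (hΦ : ContinuousOn Φ K) (z : Rd d)
    (i : Fin d) :
    MemLp (fun y => wassersteinGradient (fun ν => v ν τ z i) (μ.map Φ) (Φ y)) 2 μ := by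
  have := hμ.1
  have h := (hasWassersteinGradientOn_map hK hμ hS hΦ (isCompact_singleton (x := z)) i).1 (τ, z)
    ⟨hτ, rfl⟩
  exact h.1.comp_of_map (aemeasurable_of_ae_mem_isCompact hK hμ.2 hΦ)

theorem integrable_wassersteinMatrix (hK : IsCompact K) (hμ : ProbOn K μ)
    (hS : IsWassersteinDifferentiableField S v) (hτ : τ ∈ S) (hΦ : ContinuousOn Φ K)
    {Z : Rd d → Rd d} (hZ : ContinuousOn Z K) (z : Rd d) :
    Integrable (fun y => Matrix.toEuclideanLin (wassersteinMatrix v (μ.map Φ) τ z (Φ y)) (Z y))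
      μ := by
  have := hμ.1
  refine Integrable.of_eval_piLp fun i => ?_
  simp only [toEuclideanLin_wassersteinMatrix_apply]
  exact integrable_inner_of_memLp (memLp_wassersteinGradient_comp hK hμ hS hτ hΦ z i)
    (memLp_two_of_ae_mem_isCompact hK hμ.2 hZ)

theorem nonlocalDeriv_apply (hK : IsCompact K) (hμ : ProbOn K μ)
    (hS : IsWassersteinDifferentiableField S v) (hτ : τ ∈ S) (hΦ : ContinuousOn Φ K)
    {Z : Rd d → Rd d} (hZ : ContinuousOn Z K) (z : Rd d) (i : Fin d) :
    nonlocalDeriv v μ Φ τ Z z i =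
      ∫ y, inner ℝ (wassersteinGradient (fun ν => v ν τ z i) (μ.map Φ) (Φ y)) (Z y) ∂μ := by
  rw [nonlocalDeriv, eval_integral_piLp fun i =>
    (integrable_wassersteinMatrix hK hμ hS hτ hΦ hZ z).eval_piLp i]
  simp only [toEuclideanLin_wassersteinMatrix_apply]

theorem nonlocalDeriv_sub (hK : IsCompact K) (hμ : ProbOn K μ)
    (hS : IsWassersteinDifferentiableField S v) (hτ : τ ∈ S) (hΦ : ContinuousOn Φ K)
    {Z Z' : Rd d → Rd d} (hZ : ContinuousOn Z K) (hZ' : ContinuousOn Z' K) (z : Rd d) :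
    nonlocalDeriv v μ Φ τ Z z - nonlocalDeriv v μ Φ τ Z' z =
      nonlocalDeriv v μ Φ τ (fun y => Z y - Z' y) z := by
  rw [nonlocalDeriv, nonlocalDeriv, nonlocalDeriv,
    ← integral_sub (integrable_wassersteinMatrix hK hμ hS hτ hΦ hZ z)
      (integrable_wassersteinMatrix hK hμ hS hτ hΦ hZ' z)]
  simp only [map_sub]

/-- The velocity field is differentiable along perturbations of the measure, locally uniformly
with respect to the position. -/
theorem eventually_expansion (hv : HypothesesWith v M L₁ L₂) (hK : IsCompact K)
    (hμ : ProbOn K μ) (hS : IsWassersteinDifferentiableField S v) (hτ : τ ∈ S)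
    (hΦ : ContinuousOn Φ K) (hinj : InjOn Φ K) {κ : Type*} [Fintype κ] {Z : κ → Rd d → Rd d}
    (hZ : ∀ k, ContinuousOn (Z k) K) (r : ℝ) {η : ℝ} (hη : 0 < η) :
    ∀ᶠ e : EuclideanSpace ℝ κ in 𝓝 0, ∀ z ∈ closedBall (0 : Rd d) r,
      ‖v (μ.map fun y => Φ y + ∑ k, e k • Z k y) τ z - v (μ.map Φ) τ z -
        ∑ k, e k • nonlocalDeriv v μ Φ τ (Z k) z‖ ≤ η * ‖e‖ := by
  obtain ⟨R, hR⟩ := (hK.image_of_continuousOn hΦ).isBounded.subset_closedBall 0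
  -- One ball plays two roles: its radius exceeds `R` by 1 to contain the perturbed measures, and it
  -- contains the positions `z`.
  set R' := max (R + 1) r with hR'
  have hη' : 0 < η / (d + 1) := by positivity
  have key : ∀ i : Fin d, ∃ δ > 0, ∀ e : EuclideanSpace ℝ κ, ‖e‖ < δ →
      ∀ a ∈ S ×ˢ closedBall (0 : Rd d) R',
      |v (μ.map fun y => Φ y + ∑ k, e k • Z k y) a.1 a.2 i - v (μ.map Φ) a.1 a.2 i -
        ∑ k, e k * ∫ y, inner ℝ (wassersteinGradient (fun ν => v ν a.1 a.2 i) (μ.map Φ) (Φ y))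
          (Z k y) ∂μ| ≤ η / (d + 1) * ‖e‖ := fun i =>
    HasWassersteinGradientOn.expansion_map hK hμ hΦ hinj (mapsTo_iff_image_subset.2 hR) hZ
      (closedBall_subset_closedBall (le_max_left _ _))
      (hasWassersteinGradientOn_map hK hμ hS hΦ (isCompact_closedBall _ _) i) hv.L₂_pos.le
      (fun a _ ν ν' hν hν' => by
        have h1 := hv.lipschitz_measure ν ν' hν hν' a.1 a.2
        refine le_trans ?_ h1
        rw [← PiLp.sub_apply, ← Real.norm_eq_abs]
        exact PiLp.norm_apply_le _ i) hη'
  choose δ hδ hkey using key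
  have hev : ∀ᶠ e : EuclideanSpace ℝ κ in 𝓝 0, ∀ i, ‖e‖ < δ i := by
    rw [eventually_all]
    intro i
    have : Continuous fun e : EuclideanSpace ℝ κ => ‖e‖ := continuous_norm
    exact (this.tendsto' 0 0 norm_zero).eventually_lt_const (hδ i)
  filter_upwards [hev] with e he z hz
  have h1 : ∀ i, |(v (μ.map fun y => Φ y + ∑ k, e k • Z k y) τ z - v (μ.map Φ) τ z -
        ∑ k, e k • nonlocalDeriv v μ Φ τ (Z k) z) i| ≤ η / (d + 1) * ‖e‖ := by
    intro i
    have h2 := hkey i e (he i) (τ, z) ⟨hτ, closedBall_subset_closedBall (le_max_right _ _) hz⟩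
    simp only [PiLp.sub_apply, WithLp.ofLp_sum, Finset.sum_apply, PiLp.smul_apply, smul_eq_mul,
      nonlocalDeriv_apply hK hμ hS hτ hΦ (hZ _)]
    exact h2
  refine (norm_le_mul_of_forall_abs_le h1).trans ?_
  rw [← mul_assoc]
  refine mul_le_mul_of_nonneg_right ?_ (norm_nonneg _)
  rw [mul_div_assoc', div_le_iff₀ (by positivity)]
  nlinarith

/-- The representative in `wassersteinGradient` is an arbitrary choice, so regularity in time and
position cannot be read from it. Once integrated against `Z` it is a locally uniform limit of
difference quotients of `v`, from which bounds, continuity and measurability are inherited. -/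
theorem tendsto_quotient (hv : HypothesesWith v M L₁ L₂) (hK : IsCompact K)
    (hμ : ProbOn K μ) (hS : IsWassersteinDifferentiableField S v) (hτ : τ ∈ S)
    (hΦ : ContinuousOn Φ K) (hinj : InjOn Φ K) {Z : Rd d → Rd d} (hZ : ContinuousOn Z K) (r : ℝ) :
    TendstoUniformlyOn (fun (n : ℕ) z => ((n : ℝ) + 1) •
      (v (μ.map fun y => Φ y + ((n : ℝ) + 1)⁻¹ • Z y) τ z - v (μ.map Φ) τ z))
      (nonlocalDeriv v μ Φ τ Z) atTop (closedBall 0 r) := by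
  rw [Metric.tendstoUniformlyOn_iff]
  intro η hη
  have h1 := hv.eventually_expansion hK hμ hS hτ hΦ hinj (κ := Unit) (Z := fun _ => Z)
    (fun _ => hZ) r (half_pos hη)
  have h2 : Tendsto (fun n : ℕ => EuclideanSpace.single () ((n : ℝ) + 1)⁻¹) atTop (𝓝 0) := by
    rw [tendsto_zero_iff_norm_tendsto_zero]
    simp only [PiLp.norm_single]
    have := tendsto_one_div_add_atTop_nhds_zero_nat (𝕜 := ℝ)
    simpa using this.norm
  filter_upwards [h2.eventually h1] with n hn z hz
  have hn' := hn z hz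
  have hpos : (0 : ℝ) < (n : ℝ) + 1 := by positivity
  simp only [Finset.univ_unique, PUnit.default_eq_unit, Finset.sum_singleton,
    PiLp.norm_single, norm_inv, Real.norm_of_nonneg hpos.le] at hn'
  have hs : (EuclideanSpace.single () ((n : ℝ) + 1)⁻¹ : EuclideanSpace ℝ Unit) () =
    ((n : ℝ) + 1)⁻¹ := by simp
  simp only [hs] at hn'
  rw [dist_comm, dist_eq_norm]
  have h3 : ((n : ℝ) + 1) • (v (μ.map fun y => Φ y + ((n : ℝ) + 1)⁻¹ • Z y) τ z -
      v (μ.map Φ) τ z) - nonlocalDeriv v μ Φ τ Z z = ((n : ℝ) + 1) •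
      (v (μ.map fun y => Φ y + ((n : ℝ) + 1)⁻¹ • Z y) τ z - v (μ.map Φ) τ z -
        ((n : ℝ) + 1)⁻¹ • nonlocalDeriv v μ Φ τ Z z) := by
    rw [smul_sub _ (_ - _), smul_inv_smul₀ hpos.ne']
  rw [h3, norm_smul, Real.norm_of_nonneg hpos.le]
  calc _ ≤ ((n : ℝ) + 1) * (η / 2 * ((n : ℝ) + 1)⁻¹) := mul_le_mul_of_nonneg_left hn' hpos.le
    _ = η / 2 := by field_simp
    _ < η := half_lt_self hη

theorem tendsto_quotient_apply (hv : HypothesesWith v M L₁ L₂) (hK : IsCompact K)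
    (hμ : ProbOn K μ) (hS : IsWassersteinDifferentiableField S v) (hτ : τ ∈ S)
    (hΦ : ContinuousOn Φ K) (hinj : InjOn Φ K) {Z : Rd d → Rd d} (hZ : ContinuousOn Z K)
    (z : Rd d) :
    Tendsto (fun (n : ℕ) => ((n : ℝ) + 1) •
      (v (μ.map fun y => Φ y + ((n : ℝ) + 1)⁻¹ • Z y) τ z - v (μ.map Φ) τ z)) atTop
      (𝓝 (nonlocalDeriv v μ Φ τ Z z)) :=
  (hv.tendsto_quotient hK hμ hS hτ hΦ hinj hZ ‖z‖).tendsto_at (by simp)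

theorem norm_nonlocalDeriv_le (hv : HypothesesWith v M L₁ L₂) (hK : IsCompact K)
    (hμ : ProbOn K μ) (hS : IsWassersteinDifferentiableField S v) (hτ : τ ∈ S)
    (hΦ : ContinuousOn Φ K) (hinj : InjOn Φ K) {Z : Rd d → Rd d} (hZ : ContinuousOn Z K)
    (z : Rd d) : ‖nonlocalDeriv v μ Φ τ Z z‖ ≤ L₂ * ∫ y, ‖Z y‖ ∂μ := by
  refine le_of_tendsto (hv.tendsto_quotient_apply hK hμ hS hτ hΦ hinj hZ z).norm
    (Eventually.of_forall fun n => ?_)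
  have hpos : (0 : ℝ) < (n : ℝ) + 1 := by positivity
  have h1 := hv.norm_sub_map_le hK hμ (f := fun y => Φ y + ((n : ℝ) + 1)⁻¹ • Z y)
    (hΦ.add (hZ.const_smul ((n : ℝ) + 1)⁻¹)) hΦ τ z z
  simp only [add_sub_cancel_left, norm_smul, integral_const_mul, sub_self, norm_zero, mul_zero,
    zero_add] at h1
  rw [norm_smul]
  calc _ ≤ ‖(n : ℝ) + 1‖ * (L₂ * (‖((n : ℝ) + 1)⁻¹‖ * ∫ y, ‖Z y‖ ∂μ)) :=
        mul_le_mul_of_nonneg_left h1 (norm_nonneg _)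
    _ = _ := by
        rw [norm_inv, Real.norm_of_nonneg hpos.le]
        field_simp

theorem continuous_nonlocalDeriv (hv : HypothesesWith v M L₁ L₂) (hK : IsCompact K)
    (hμ : ProbOn K μ) (hS : IsWassersteinDifferentiableField S v) (hτ : τ ∈ S)
    (hΦ : ContinuousOn Φ K) (hinj : InjOn Φ K) {Z : Rd d → Rd d} (hZ : ContinuousOn Z K) :
    Continuous (nonlocalDeriv v μ Φ τ Z) := by
  rw [continuous_iff_continuousAt]
  intro z
  have h1 : ContinuousOn (nonlocalDeriv v μ Φ τ Z) (closedBall 0 (‖z‖ + 1)) := by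
    refine (hv.tendsto_quotient hK hμ hS hτ hΦ hinj hZ (‖z‖ + 1)).continuousOn
      (Eventually.of_forall fun n => Continuous.continuousOn ?_).frequently
    exact ((hv.contDiff_space _ (hμ.probCompact_map hK
      (f := fun y => Φ y + ((n : ℝ) + 1)⁻¹ • Z y) (hΦ.add (hZ.const_smul ((n : ℝ) + 1)⁻¹))) τ).continuous.sub
      (hv.contDiff_space _ (hμ.probCompact_map hK hΦ) τ).continuous).const_smul ((n : ℝ) + 1)
  refine h1.continuousAt (mem_of_superset (ball_mem_nhds z one_pos) fun y hy => ?_)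
  rw [mem_closedBall_zero_iff]
  rw [mem_ball_iff_norm] at hy
  linarith [norm_le_norm_add_norm_sub' y z]

/-- The difference quotients are measurable on the whole line; their convergence is known only at
times of `S`, hence the restricted measure. -/
theorem aestronglyMeasurable_nonlocalDeriv (hv : HypothesesWith v M L₁ L₂) (hK : IsCompact K)
    (hμ : ProbOn K μ) (hSm : MeasurableSet S) (hS : IsWassersteinDifferentiableField S v)
    {Φ : ℝ → Rd d → Rd d} (hΦ : ContinuousOn (Function.uncurry Φ) (univ ×ˢ K))
    (hinj : ∀ τ, InjOn (Φ τ) K) {Z : ℝ → Rd d → Rd d}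
    (hZ : ContinuousOn (Function.uncurry Z) (univ ×ˢ K)) {z : ℝ → Rd d} (hz : Continuous z) :
    AEStronglyMeasurable (fun τ => nonlocalDeriv v μ (Φ τ) τ (Z τ) (z τ))
      (volume.restrict S) := by
  have hsec : ∀ {f : ℝ → Rd d → Rd d}, ContinuousOn (Function.uncurry f) (univ ×ˢ K) →
      ∀ c, ContinuousOn (f c) K := fun hf c =>
    hf.comp (f := fun y => (c, y)) (by fun_prop) fun y hy => ⟨mem_univ _, hy⟩
  refine aestronglyMeasurable_of_tendsto_ae (u := atTop) (f := fun (n : ℕ) τ => ((n : ℝ) + 1) •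
      (v (μ.map fun y => Φ τ y + ((n : ℝ) + 1)⁻¹ • Z τ y) τ (z τ) - v (μ.map (Φ τ)) τ (z τ)))
    (fun n => AEStronglyMeasurable.restrict ?_)
    (ae_restrict_of_forall_mem hSm fun τ hτ => ?_)
  · exact ((hv.aestronglyMeasurable_along hK hμ
      (f := fun τ y => Φ τ y + ((n : ℝ) + 1)⁻¹ • Z τ y) (hΦ.add (hZ.const_smul ((n : ℝ) + 1)⁻¹)) hz).sub
      (hv.aestronglyMeasurable_along hK hμ hΦ hz)).const_smul ((n : ℝ) + 1)
  · exact hv.tendsto_quotient_apply hK hμ hS hτ (hsec hΦ τ) (hinj τ) (hsec hZ τ) (z τ)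

end HypothesesWith

end NonlocalDeriv

end

noncomputable section

/-- Used to replace the directions `F k`, continuous only on `K`, by globally continuous ones; `μ`
does not see the change. -/
theorem exists_continuous_eqOn {d : ℕ} {K : Set (Rd d)} (hK : IsClosed K) {f : Rd d → Rd d}
    (hf : ContinuousOn f K) : ∃ g : Rd d → Rd d, Continuous g ∧ EqOn f g K := by
  have : TietzeExtension (Rd d) := TietzeExtension.of_tvs ℝ
  obtain ⟨g, hg⟩ := ContinuousMap.exists_restrict_eq hK
    ⟨K.domRestrict f, continuousOn_iff_continuous_domRestrict.1 hf⟩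
  refine ⟨g, g.continuous, fun x hx => ?_⟩
  exact (DFunLike.congr_fun hg ⟨x, hx⟩).symm

/-! ### Well-posedness of the linearized nonlocal problem -/

section Linearized

variable {d : ℕ} {v : Measure (Rd d) → ℝ → Rd d → Rd d} {M L₁ L₂ : ℝ} {K : Set (Rd d)}
  {μ : Measure (Rd d)} {T s : ℝ}

theorem linearizedField_eq (F : Rd d → Rd d) (w : ℝ → Rd d → Rd d) (t : ℝ) (x : Rd d) :
    linearizedField v s μ F w t x =
      fderiv ℝ (v (μ.map (nonlocalFlow v s μ t)) t) (nonlocalFlow v s μ t x) (w t x) +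
      nonlocalDeriv v μ (nonlocalFlow v s μ t) t
        (fun y => fderiv ℝ (nonlocalFlow v s μ t) y (F y) + w t y) (nonlocalFlow v s μ t x) :=
  rfl

theorem linearizedField_congr {F F' : Rd d → Rd d} (h : F =ᵐ[μ] F') (w : ℝ → Rd d → Rd d) :
    linearizedField v s μ F w = linearizedField v s μ F' w := by
  funext t x
  rw [linearizedField_eq, linearizedField_eq, nonlocalDeriv_congr]
  filter_upwards [h] with y hy
  rw [hy]

theorem IsLinearizedSolution.congr {F F' : Rd d → Rd d} (h : F =ᵐ[μ] F') {w : ℝ → Rd d → Rd d}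
    (hw : IsLinearizedSolution v T s μ F w) : IsLinearizedSolution v T s μ F' w := by
  refine ⟨hw.1, fun t ht x => ?_⟩
  rw [← linearizedField_congr h w]
  exact hw.2 t ht x

namespace HypothesesWith

theorem fderiv_nonlocalFlow (hv : HypothesesWith v M L₁ L₂) (hK : IsCompact K)
    (hμ : ProbOn K μ) (s : ℝ) : Continuous fun p : ℝ × Rd d =>
      fderiv ℝ (nonlocalFlow v s μ p.1) p.2 := by
  obtain ⟨J, hJc, hJ, -⟩ := (hv.isNonlocalFlow_nonlocalFlow hK hμ s).exists_hasFDerivAt hv hK hμ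
  have : (fun p : ℝ × Rd d => fderiv ℝ (nonlocalFlow v s μ p.1) p.2) = Function.uncurry J :=
    funext fun p => (hJ p.1 p.2).fderiv
  rw [this]
  exact hJc

theorem exists_linearized (hv : HypothesesWith v M L₁ L₂) (hK : IsCompact K)
    (hμ : ProbOn K μ) (hS : IsWassersteinDifferentiableField (Icc 0 T) v) (hs : s ∈ Icc 0 T)
    {F : Rd d → Rd d} (hF : Continuous F) :
    ∃ w : ℝ → Rd d → Rd d, Continuous (Function.uncurry w) ∧
      IsLinearizedSolution v T s μ F w := by
  have hflow := hv.isNonlocalFlow_nonlocalFlow hK hμ s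
  set Φ := nonlocalFlow v s μ with hΦdef
  have hΦc := hflow.continuous_uncurry hv hK hμ
  have hΦx := hflow.continuous_time
  have hpc := hflow.probCompact hK hμ
  have hinj : ∀ τ, InjOn (Φ τ) K := fun τ => (hflow.injective hv hK hμ τ).injOn
  have hL₁ := hv.L₁_pos
  have hL₂ := hv.L₂_pos
  have hJF : Continuous fun p : ℝ × Rd d => fderiv ℝ (Φ p.1) p.2 (F p.2) :=
    (hv.fderiv_nonlocalFlow hK hμ s).clm_apply (hF.comp continuous_snd)
  have hJF' : ∀ τ, Continuous fun y => fderiv ℝ (Φ τ) y (F y) := fun τ =>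
    hJF.comp (by fun_prop : Continuous fun y : Rd d => (τ, y))
  obtain ⟨CJ, hCJ⟩ := ((isCompact_Icc (a := (0 : ℝ)) (b := T)).prod hK).exists_bound_of_continuousOn
    hJF.continuousOn
  -- The right-hand side is cut off outside `[0, T]`: the Volterra lemma asks for bounds at all
  -- times, while differentiability in the measure is available only there.
  obtain ⟨N, hN⟩ : ∃ N : ℝ → (Rd d → Rd d) → Rd d → Rd d, N = fun τ g x => (Icc 0 T).indicator (fun τ =>
    fderiv ℝ (v (μ.map (Φ τ)) τ) (Φ τ x) (g x) +
      nonlocalDeriv v μ (Φ τ) τ (fun y => fderiv ℝ (Φ τ) y (F y) + g y) (Φ τ x)) τ := ⟨_, rfl⟩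
  have hNin : ∀ {τ}, τ ∈ Icc 0 T → ∀ g x, N τ g x =
      fderiv ℝ (v (μ.map (Φ τ)) τ) (Φ τ x) (g x) +
      nonlocalDeriv v μ (Φ τ) τ (fun y => fderiv ℝ (Φ τ) y (F y) + g y) (Φ τ x) :=
    fun hτ g x => by
      rw [hN]
      exact indicator_of_mem hτ _
  have hNout : ∀ {τ}, τ ∉ Icc 0 T → ∀ g x, N τ g x = 0 := fun hτ g x => by
    rw [hN]
    exact indicator_of_notMem hτ _
  have hsum : ∀ τ {g : Rd d → Rd d}, Continuous g →
      ContinuousOn (fun y => fderiv ℝ (Φ τ) y (F y) + g y) K := fun τ g hg =>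
    ((hJF' τ).add hg).continuousOn
  obtain ⟨f, hf, -, hfe⟩ := exists_volterra_solution (X := Rd d) (E := Rd d) s
    -- `L₁ + L₂` is the Lipschitz constant of the local and nonlocal terms, and `L₂ |CJ|` bounds the
    -- forcing by `DΦ F` that remains when the unknown is zero. No spatial weight is needed since
    -- these bounds do not depend on the position.
    (ω := fun _ => 1) continuous_const (fun _ => one_pos) N (C := L₁ + L₂ + L₂ * |CJ|)
    (by positivity) (by
      intro f hf _ x
      rw [hN]
      have hfx : Continuous fun τ => f τ x := hf.comp (by fun_prop : Continuous fun τ : ℝ => (τ, x))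
      have hZ : Continuous (Function.uncurry fun τ y => fderiv ℝ (Φ τ) y (F y) + f τ y) :=
        hJF.add hf
      have h1 : AEStronglyMeasurable (fun τ => fderiv ℝ (v (μ.map (Φ τ)) τ) (Φ τ x) (f τ x) +
          nonlocalDeriv v μ (Φ τ) τ (fun y => fderiv ℝ (Φ τ) y (F y) + f τ y) (Φ τ x))
          (volume.restrict (Icc 0 T)) := by
        refine AEStronglyMeasurable.add (AEStronglyMeasurable.restrict ?_)
          (hv.aestronglyMeasurable_nonlocalDeriv hK hμ measurableSet_Icc hS hΦc.continuousOn hinj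
            hZ.continuousOn (hΦx x))
        exact aestronglyMeasurable_clm_apply
          (fun w => (hv.aestronglyMeasurable_fderiv_along hK hμ hΦc.continuousOn
            (hΦx x)).apply_continuousLinearMap w) hfx.aestronglyMeasurable
      have h2 := (aestronglyMeasurable_indicator_iff measurableSet_Icc).2 h1
      refine h2.congr (Eventually.of_forall fun τ => ?_)
      by_cases hτ : τ ∈ Icc 0 T <;> simp only [indicator_of_mem, indicator_of_notMem, hτ,
        not_false_eq_true]) (by
      intro τ g hg _
      by_cases hτ : τ ∈ Icc 0 T
      · have h1 : N τ g = fun x => fderiv ℝ (v (μ.map (Φ τ)) τ) (Φ τ x) (g x) +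
            nonlocalDeriv v μ (Φ τ) τ (fun y => fderiv ℝ (Φ τ) y (F y) + g y) (Φ τ x) :=
          funext fun x => hNin hτ g x
        rw [h1]
        exact (((hv.continuous_fderiv (hpc τ) τ).comp (hflow.1 τ)).clm_apply hg).add
          ((hv.continuous_nonlocalDeriv hK hμ hS hτ (hflow.1 τ).continuousOn (hinj τ)
            (hsum τ hg)).comp (hflow.1 τ))
      · have h1 : N τ g = fun _ => 0 := funext fun x => hNout hτ g x
        rw [h1]
        exact continuous_const) (by
      intro τ x
      by_cases hτ : τ ∈ Icc 0 T
      · rw [hNin hτ (fun _ => 0) x, map_zero, zero_add, mul_one]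
        refine (hv.norm_nonlocalDeriv_le hK hμ hS hτ (hflow.1 τ).continuousOn (hinj τ)
          (hsum τ continuous_const) _).trans ?_
        have h1 : ∫ y, ‖fderiv ℝ (Φ τ) y (F y) + 0‖ ∂μ ≤ |CJ| :=
          integral_norm_le_of_forall_mem hμ fun y hy => by
            rw [add_zero]
            exact (hCJ (τ, y) ⟨hτ, hy⟩).trans (le_abs_self _)
        have h2 := mul_le_mul_of_nonneg_left h1 hL₂.le
        linarith
      · rw [hNout hτ (fun _ => 0) x, norm_zero]
        positivity) (by
      intro τ g g' b hg hg' _ _ hb hgg' x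
      simp only [mul_one] at hgg' ⊢
      by_cases hτ : τ ∈ Icc 0 T
      · rw [hNin hτ, hNin hτ, add_sub_add_comm, ← map_sub,
          nonlocalDeriv_sub hK hμ hS hτ (hflow.1 τ).continuousOn (hsum τ hg) (hsum τ hg')]
        simp only [add_sub_add_left_eq_sub]
        have h1 := hv.norm_nonlocalDeriv_le hK hμ hS hτ (hflow.1 τ).continuousOn (hinj τ)
          (Z := fun y => g y - g' y) (hg.sub hg').continuousOn (Φ τ x)
        have h2 : ∫ y, ‖g y - g' y‖ ∂μ ≤ b := integral_norm_le_of_forall_mem hμ fun y _ => hgg' y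
        have h3 := mul_le_mul_of_nonneg_left h2 hL₂.le
        have h4 := ContinuousLinearMap.le_of_opNorm_le _ (hv.norm_fderiv_le (hpc τ) τ (Φ τ x))
          (g x - g' x)
        have h5 := mul_le_mul_of_nonneg_left (hgg' x) hL₁.le
        have h6 : 0 ≤ L₂ * |CJ| * b := by positivity
        refine (norm_add_le _ _).trans ?_
        calc _ ≤ L₁ * b + L₂ * b := add_le_add (h4.trans h5) (h1.trans h3)
          _ ≤ L₁ * b + L₂ * b + L₂ * |CJ| * b := le_add_of_nonneg_right h6
          _ = _ := by ring
      · rw [hNout hτ, hNout hτ, sub_zero, norm_zero]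
        positivity)
  refine ⟨f, hf, hf.continuousOn, fun t ht x => ?_⟩
  have h1 : ∀ τ ∈ uIcc s t, N τ (f τ) x = linearizedField v s μ F f τ x := fun τ hτ => by
    rw [hNin (uIcc_subset_Icc hs ht hτ), linearizedField_eq]
  refine ⟨(hfe t x).1.congr fun τ hτ => h1 τ (uIoc_subset_uIcc hτ), ?_⟩
  rw [(hfe t x).2]
  exact intervalIntegral.integral_congr h1

/-- The difference of two solutions solves the homogeneous equation, so the bootstrap closes with `A
= 0`. -/
theorem eqOn_of_isLinearizedSolution (hv : HypothesesWith v M L₁ L₂) (hK : IsCompact K)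
    (hμ : ProbOn K μ) (hS : IsWassersteinDifferentiableField (Icc 0 T) v) (hs : s ∈ Icc 0 T)
    {F : Rd d → Rd d} (hF : Continuous F) {w w' : ℝ → Rd d → Rd d}
    (hw : IsLinearizedSolution v T s μ F w) (hw' : IsLinearizedSolution v T s μ F w') :
    ∀ t ∈ Icc 0 T, ∀ x, w' t x = w t x := by
  intro t ht x
  have hflow := hv.isNonlocalFlow_nonlocalFlow hK hμ s
  set Φ := nonlocalFlow v s μ with hΦdef
  have hpc := hflow.probCompact hK hμ
  have hinj : ∀ τ, InjOn (Φ τ) K := fun τ => (hflow.injective hv hK hμ τ).injOn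
  have hL₁ := hv.L₁_pos
  have hL₂ := hv.L₂_pos
  -- The first term meets the Grönwall condition `2 L₁ ≤ l`; the second makes the nonlocal
  -- contribution `2 L₂ b / l` at most `b / 2`.
  set l := 2 * L₁ + 4 * L₂ with hl
  have hl0 : 0 < l := by positivity
  have hJF' : ∀ τ, Continuous fun y => fderiv ℝ (Φ τ) y (F y) := fun τ =>
    ((hv.fderiv_nonlocalFlow hK hμ s).comp (by fun_prop : Continuous fun y : Rd d => (τ, y))).clm_apply hF
  have hwc : ∀ {w : ℝ → Rd d → Rd d}, IsLinearizedSolution v T s μ F w → ∀ τ ∈ Icc 0 T,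
      Continuous (w τ) := fun hw τ hτ => by
    rw [← continuousOn_univ]
    exact hw.1.comp (f := fun y => (τ, y)) (by fun_prop) fun y hy => ⟨hτ, hy⟩
  have hsum : ∀ {w : ℝ → Rd d → Rd d}, IsLinearizedSolution v T s μ F w → ∀ τ ∈ Icc 0 T,
      ContinuousOn (fun y => fderiv ℝ (Φ τ) y (F y) + w τ y) K := fun hw τ hτ =>
    ((hJF' τ).add (hwc hw τ hτ)).continuousOn
  -- A solution may be unbounded in space. The nonlocal term sees it only on `K`, so it suffices to
  -- follow `K` and the single point `x`, a compact set on which continuity supplies the a priori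
  -- bound.
  set I : Set (ℝ × Rd d) := Icc 0 T ×ˢ insert x K with hI
  have hIc : IsCompact I := isCompact_Icc.prod (hK.insert x)
  have hdc : ContinuousOn (fun p : ℝ × Rd d => w' p.1 p.2 - w p.1 p.2) (Icc 0 T ×ˢ univ) :=
    hw'.1.sub hw.1
  obtain ⟨b₀, hb₀⟩ := hIc.exists_bound_of_continuousOn (hdc.mono (prod_mono subset_rfl
    (subset_univ _)))
  have key := le_two_mul_of_bootstrap (I := I)
    (u := fun p => ‖w' p.1 p.2 - w p.1 p.2‖ / Real.exp (l * |p.1 - s|)) (A := 0) (b₀ := b₀) le_rfl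
    (fun p hp => (div_le_self (norm_nonneg _) (Real.one_le_exp (by positivity))).trans (hb₀ p hp))
    (by
      intro b hb hbI p hp
      have hle : ∀ τ ∈ Icc 0 T, ∀ y ∈ K, ‖w' τ y - w τ y‖ ≤ b * Real.exp (l * |τ - s|) :=
        fun τ hτ y hy => by
          have := hbI (τ, y) ⟨hτ, mem_insert_of_mem _ hy⟩
          rwa [div_le_iff₀ (Real.exp_pos _)] at this
      have h1 := norm_le_of_integral_inequality (I := Icc 0 T) ordConnected_Icc hs
        (r := fun t => w' t p.2 - w t p.2)
        (q := fun τ => linearizedField v s μ F w' τ p.2 - linearizedField v s μ F w τ p.2)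
        (g := fun _ => 0) (r₀ := 0) (L := L₁) (c := L₂ * b) (l := l) (G := 0) (b₀ := b₀) hL₁.le
        (by positivity) hl0 (by linarith) (fun t ht => by
          rw [intervalIntegral.integral_sub (hw'.2 t ht _).1 (hw.2 t ht _).1,
            ← (hw'.2 t ht _).2, ← (hw.2 t ht _).2, zero_add]) (fun τ hτ => by
          rw [linearizedField_eq, linearizedField_eq, ← hΦdef, add_sub_add_comm, ← map_sub,
            nonlocalDeriv_sub hK hμ hS hτ (hflow.1 τ).continuousOn (hsum hw' τ hτ)
              (hsum hw τ hτ)]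
          simp only [add_sub_add_left_eq_sub]
          have h1 := hv.norm_nonlocalDeriv_le hK hμ hS hτ (hflow.1 τ).continuousOn (hinj τ)
            (Z := fun y => w' τ y - w τ y) ((hwc hw' τ hτ).sub (hwc hw τ hτ)).continuousOn
            (Φ τ p.2)
          have h2 := integral_norm_le_of_forall_mem hμ (hle τ hτ)
          have h3 := mul_le_mul_of_nonneg_left h2 hL₂.le
          have h4 := ContinuousLinearMap.le_of_opNorm_le _ (hv.norm_fderiv_le (hpc τ) τ (Φ τ p.2))
            (w' τ p.2 - w τ p.2)
          refine (norm_add_le _ _).trans ?_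
          linarith) (fun _ _ => by simp) (fun _ _ => by simp)
        (fun t ht => hb₀ (t, p.2) ⟨ht, hp.2⟩) p.1 hp.1
      rw [div_le_iff₀ (Real.exp_pos _)]
      refine h1.trans ?_
      rw [norm_zero, add_zero, mul_zero, add_zero, add_zero, mul_comm]
      refine mul_le_mul_of_nonneg_right ?_ (Real.exp_pos _).le
      rw [mul_div_assoc', div_le_iff₀ hl0]
      have : 0 ≤ L₁ * b := by positivity
      rw [hl]
      linarith)
  have h1 := key (t, x) ⟨ht, mem_insert _ _⟩
  rw [mul_zero, div_le_iff₀ (Real.exp_pos _), zero_mul] at h1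
  exact sub_eq_zero.1 (norm_le_zero_iff.1 h1)

end HypothesesWith

end Linearized

/-! ### Linearization of the field in the measure and the position -/

section LinearizationError

variable {d : ℕ} {v : Measure (Rd d) → ℝ → Rd d → Rd d} {M L₁ L₂ : ℝ} {K : Set (Rd d)}
  {μ : Measure (Rd d)} {S : Set ℝ} {κ : Type*} [Fintype κ]

/-- The remainder in the linearization of `v[Φ_# μ](τ, z)` along simultaneous perturbations of
the map `Φ` and of the point `z`. -/
def linearizationError (v : Measure (Rd d) → ℝ → Rd d → Rd d) (μ : Measure (Rd d))
    (Φ : Rd d → Rd d) (τ : ℝ) (Z : κ → Rd d → Rd d) (z : Rd d) (u : κ → Rd d)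
    (e : EuclideanSpace ℝ κ) : Rd d :=
  v (μ.map fun y => Φ y + ∑ k, e k • Z k y) τ (z + ∑ k, e k • u k) - v (μ.map Φ) τ z -
    ∑ k, e k • (fderiv ℝ (v (μ.map Φ) τ) z (u k) + nonlocalDeriv v μ Φ τ (Z k) z)

namespace HypothesesWith

variable {Φ : Rd d → Rd d} {τ : ℝ} {Z : κ → Rd d → Rd d}

/-- Supplies the dominating function for the dominated convergence arguments, from the Lipschitz
bounds alone. -/
theorem norm_linearizationError_le (hv : HypothesesWith v M L₁ L₂) (hK : IsCompact K)
    (hμ : ProbOn K μ) (hS : IsWassersteinDifferentiableField S v) (hτ : τ ∈ S)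
    (hΦ : ContinuousOn Φ K) (hinj : InjOn Φ K) (hZ : ∀ k, ContinuousOn (Z k) K) (z : Rd d)
    {u : κ → Rd d} {C : ℝ} (hu : ∀ k, ‖u k‖ ≤ C) (hZC : ∀ k, ∀ y ∈ K, ‖Z k y‖ ≤ C)
    (e : EuclideanSpace ℝ κ) :
    ‖linearizationError v μ Φ τ Z z u e‖ ≤ 2 * (L₁ + L₂) * (Fintype.card κ * C) * ‖e‖ := by
  have hL₁ := hv.L₁_pos
  have hL₂ := hv.L₂_pos
  have hZe : ContinuousOn (fun y => Φ y + ∑ k, e k • Z k y) K :=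
    hΦ.add (continuousOn_finsetSum _ fun k _ => (hZ k).const_smul (e k))
  have h1 := hv.norm_sub_map_le hK hμ hZe hΦ τ (z + ∑ k, e k • u k) z
  simp only [add_sub_cancel_left] at h1
  have h2 : ‖∑ k, e k • u k‖ ≤ ‖e‖ * (Fintype.card κ * C) := by
    simpa using norm_sum_smul_le e hu
  have h3 : ∫ y, ‖∑ k, e k • Z k y‖ ∂μ ≤ ‖e‖ * (Fintype.card κ * C) :=
    integral_norm_le_of_forall_mem hμ fun y hy => by
      simpa using norm_sum_smul_le e fun k => hZC k y hy
  have h4 : ∀ k, ‖fderiv ℝ (v (μ.map Φ) τ) z (u k) + nonlocalDeriv v μ Φ τ (Z k) z‖ ≤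
      (L₁ + L₂) * C := by
    intro k
    have h5 := ContinuousLinearMap.le_of_opNorm_le _
      (hv.norm_fderiv_le (hμ.probCompact_map hK hΦ) τ z) (u k)
    have h6 := mul_le_mul_of_nonneg_left (hu k) hL₁.le
    have h7 := hv.norm_nonlocalDeriv_le hK hμ hS hτ hΦ hinj (hZ k) z
    have h8 := mul_le_mul_of_nonneg_left (integral_norm_le_of_forall_mem hμ (hZC k)) hL₂.le
    refine (norm_add_le _ _).trans ?_
    linarith
  have h9 : ‖∑ k, e k • (fderiv ℝ (v (μ.map Φ) τ) z (u k) + nonlocalDeriv v μ Φ τ (Z k) z)‖ ≤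
      ‖e‖ * (Fintype.card κ * ((L₁ + L₂) * C)) := by
    simpa using norm_sum_smul_le e h4
  have h10 := mul_le_mul_of_nonneg_left h2 hL₁.le
  have h11 := mul_le_mul_of_nonneg_left h3 hL₂.le
  refine (norm_sub_le _ _).trans ?_
  calc _ ≤ (L₁ * (‖e‖ * (Fintype.card κ * C)) + L₂ * (‖e‖ * (Fintype.card κ * C))) +
        ‖e‖ * (Fintype.card κ * ((L₁ + L₂) * C)) := add_le_add (by linarith) h9
    _ = _ := by ring

/-- Three contributions: the expansion in the measure at the moved point, the variation of the
nonlocal derivative between `z` and that point, and the differential in `x`. The first uses that the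
expansion is locally uniform in the position, the second that the nonlocal derivative is continuous.
-/
theorem isLittleO_linearizationError (hv : HypothesesWith v M L₁ L₂) (hK : IsCompact K)
    (hμ : ProbOn K μ) (hS : IsWassersteinDifferentiableField S v) (hτ : τ ∈ S)
    (hΦ : ContinuousOn Φ K) (hinj : InjOn Φ K) (hZ : ∀ k, ContinuousOn (Z k) K) (z : Rd d)
    (u : κ → Rd d) :
    (fun e => linearizationError v μ Φ τ Z z u e) =o[𝓝 0] fun e => e := by
  have hlin : Continuous fun e : EuclideanSpace ℝ κ => ∑ k, e k • u k := by fun_prop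
  have hzlim : Tendsto (fun e : EuclideanSpace ℝ κ => z + ∑ k, e k • u k) (𝓝 0) (𝓝 z) :=
    (continuous_const.add hlin).tendsto' 0 z (by simp)
  have h1 : (fun e : EuclideanSpace ℝ κ =>
      v (μ.map fun y => Φ y + ∑ k, e k • Z k y) τ (z + ∑ k, e k • u k) -
        v (μ.map Φ) τ (z + ∑ k, e k • u k) -
        ∑ k, e k • nonlocalDeriv v μ Φ τ (Z k) (z + ∑ k, e k • u k)) =o[𝓝 0] fun e => e := by
    rw [Asymptotics.isLittleO_iff]
    intro η hη
    have hmem : ∀ᶠ e : EuclideanSpace ℝ κ in 𝓝 0,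
        z + ∑ k, e k • u k ∈ Metric.closedBall (0 : Rd d) (‖z‖ + 1) := by
      refine hzlim.eventually (mem_of_superset (Metric.ball_mem_nhds z one_pos) fun y hy => ?_)
      change y ∈ Metric.closedBall 0 (‖z‖ + 1)
      rw [mem_closedBall_zero_iff]
      rw [mem_ball_iff_norm] at hy
      linarith [norm_le_norm_add_norm_sub' y z]
    filter_upwards [hv.eventually_expansion hK hμ hS hτ hΦ hinj hZ (‖z‖ + 1) hη, hmem]
      with e he hme using he _ hme
  have hcoord : ∀ k, (fun e : EuclideanSpace ℝ κ => e k) =O[𝓝 0] fun e => e := fun k =>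
    Asymptotics.IsBigO.of_bound 1 (Eventually.of_forall fun e => by
      rw [one_mul]
      exact PiLp.norm_apply_le e k)
  have h2 : (fun e : EuclideanSpace ℝ κ => ∑ k, e k •
      (nonlocalDeriv v μ Φ τ (Z k) (z + ∑ k, e k • u k) - nonlocalDeriv v μ Φ τ (Z k) z))
      =o[𝓝 0] fun e => e := by
    refine Asymptotics.IsLittleO.fun_sum fun k _ => ?_
    have h3 : (fun e : EuclideanSpace ℝ κ => nonlocalDeriv v μ Φ τ (Z k) (z + ∑ k, e k • u k) -
        nonlocalDeriv v μ Φ τ (Z k) z) =o[𝓝 0] fun _ => (1 : ℝ) := by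
      rw [Asymptotics.isLittleO_one_iff]
      have h4 := ((hv.continuous_nonlocalDeriv hK hμ hS hτ hΦ hinj (hZ k)).tendsto z).comp hzlim
      simpa using h4.sub_const (nonlocalDeriv v μ Φ τ (Z k) z)
    have h5 := (hcoord k).norm_right.smul_isLittleO h3
    simp only [smul_eq_mul, mul_one] at h5
    exact h5.of_norm_right
  have h6 : (fun e : EuclideanSpace ℝ κ => v (μ.map Φ) τ (z + ∑ k, e k • u k) - v (μ.map Φ) τ z -
      fderiv ℝ (v (μ.map Φ) τ) z (∑ k, e k • u k)) =o[𝓝 0] fun e => e := by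
    have h7 := (((hv.contDiff_space _ (hμ.probCompact_map hK hΦ) τ).differentiable (by simp))
      z).hasFDerivAt
    rw [hasFDerivAt_iff_isLittleO_nhds_zero] at h7
    refine (h7.comp_tendsto (hlin.tendsto' 0 0 (by simp))).trans_isBigO ?_
    refine Asymptotics.IsBigO.of_bound (∑ k, ‖u k‖) (Eventually.of_forall fun e => ?_)
    rw [mul_comm]
    exact norm_sum_smul_le e fun k => le_rfl
  refine ((h1.add h2).add h6).congr_left fun e => ?_
  simp only [linearizationError, map_sum, map_smul, smul_add, smul_sub, Finset.sum_add_distrib,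
    Finset.sum_sub_distrib]
  abel

end HypothesesWith

end LinearizationError

end

noncomputable section

/-! ### Remainder estimates for the perturbed flow -/

section Remainder

variable {d : ℕ} {v : Measure (Rd d) → ℝ → Rd d → Rd d} {M L₁ L₂ : ℝ} {K : Set (Rd d)}
  {μ : Measure (Rd d)} {S : Set ℝ} {κ : Type*} [Fintype κ] {T s : ℝ}

namespace HypothesesWith

theorem aestronglyMeasurable_linearizationError (hv : HypothesesWith v M L₁ L₂)
    (hK : IsCompact K) (hμ : ProbOn K μ) (hSm : MeasurableSet S)
    (hS : IsWassersteinDifferentiableField S v) {Φ : ℝ → Rd d → Rd d}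
    (hΦ : Continuous (Function.uncurry Φ)) (hinj : ∀ τ, InjOn (Φ τ) K)
    {Z : κ → ℝ → Rd d → Rd d} (hZ : ∀ k, Continuous (Function.uncurry (Z k))) {z : ℝ → Rd d}
    (hz : Continuous z) {u : κ → ℝ → Rd d} (hu : ∀ k, Continuous (u k))
    (e : EuclideanSpace ℝ κ) :
    AEStronglyMeasurable (fun τ => linearizationError v μ (Φ τ) τ (fun k => Z k τ) (z τ)
      (fun k => u k τ) e) (volume.restrict S) := by
  have hZe : Continuous (Function.uncurry fun τ y => Φ τ y + ∑ k, e k • Z k τ y) :=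
    hΦ.add (continuous_finsetSum _ fun k _ => (hZ k).const_smul (e k))
  have hze : Continuous fun τ => z τ + ∑ k, e k • u k τ :=
    hz.add (continuous_finsetSum _ fun k _ => (hu k).const_smul (e k))
  refine AEStronglyMeasurable.sub (AEStronglyMeasurable.sub ?_ ?_)
    (Finset.aestronglyMeasurable_fun_sum _ fun k _ =>
      AEStronglyMeasurable.const_smul (AEStronglyMeasurable.add ?_ ?_) (e k))
  · exact (hv.aestronglyMeasurable_along hK hμ hZe.continuousOn hze).restrict
  · exact (hv.aestronglyMeasurable_along hK hμ hΦ.continuousOn hz).restrict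
  · exact (aestronglyMeasurable_clm_apply (fun w =>
      (hv.aestronglyMeasurable_fderiv_along hK hμ hΦ.continuousOn hz).apply_continuousLinearMap w)
      (hu k).aestronglyMeasurable).restrict
  · exact hv.aestronglyMeasurable_nonlocalDeriv hK hμ hSm hS hΦ.continuousOn hinj
      (hZ k).continuousOn hz

theorem continuous_linearizationError (hv : HypothesesWith v M L₁ L₂)
    (hK : IsCompact K) (hμ : ProbOn K μ) (hS : IsWassersteinDifferentiableField S v) {τ : ℝ}
    (hτ : τ ∈ S) {Φ : Rd d → Rd d} (hΦ : ContinuousOn Φ K) (hinj : InjOn Φ K)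
    {Z : κ → Rd d → Rd d} (hZ : ∀ k, ContinuousOn (Z k) K) {z : Rd d → Rd d}
    (hz : Continuous z) {u : κ → Rd d → Rd d} (hu : ∀ k, Continuous (u k))
    (e : EuclideanSpace ℝ κ) :
    Continuous fun y => linearizationError v μ Φ τ Z (z y) (fun k => u k y) e := by
  have hZe : ContinuousOn (fun y => Φ y + ∑ k, e k • Z k y) K :=
    hΦ.add (continuousOn_finsetSum _ fun k _ => (hZ k).const_smul (e k))
  have hze : Continuous fun y => z y + ∑ k, e k • u k y :=
    hz.add (continuous_finsetSum _ fun k _ => (hu k).const_smul (e k))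
  have hm := hμ.probCompact_map hK hΦ
  refine (((hv.contDiff_space _ (hμ.probCompact_map hK hZe) τ).continuous.comp hze).sub
    ((hv.contDiff_space _ hm τ).continuous.comp hz)).sub
    (continuous_finsetSum _ fun k _ => Continuous.const_smul (Continuous.add ?_ ?_) (e k))
  · exact ((hv.continuous_fderiv hm τ).comp hz).clm_apply (hu k)
  · exact (hv.continuous_nonlocalDeriv hK hμ hS hτ hΦ hinj (hZ k)).comp hz

variable {Φ : ℝ → Rd d → Rd d} {Z : κ → ℝ → Rd d → Rd d}

theorem exists_norm_linearizationError_le (hv : HypothesesWith v M L₁ L₂)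
    (hK : IsCompact K) (hμ : ProbOn K μ) (hS : IsWassersteinDifferentiableField (Icc 0 T) v)
    (hΦ : Continuous (Function.uncurry Φ)) (hinj : ∀ τ, InjOn (Φ τ) K)
    (hZ : ∀ k, Continuous (Function.uncurry (Z k))) {K₁ : Set (Rd d)} (hK₁ : IsCompact K₁)
    {u : κ → ℝ → Rd d → Rd d} (hu : ∀ k, Continuous (Function.uncurry (u k))) :
    ∃ C, 0 ≤ C ∧ ∀ e, ∀ τ ∈ Icc 0 T, ∀ y ∈ K₁, ‖linearizationError v μ (Φ τ) τ (fun k => Z k τ)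
      (Φ τ y) (fun k => u k τ y) e‖ ≤ C * ‖e‖ := by
  have hL₁ := hv.L₁_pos
  have hL₂ := hv.L₂_pos
  choose CZ hCZ using fun k => ((isCompact_Icc (a := 0) (b := T)).prod
    hK).exists_bound_of_continuousOn (hZ k).continuousOn
  choose Cu hCu using fun k => ((isCompact_Icc (a := 0) (b := T)).prod
    hK₁).exists_bound_of_continuousOn (hu k).continuousOn
  set C := ∑ k, (|CZ k| + |Cu k|) with hC
  have hCk : ∀ k, |CZ k| + |Cu k| ≤ C := fun k =>
    Finset.single_le_sum (f := fun k => |CZ k| + |Cu k|) (fun _ _ => by positivity)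
      (Finset.mem_univ k)
  refine ⟨2 * (L₁ + L₂) * (Fintype.card κ * C), by positivity, fun e τ hτ y hy => ?_⟩
  refine hv.norm_linearizationError_le hK hμ hS hτ
    (hΦ.comp (by fun_prop : Continuous fun y : Rd d => (τ, y))).continuousOn (hinj τ)
    (fun k => ((hZ k).comp (by fun_prop : Continuous fun y : Rd d => (τ, y))).continuousOn) _
    (fun k => ?_) (fun k z hz => ?_) e
  · have h1 := hCu k (τ, y) ⟨hτ, hy⟩
    have h2 := hCk k
    simp only [Function.uncurry_apply_pair] at h1
    linarith [le_abs_self (Cu k), abs_nonneg (CZ k)]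
  · have h1 := hCZ k (τ, z) ⟨hτ, hz⟩
    have h2 := hCk k
    simp only [Function.uncurry_apply_pair] at h1
    change ‖Z k τ z‖ ≤ C
    linarith [le_abs_self (CZ k), abs_nonneg (Cu k)]

theorem continuousOn_integral_linearizationError (hv : HypothesesWith v M L₁ L₂)
    (hK : IsCompact K) (hμ : ProbOn K μ) (hS : IsWassersteinDifferentiableField (Icc 0 T) v)
    (hΦ : Continuous (Function.uncurry Φ)) (hinj : ∀ τ, InjOn (Φ τ) K)
    (hZ : ∀ k, Continuous (Function.uncurry (Z k))) (e : EuclideanSpace ℝ κ) :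
    ContinuousOn (fun y => ∫ τ in Icc 0 T, ‖linearizationError v μ (Φ τ) τ (fun k => Z k τ)
      (Φ τ y) (fun k => Z k τ y) e‖) K := by
  obtain ⟨C, -, hC⟩ := hv.exists_norm_linearizationError_le hK hμ hS hΦ hinj hZ hK hZ
  have hsec : ∀ {f : ℝ → Rd d → Rd d}, Continuous (Function.uncurry f) → ∀ τ, Continuous (f τ) :=
    fun hf τ => hf.comp (by fun_prop : Continuous fun y : Rd d => (τ, y))
  have hsec' : ∀ {f : ℝ → Rd d → Rd d}, Continuous (Function.uncurry f) →
      ∀ y, Continuous fun τ => f τ y :=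
    fun hf y => hf.comp (by fun_prop : Continuous fun τ : ℝ => (τ, y))
  refine continuousOn_of_dominated (bound := fun _ => C * ‖e‖) (fun y _ =>
    (hv.aestronglyMeasurable_linearizationError hK hμ measurableSet_Icc hS hΦ hinj hZ
      (hsec' hΦ y) (fun k => hsec' (hZ k) y) e).norm)
    (fun y hy => ae_restrict_of_forall_mem measurableSet_Icc fun τ hτ => ?_)
    (integrable_const _) (ae_restrict_of_forall_mem measurableSet_Icc fun τ hτ => ?_)
  · rw [norm_norm]
    exact hC e τ hτ y hy
  · exact (hv.continuous_linearizationError hK hμ hS hτ (hsec hΦ τ).continuousOn (hinj τ)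
      (fun k => (hsec (hZ k) τ).continuousOn) (hsec hΦ τ)
      (fun k => hsec (hZ k) τ) e).norm.continuousOn

end HypothesesWith

/-- The curves `u k` solve the linearized equation along the trajectory of `x` with forcing
`Z k`, and start from `u₀ k`. -/
def IsLinearizedCurve (v : Measure (Rd d) → ℝ → Rd d → Rd d) (μ : Measure (Rd d)) (T s : ℝ)
    (Φ : ℝ → Rd d → Rd d) (Z : κ → ℝ → Rd d → Rd d) (x : Rd d) (u₀ : κ → Rd d)
    (u : κ → ℝ → Rd d) : Prop :=
  ∀ k, ∀ t ∈ Icc 0 T,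
    IntervalIntegrable (fun τ => fderiv ℝ (v (μ.map (Φ τ)) τ) (Φ τ x) (u k τ) +
      nonlocalDeriv v μ (Φ τ) τ (Z k τ) (Φ τ x)) volume s t ∧
    u k t = u₀ k + ∫ τ in s..t, (fderiv ℝ (v (μ.map (Φ τ)) τ) (Φ τ x) (u k τ) +
      nonlocalDeriv v μ (Φ τ) τ (Z k τ) (Φ τ x))

variable {Φ Ψ : ℝ → Rd d → Rd d} {Z : κ → ℝ → Rd d → Rd d}

/-- The point `p` and the curves `u` are kept separate from `g` and `Z` for two uses: `p = g x` with
`u = Z` for points carried by the perturbed measure, and `p = x` with `u = w` for a fixed starting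
point. In both the measures are compared through `Z`, which explains the mean of the `Z`-remainder.
-/
theorem IsLinearizedCurve.exists_remainder {x p : Rd d} {u₀ : κ → Rd d} {u : κ → ℝ → Rd d}
    (h : IsLinearizedCurve v μ T s Φ Z x u₀ u) (hv : HypothesesWith v M L₁ L₂) (hK : IsCompact K)
    (hμ : ProbOn K μ) (hΦ : IsNonlocalFlow v s μ Φ) {g : Rd d → Rd d} (hg : ContinuousOn g K)
    (hΨ : IsNonlocalFlow v s (μ.map g) Ψ) (hZ : ∀ k τ, ContinuousOn (Z k τ) K)
    (e : EuclideanSpace ℝ κ) :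
    ∃ q : ℝ → Rd d,
      (∀ t ∈ Icc 0 T, Ψ t p - Φ t x - ∑ k, e k • u k t =
        (p - x - ∑ k, e k • u₀ k) + ∫ τ in s..t, q τ) ∧
      ∀ τ ∈ Icc 0 T, ‖q τ‖ ≤ L₁ * ‖Ψ τ p - Φ τ x - ∑ k, e k • u k τ‖ +
        L₂ * ∫ y, ‖Ψ τ (g y) - Φ τ y - ∑ k, e k • Z k τ y‖ ∂μ +
        ‖linearizationError v μ (Φ τ) τ (fun k => Z k τ) (Φ τ x) (fun k => u k τ) e‖ := by
  have hmap : ∀ τ, (μ.map g).map (Ψ τ) = μ.map fun y => Ψ τ (g y) := fun τ =>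
    AEMeasurable.map_map_of_aemeasurable (hΨ.1 τ).aemeasurable
      (aemeasurable_of_ae_mem_isCompact hK hμ.2 hg)
  refine ⟨fun τ => v ((μ.map g).map (Ψ τ)) τ (Ψ τ p) - v (μ.map (Φ τ)) τ (Φ τ x) -
    ∑ k, e k • (fderiv ℝ (v (μ.map (Φ τ)) τ) (Φ τ x) (u k τ) +
      nonlocalDeriv v μ (Φ τ) τ (Z k τ) (Φ τ x)), fun t ht => ?_, fun τ hτ => ?_⟩
  · have hi : ∀ k, IntervalIntegrable (fun τ => e k • (fderiv ℝ (v (μ.map (Φ τ)) τ) (Φ τ x)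
        (u k τ) + nonlocalDeriv v μ (Φ τ) τ (Z k τ) (Φ τ x))) volume s t := fun k =>
      (h k t ht).1.smul (e k)
    have hsum : IntervalIntegrable (fun τ => ∑ k, e k • (fderiv ℝ (v (μ.map (Φ τ)) τ) (Φ τ x)
        (u k τ) + nonlocalDeriv v μ (Φ τ) τ (Z k τ) (Φ τ x))) volume s t := by
      refine (IntervalIntegrable.sum Finset.univ fun k _ => hi k).congr fun τ _ => ?_
      rw [Finset.sum_apply]
    rw [intervalIntegral.integral_sub ((hΨ.2 t p).1.sub (hΦ.2 t x).1) hsum,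
      intervalIntegral.integral_sub (hΨ.2 t p).1 (hΦ.2 t x).1,
      intervalIntegral.integral_finsetSum fun k _ => hi k]
    simp only [intervalIntegral.integral_smul]
    have h1 : ∀ k, e k • u k t = e k • u₀ k + e k • ∫ τ in s..t,
        (fderiv ℝ (v (μ.map (Φ τ)) τ) (Φ τ x) (u k τ) +
          nonlocalDeriv v μ (Φ τ) τ (Z k τ) (Φ τ x)) := fun k => by
      rw [← smul_add, ← (h k t ht).2]
    rw [Finset.sum_congr rfl fun k _ => h1 k, Finset.sum_add_distrib, (hΨ.2 t p).2, (hΦ.2 t x).2]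
    abel
  · have hZe : ContinuousOn (fun y => Φ τ y + ∑ k, e k • Z k τ y) K :=
      (hΦ.1 τ).continuousOn.add (continuousOn_finsetSum _ fun k _ => (hZ k τ).const_smul (e k))
    have h1 := hv.norm_sub_map_le hK hμ (f := fun y => Ψ τ (g y)) ((hΨ.1 τ).comp_continuousOn hg)
      hZe τ (Ψ τ p) (Φ τ x + ∑ k, e k • u k τ)
    simp only [← sub_sub] at h1
    refine le_trans ?_ (add_le_add_left h1 _)
    refine le_trans (le_of_eq ?_) (norm_add_le _ _)
    congr 1
    beta_reduce
    rw [linearizationError, hmap]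
    abel

/-- The mean over the initial measure of the remainder of the perturbed flow. -/
theorem integral_remainder_le (hv : HypothesesWith v M L₁ L₂) (hK : IsCompact K)
    (hμ : ProbOn K μ) (hS : IsWassersteinDifferentiableField (Icc 0 T) v) (hs : s ∈ Icc 0 T)
    (hΦ : IsNonlocalFlow v s μ Φ) {g : Rd d → Rd d} (hg : ContinuousOn g K)
    (hgK : ProbOn K (μ.map g)) (hΨ : IsNonlocalFlow v s (μ.map g) Ψ)
    (hZ : ∀ k, Continuous (Function.uncurry (Z k))) {F : κ → Rd d → Rd d}
    (hF : ∀ k, Continuous (F k))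
    (h : ∀ x, IsLinearizedCurve v μ T s Φ Z x (fun k => F k x) fun k τ => Z k τ x)
    (e : EuclideanSpace ℝ κ) {t : ℝ} (ht : t ∈ Icc 0 T) :
    ∫ y, ‖Ψ t (g y) - Φ t y - ∑ k, e k • Z k t y‖ ∂μ ≤
      Real.exp ((2 * L₁ + 4 * L₂) * T) * (4 * (∫ y, ‖g y - y - ∑ k, e k • F k y‖ ∂μ +
        ∫ y, (∫ τ in Icc 0 T, ‖linearizationError v μ (Φ τ) τ (fun k => Z k τ) (Φ τ y)
          (fun k => Z k τ y) e‖) ∂μ)) := by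
  have := hμ.1
  have hL₁ := hv.L₁_pos
  have hL₂ := hv.L₂_pos
  -- As for uniqueness: `2 L₁ ≤ l` for the local Grönwall estimate, and `2 L₂ b / l ≤ b / 2` for the
  -- mean.
  set l := 2 * L₁ + 4 * L₂ with hl
  have hl0 : 0 < l := by positivity
  have hΦc := hΦ.continuous_uncurry hv hK hμ
  have hΨc := hΨ.continuous_uncurry hv hK hgK
  have hinj : ∀ τ, InjOn (Φ τ) K := fun τ => (hΦ.injective hv hK hμ τ).injOn
  have hZτ : ∀ k τ, Continuous (Z k τ) := fun k τ =>
    (hZ k).comp (by fun_prop : Continuous fun y : Rd d => (τ, y))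
  have hZy : ∀ k y, Continuous fun τ => Z k τ y := fun k y =>
    (hZ k).comp (by fun_prop : Continuous fun τ : ℝ => (τ, y))
  have hcpt : IsCompact (Icc 0 T ×ˢ K) := isCompact_Icc.prod hK
  set err : Rd d → ℝ → Rd d := fun y τ => linearizationError v μ (Φ τ) τ (fun k => Z k τ) (Φ τ y)
    (fun k => Z k τ y) e with herr
  set r : ℝ → Rd d → Rd d := fun τ y => Ψ τ (g y) - Φ τ y - ∑ k, e k • Z k τ y with hr
  have hrc : ContinuousOn (fun p : ℝ × Rd d => r p.1 p.2) (Icc 0 T ×ˢ K) := by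
    refine ContinuousOn.sub (ContinuousOn.sub ?_ hΦc.continuousOn)
      (continuousOn_finsetSum _ fun k _ => (hZ k).continuousOn.const_smul (e k))
    have h1 : ContinuousOn (fun p : ℝ × Rd d => (p.1, g p.2)) (Icc 0 T ×ˢ K) :=
      continuousOn_fst.prodMk (hg.comp continuousOn_snd fun p hp => hp.2)
    exact hΨc.comp_continuousOn h1
  obtain ⟨b₀, hb₀⟩ := hcpt.exists_bound_of_continuousOn hrc
  obtain ⟨C, hC0, hC⟩ := hv.exists_norm_linearizationError_le hK hμ hS hΦc hinj hZ hK hZ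
  have herrB : ∀ τ ∈ Icc 0 T, ∀ y ∈ K, ‖err y τ‖ ≤ C * ‖e‖ := hC e
  have herrm : ∀ y, AEStronglyMeasurable (err y) (volume.restrict (Icc 0 T)) := fun y =>
    hv.aestronglyMeasurable_linearizationError hK hμ measurableSet_Icc hS hΦc hinj hZ
      (hΦ.continuous_time y) (fun k => hZy k y) e
  have herri : ∀ y ∈ K, IntegrableOn (fun τ => ‖err y τ‖) (Icc 0 T) := fun y hy => by
    refine Integrable.of_bound (herrm y).norm (C * ‖e‖) ?_
    exact ae_restrict_of_forall_mem measurableSet_Icc fun τ hτ => by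
      rw [norm_norm]
      exact herrB τ hτ y hy
  set A : Rd d → ℝ := fun y => ∫ τ in Icc 0 T, ‖err y τ‖ with hA
  have hAc : ContinuousOn A K :=
    hv.continuousOn_integral_linearizationError hK hμ hS hΦc hinj hZ e
  have hr₀c : ContinuousOn (fun y => ‖g y - y - ∑ k, e k • F k y‖) K :=
    ((hg.sub continuousOn_id).sub (continuousOn_finsetSum _ fun k _ =>
      (hF k).continuousOn.const_smul (e k))).norm
  have hAi := integrable_of_ae_mem_isCompact hK hμ.2 hAc
  have hr₀i := integrable_of_ae_mem_isCompact hK hμ.2 hr₀c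
  rw [← integral_add hr₀i hAi]
  have hA0 : ∀ y, 0 ≤ A y := fun y => integral_nonneg fun _ => norm_nonneg _
  set Q := ∫ y, (‖g y - y - ∑ k, e k • F k y‖ + A y) ∂μ with hQ
  have hQ0 : 0 ≤ Q := integral_nonneg fun y => add_nonneg (norm_nonneg _) (hA0 y)
  have key := le_two_mul_of_bootstrap (I := Icc 0 T)
    (u := fun t => (∫ y, ‖r t y‖ ∂μ) / Real.exp (l * |t - s|)) (A := 2 * Q) (b₀ := b₀)
    (by positivity) (fun t ht => (div_le_self (integral_nonneg fun _ => norm_nonneg _)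
      (Real.one_le_exp (by positivity))).trans
      (integral_norm_le_of_forall_mem hμ fun y hy => hb₀ (t, y) ⟨ht, hy⟩)) (by
      intro b hb hbI t ht
      rw [div_le_iff₀ (Real.exp_pos _)]
      -- For each `y` the mean enters as a known forcing of size `L₂ b` times the exponential
      -- weight. Integrating the resulting pointwise bound over `μ` closes the bootstrap on the mean
      -- itself.
      have h1 : ∀ y ∈ K, ‖r t y‖ ≤ Real.exp (l * |t - s|) *
          (2 * (L₂ * b / l) + 2 * (‖g y - y - ∑ k, e k • F k y‖ + A y)) := by
        intro y hy
        obtain ⟨q, hq1, hq2⟩ := (h y).exists_remainder (p := g y) hv hK hμ hΦ hg hΨ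
          (fun k τ => (hZτ k τ).continuousOn) e
        have hsub : ∀ t' ∈ Icc 0 T, uIoc s t' ⊆ Icc 0 T := fun t' ht' =>
          uIoc_subset_of_ordConnected ordConnected_Icc hs ht'
        exact norm_le_of_integral_inequality (I := Icc 0 T) ordConnected_Icc hs
          (r := fun t => r t y) (q := q) (g := fun τ => ‖err y τ‖)
          (r₀ := g y - y - ∑ k, e k • F k y) (L := L₁) (c := L₂ * b) (l := l) (G := A y)
          (b₀ := b₀) hL₁.le (by positivity) hl0 (by linarith) hq1 (fun τ hτ => by
            have h2 := hbI τ hτ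
            rw [div_le_iff₀ (Real.exp_pos _)] at h2
            have h3 := mul_le_mul_of_nonneg_left h2 hL₂.le
            have h4 := hq2 τ hτ
            rw [← mul_assoc] at h3
            exact h4.trans (add_le_add_left (add_le_add_right h3 _) _)) (fun t' ht' => by
            rw [intervalIntegrable_iff]
            exact (herri y hy).mono_set (hsub t' ht')) (fun t' ht' => by
            rw [intervalIntegral.abs_integral_eq_abs_integral_uIoc, abs_of_nonneg
              (integral_nonneg fun _ => norm_nonneg _)]
            exact setIntegral_mono_set (herri y hy) (Eventually.of_forall fun _ => norm_nonneg _)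
              (hsub t' ht').eventuallyLE) (fun t' ht' => hb₀ (t', y) ⟨ht', hy⟩) t ht
      have h2 : ∫ y, ‖r t y‖ ∂μ ≤ ∫ y, Real.exp (l * |t - s|) *
          (2 * (L₂ * b / l) + 2 * (‖g y - y - ∑ k, e k • F k y‖ + A y)) ∂μ := by
        refine integral_mono_of_nonneg (Eventually.of_forall fun _ => norm_nonneg _) ?_ ?_
        · exact ((integrable_const _).add ((hr₀i.add hAi).const_mul 2)).const_mul _
        · filter_upwards [hμ.ae_mem] with y hy using h1 y hy
      have h3 : ∫ y, (2 * (L₂ * b / l) + 2 * (‖g y - y - ∑ k, e k • F k y‖ + A y)) ∂μ =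
          2 * (L₂ * b / l) + 2 * Q := by
        rw [integral_add (f := fun _ => 2 * (L₂ * b / l))
          (g := fun y => 2 * (‖g y - y - ∑ k, e k • F k y‖ + A y)) (integrable_const _)
          ((hr₀i.add hAi).const_mul 2), integral_const, probReal_univ, one_smul,
          integral_const_mul]
      rw [integral_const_mul, h3] at h2
      refine h2.trans ?_
      rw [mul_comm]
      refine mul_le_mul_of_nonneg_right (add_le_add_left ?_ _) (Real.exp_pos _).le
      rw [mul_div_assoc', div_le_iff₀ hl0]
      have : 0 ≤ L₁ * b := by positivity
      rw [hl]
      linarith) t ht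
  simp only [div_le_iff₀ (Real.exp_pos _)] at key
  refine key.trans ?_
  -- One factor 2 comes from the pointwise Grönwall estimate and the other from the bootstrap.
  rw [← mul_assoc, mul_comm, show (2 : ℝ) * 2 = 4 by norm_num]
  refine mul_le_mul_of_nonneg_right (Real.exp_le_exp.2 ?_) (by positivity)
  refine mul_le_mul_of_nonneg_left ?_ hl0.le
  rw [abs_le]
  constructor <;> linarith [ht.1, ht.2, hs.1, hs.2]

end Remainder

end

noncomputable section

/-! ### Differentiability of the perturbed flow at `e = 0` -/

section Differentiability

variable {d N : ℕ} {v : Measure (Rd d) → ℝ → Rd d → Rd d} {M L₁ L₂ : ℝ} {K : Set (Rd d)}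
  {μ : Measure (Rd d)} {T s ε : ℝ} {G : EuclideanSpace ℝ (Fin N) → Rd d → Rd d}
  {F : Fin N → Rd d → Rd d}

namespace IsPerturbation

theorem congr (hG : IsPerturbation K ε μ G F) {F' : Fin N → Rd d → Rd d}
    (h : ∀ k, EqOn (F k) (F' k) K) : IsPerturbation K ε μ G F' := by
  refine ⟨hG.continuousOn, hG.map_zero, fun η hη => ?_, hG.support,
    fun k => (hG.continuousOn_deriv k).congr (h k).symm⟩
  obtain ⟨δ, hδ, H⟩ := hG.differentiable η hη
  refine ⟨δ, hδ, fun e he heδ x hx => ?_⟩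
  have h1 : ∑ k, e k • F' k x = ∑ k, e k • F k x :=
    Finset.sum_congr rfl fun k _ => by rw [h k hx]
  rw [h1]
  exact H e he heδ x hx

theorem continuousOn_apply (hG : IsPerturbation K ε μ G F) {e : EuclideanSpace ℝ (Fin N)}
    (he : e ∈ cube N ε) : ContinuousOn (G e) K :=
  hG.continuousOn.comp (f := fun x => (e, x)) (by fun_prop) fun _ hx => ⟨he, hx⟩

theorem probOn_map (hG : IsPerturbation K ε μ G F) (hK : IsCompact K) (hμ : ProbOn K μ)
    {e : EuclideanSpace ℝ (Fin N)} (he : e ∈ cube N ε) : ProbOn K (μ.map (G e)) := by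
  have := hμ.1
  exact ⟨Measure.isProbabilityMeasure_map (aemeasurable_of_ae_mem_isCompact hK hμ.2
    (hG.continuousOn_apply he)), hG.support e he⟩

theorem map_zero_eq (hG : IsPerturbation K ε μ G F) (hμ : ProbOn K μ) : μ.map (G 0) = μ := by
  have h1 : G 0 =ᵐ[μ] id := by
    filter_upwards [hμ.ae_mem] with y hy using hG.map_zero y hy
  rw [Measure.map_congr h1, Measure.map_id]

theorem isLittleO_integral (hG : IsPerturbation K ε μ G F) (hμ : ProbOn K μ) :
    (fun e => ∫ y, ‖G e y - y - ∑ k, e k • F k y‖ ∂μ) =o[𝓝[cube N ε] 0] fun e => e := by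
  rw [Asymptotics.isLittleO_iff]
  intro η hη
  obtain ⟨δ, hδ, H⟩ := hG.differentiable η hη
  have hnear : ∀ᶠ e : EuclideanSpace ℝ (Fin N) in 𝓝[cube N ε] 0, ‖e‖ < δ := by
    refine eventually_nhdsWithin_of_eventually_nhds ?_
    exact (continuous_norm.tendsto' 0 0 norm_zero).eventually_lt_const hδ
  filter_upwards [hnear, self_mem_nhdsWithin] with e he hec
  rw [Real.norm_of_nonneg (integral_nonneg fun _ => norm_nonneg _)]
  refine integral_norm_le_of_forall_mem hμ fun y hy => ?_
  have := H e hec he y hy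
  rwa [hG.map_zero y hy] at this

end IsPerturbation

namespace HypothesesWith

/-- The direction along which the transported measure is perturbed. -/
theorem isLinearizedCurve_direction (hv : HypothesesWith v M L₁ L₂) (hK : IsCompact K)
    (hμ : ProbOn K μ) {w : Fin N → ℝ → Rd d → Rd d}
    (hw : ∀ k, IsLinearizedSolution v T s μ (F k) (w k)) (x : Rd d) :
    IsLinearizedCurve v μ T s (nonlocalFlow v s μ)
      (fun k τ y => fderiv ℝ (nonlocalFlow v s μ τ) y (F k y) + w k τ y) x (fun k => F k x)
      fun k τ => fderiv ℝ (nonlocalFlow v s μ τ) x (F k x) + w k τ x := by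
  obtain ⟨J, -, hJ, hJi⟩ := (hv.isNonlocalFlow_nonlocalFlow hK hμ s).exists_hasFDerivAt hv hK hμ
  intro k t ht
  obtain ⟨h1, h2⟩ := (hw k).2 t ht x
  obtain ⟨h3, h4⟩ := hJi t x
  have h5 : IntervalIntegrable (fun τ => fderiv ℝ (v (μ.map (nonlocalFlow v s μ τ)) τ)
      (nonlocalFlow v s μ τ x) (J τ x (F k x))) volume s t :=
    ⟨(ContinuousLinearMap.apply ℝ (Rd d) (F k x)).integrable_comp h3.1,
      (ContinuousLinearMap.apply ℝ (Rd d) (F k x)).integrable_comp h3.2⟩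
  have h6 := ContinuousLinearMap.intervalIntegral_apply h3 (F k x)
  have hfd : ∀ τ y, fderiv ℝ (nonlocalFlow v s μ τ) y = J τ y := fun τ y => (hJ τ y).fderiv
  -- The part `DΦ F` solves the local linearized equation with initial value `F`, and `w` carries
  -- the whole nonlocal forcing from the initial value zero; the equation of the direction is their
  -- sum.
  have h7 : ∀ τ, fderiv ℝ (v (μ.map (nonlocalFlow v s μ τ)) τ) (nonlocalFlow v s μ τ x)
        (fderiv ℝ (nonlocalFlow v s μ τ) x (F k x) + w k τ x) +
      nonlocalDeriv v μ (nonlocalFlow v s μ τ) τ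
        (fun y => fderiv ℝ (nonlocalFlow v s μ τ) y (F k y) + w k τ y) (nonlocalFlow v s μ τ x) =
      fderiv ℝ (v (μ.map (nonlocalFlow v s μ τ)) τ) (nonlocalFlow v s μ τ x) (J τ x (F k x)) +
        linearizedField v s μ (F k) (w k) τ x := fun τ => by
    rw [linearizedField_eq, map_add, add_assoc, hfd τ x]
  simp only [h7]
  refine ⟨h5.add h1, ?_⟩
  rw [intervalIntegral.integral_add h5 h1, ← h2, ← add_assoc, hfd, add_left_inj]
  conv_lhs => rw [h4, add_apply, ContinuousLinearMap.id_apply]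
  exact congrArg _ h6

/-- The perturbed flow is differentiable with respect to the perturbation. -/
theorem hasFDerivWithinAt_nonlocalFlow (hv : HypothesesWith v M L₁ L₂) (hK : IsCompact K)
    (hμ : ProbOn K μ) (hS : IsWassersteinDifferentiableField (Icc 0 T) v) (hs : s ∈ Icc 0 T)
    (hG : IsPerturbation K ε μ G F) (hF : ∀ k, Continuous (F k)) {w : Fin N → ℝ → Rd d → Rd d}
    (hwc : ∀ k, Continuous (Function.uncurry (w k)))
    (hw : ∀ k, IsLinearizedSolution v T s μ (F k) (w k)) {t : ℝ} (ht : t ∈ Icc 0 T) (x : Rd d) :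
    HasFDerivWithinAt (fun e => nonlocalFlow v s (μ.map (G e)) t x)
      (∑ k, (EuclideanSpace.proj (𝕜 := ℝ) k).smulRight (w k t x)) (cube N ε) 0 := by
  have := hμ.1
  have hL₁ := hv.L₁_pos
  have hL₂ := hv.L₂_pos
  have hflow := hv.isNonlocalFlow_nonlocalFlow hK hμ s
  have hJc := hv.fderiv_nonlocalFlow hK hμ s
  have hdir := hv.isLinearizedCurve_direction hK hμ hw
  have hwcurve : IsLinearizedCurve v μ T s (nonlocalFlow v s μ)
      (fun k τ y => fderiv ℝ (nonlocalFlow v s μ τ) y (F k y) + w k τ y) x (fun _ => 0)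
      fun k τ => w k τ x := fun k t ht => by
    obtain ⟨h1, h2⟩ := (hw k).2 t ht x
    refine ⟨h1, ?_⟩
    rw [zero_add]
    exact h2
  set Φ := nonlocalFlow v s μ with hΦdef
  -- A point of the perturbed measure moves for two reasons: its starting point is displaced by `F
  -- k`, and the flow itself changes by `w k`.
  set Z : Fin N → ℝ → Rd d → Rd d := fun k τ y => fderiv ℝ (Φ τ) y (F k y) + w k τ y with hZdef
  have hΦc := hflow.continuous_uncurry hv hK hμ
  have hinj : ∀ τ, InjOn (Φ τ) K := fun τ => (hflow.injective hv hK hμ τ).injOn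
  have hZ : ∀ k, Continuous (Function.uncurry (Z k)) := fun k =>
    (hJc.clm_apply ((hF k).comp continuous_snd)).add (hwc k)
  have hZτ : ∀ k τ, Continuous (Z k τ) := fun k τ =>
    (hZ k).comp (by fun_prop : Continuous fun y : Rd d => (τ, y))
  have hZy : ∀ k y, Continuous fun τ => Z k τ y := fun k y =>
    (hZ k).comp (by fun_prop : Continuous fun τ : ℝ => (τ, y))
  have hwx : ∀ k, Continuous fun τ => w k τ x := fun k =>
    (hwc k).comp (by fun_prop : Continuous fun τ : ℝ => (τ, x))
  have hΨ : ∀ e ∈ cube N ε, IsNonlocalFlow v s (μ.map (G e)) (nonlocalFlow v s (μ.map (G e))) :=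
    fun e he => hv.isNonlocalFlow_nonlocalFlow hK (hG.probOn_map hK hμ he) s
  obtain ⟨C, hC0, hC⟩ := hv.exists_norm_linearizationError_le hK hμ hS hΦc hinj hZ hK hZ
  obtain ⟨C', hC0', hC'⟩ := hv.exists_norm_linearizationError_le hK hμ hS hΦc hinj hZ
    (isCompact_singleton (x := x)) hwc
  set A : EuclideanSpace ℝ (Fin N) → Rd d → ℝ := fun e y => ∫ τ in Icc 0 T,
    ‖linearizationError v μ (Φ τ) τ (fun k => Z k τ) (Φ τ y) (fun k => Z k τ y) e‖ with hA
  set Q : EuclideanSpace ℝ (Fin N) → ℝ := fun e =>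
    4 * (∫ y, ‖G e y - y - ∑ k, e k • F k y‖ ∂μ + ∫ y, A e y ∂μ) with hQ
  have hA0 : ∀ e y, 0 ≤ A e y := fun e y => integral_nonneg fun _ => norm_nonneg _
  have hQ0 : ∀ e, 0 ≤ Q e := fun e => mul_nonneg (by norm_num)
    (add_nonneg (integral_nonneg fun _ => norm_nonneg _) (integral_nonneg (hA0 e)))
  -- Two nested dominated convergences: in time for each fixed `y`, then over `μ`.
  have hAo : (fun e => ∫ y, A e y ∂μ) =o[𝓝[cube N ε] 0] fun e => e := by
    have h1 := isLittleO_integral_norm (ρ := μ) (l := 𝓝[cube N ε] 0) (g := A) (C := C * T)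
      (mul_nonneg hC0 (hs.1.trans hs.2))
      (Eventually.of_forall fun e => (integrable_of_ae_mem_isCompact hK hμ.2
        (hv.continuousOn_integral_linearizationError hK hμ hS hΦc hinj hZ e)).1)
      (Eventually.of_forall fun e => by
        filter_upwards [hμ.ae_mem] with y hy
        have h2 : ∀ᵐ τ ∂(volume.restrict (Icc 0 T)), ‖‖linearizationError v μ (Φ τ) τ
            (fun k => Z k τ) (Φ τ y) (fun k => Z k τ y) e‖‖ ≤ C * ‖e‖ :=
          ae_restrict_of_forall_mem measurableSet_Icc fun τ hτ => by
            rw [norm_norm]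
            exact hC e τ hτ y hy
        refine (norm_integral_le_of_norm_le_const h2).trans_eq ?_
        rw [measureReal_restrict_apply_univ, Real.volume_real_Icc_of_le (hs.1.trans hs.2)]
        ring) (by
        filter_upwards [hμ.ae_mem] with y hy
        exact isLittleO_integral_norm hC0 (Eventually.of_forall fun e =>
          hv.aestronglyMeasurable_linearizationError hK hμ measurableSet_Icc hS hΦc hinj hZ
            (hflow.continuous_time y) (fun k => hZy k y) e)
          (Eventually.of_forall fun e => ae_restrict_of_forall_mem measurableSet_Icc
            fun τ hτ => hC e τ hτ y hy)
          (ae_restrict_of_forall_mem measurableSet_Icc fun τ hτ =>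
            (hv.isLittleO_linearizationError hK hμ hS hτ (hflow.1 τ).continuousOn (hinj τ)
              (fun k => (hZτ k τ).continuousOn) _ _).mono nhdsWithin_le_nhds))
    simpa only [Real.norm_of_nonneg (hA0 _ _)] using h1
  have hQo : Q =o[𝓝[cube N ε] 0] fun e => e :=
    ((hG.isLittleO_integral hμ).add hAo).const_mul_left _
  -- The starting point `x` is now fixed and need not lie in `K`, so the curves are `w k` with zero
  -- initial value. The mean of the `Z`-remainder, already shown to be `o(e)`, enters as the
  -- constant forcing `c`.
  have key := isLittleO_of_integral_inequality (l := 𝓝[cube N ε] 0) (a := 0) (b := T) (s := s)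
    (r := fun e τ => nonlocalFlow v s (μ.map (G e)) τ x - Φ τ x - ∑ k, e k • w k τ x)
    (err := fun e τ => linearizationError v μ (Φ τ) τ (fun k => Z k τ) (Φ τ x)
      (fun k => w k τ x) e) (r₀ := fun _ => 0)
    (c := fun e => L₂ * (Real.exp ((2 * L₁ + 4 * L₂) * T) * Q e)) (L := L₁) (C := C')
    hs hL₁ hC0' (by
      filter_upwards [self_mem_nhdsWithin] with e he
      obtain ⟨q, hq1, hq2⟩ := hwcurve.exists_remainder (p := x) hv hK hμ hflow
        (hG.continuousOn_apply he) (hΨ e he) (fun k τ => (hZτ k τ).continuousOn) e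
      refine ⟨q, fun t ht => ?_, fun τ hτ => (hq2 τ hτ).trans ?_⟩
      · rw [hq1 t ht]
        simp
      · have h1 := integral_remainder_le hv hK hμ hS hs hflow (hG.continuousOn_apply he)
          (hG.probOn_map hK hμ he) (hΨ e he) hZ hF hdir e hτ
        exact add_le_add_left (add_le_add_right (mul_le_mul_of_nonneg_left h1 hL₂.le) _) _) (by
      filter_upwards [self_mem_nhdsWithin] with e he
      exact isCompact_Icc.exists_bound_of_continuousOn ((((hΨ e he).continuous_time x).sub
        (hflow.continuous_time x)).sub (continuous_finsetSum _ fun k _ =>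
          (hwx k).const_smul (e k))).continuousOn)
    (Eventually.of_forall fun e => hv.aestronglyMeasurable_linearizationError hK hμ
      measurableSet_Icc hS hΦc hinj hZ (hflow.continuous_time x) hwx e)
    (Eventually.of_forall fun e τ hτ => hC' e τ hτ x rfl)
    (fun τ hτ => (hv.isLittleO_linearizationError hK hμ hS hτ (hflow.1 τ).continuousOn (hinj τ)
      (fun k => (hZτ k τ).continuousOn) _ _).mono nhdsWithin_le_nhds)
    (Asymptotics.isLittleO_zero _ _)
    (fun e => mul_nonneg hL₂.le (mul_nonneg (Real.exp_pos _).le (hQ0 e)))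
    ((hQo.const_mul_left _).const_mul_left _) t ht
  rw [hasFDerivWithinAt_iff_isLittleO]
  simp only [hG.map_zero_eq hμ, sub_zero]
  refine key.congr_left fun e => ?_
  simp [hΦdef]

end HypothesesWith

end Differentiability

end
theorem mainTheorem4 {d N : ℕ} (hN : 1 ≤ N) (T : ℝ) (hT : 0 < T) (s : ℝ) (hs : s ∈ Icc 0 T)
    (K : Set (Rd d)) (hK : IsCompact K) (μ : Measure (Rd d)) (hμ : ProbOn K μ)
    (v : Measure (Rd d) → ℝ → Rd d → Rd d) (hv : HypothesesH v)
    (hreg : ∀ K' : Set (Rd d), IsCompact K' → ∀ i : Fin d, ∀ t ∈ Icc 0 T, ∀ x ∈ K',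
      IsRegularOn K' (fun ν => v ν t x i))
    (hdiff : ∀ K' : Set (Rd d), IsCompact K' → ∀ i : Fin d,
      IsWassersteinDifferentiableOn K' (Icc (0 : ℝ) T ×ˢ K')
        (fun (a : ℝ × Rd d) ν => v ν a.1 a.2 i))
    (ε : ℝ) (hε : 0 < ε) (G : EuclideanSpace ℝ (Fin N) → Rd d → Rd d)
    (F : Fin N → Rd d → Rd d) (hG : IsPerturbation K ε μ G F) :
    ∃ w : Fin N → ℝ → Rd d → Rd d,
      (∀ k, IsLinearizedSolution v T s μ (F k) (w k) ∧
        ∀ w', IsLinearizedSolution v T s μ (F k) w' →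
          ∀ t ∈ Icc 0 T, ∀ x, w' t x = w k t x) ∧
      ∀ t ∈ Icc 0 T, ∀ x, ∃ D : EuclideanSpace ℝ (Fin N) →L[ℝ] Rd d,
        HasFDerivWithinAt (fun e => nonlocalFlow v s (μ.map (G e)) t x) D (cube N ε) 0 ∧
        ∀ σ, D σ = ∑ k, σ k • w k t x := by
  obtain ⟨M, L₁, L₂, hv'⟩ := hv.exists_with
  have hS : IsWassersteinDifferentiableField (Icc 0 T) v := hdiff
  -- The existence and differentiability arguments need directions continuous on the whole space; as
  -- the extensions agree with `F k` on `K`, both the linearized problem and the perturbation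
  -- hypothesis transfer.
  choose F' hF' hFF' using fun k => exists_continuous_eqOn hK.isClosed (hG.continuousOn_deriv k)
  have hae : ∀ k, F k =ᵐ[μ] F' k := fun k => by
    filter_upwards [hμ.ae_mem] with y hy using hFF' k hy
  choose w hwc hw using fun k => hv'.exists_linearized hK hμ hS hs (hF' k)
  refine ⟨w, fun k => ⟨(hw k).congr (hae k).symm, fun w' hw' =>
    hv'.eqOn_of_isLinearizedSolution hK hμ hS hs (hF' k) (hw k) (hw'.congr (hae k))⟩,
    fun t ht x => ⟨_, hv'.hasFDerivWithinAt_nonlocalFlow hK hμ hS hs (hG.congr hFF') hF' hwc hw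
      ht x, fun σ => ?_⟩⟩
  simp
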